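/- **Setting.** Let $d_1,d_2,d'\ge 1$, $A=\mathbb R^{d'}$, $T>0$, $\epsilon>0$, and let $b:\mathbb R^{d_1}\times A\to\mathbb R^{d_1}$, $\ell:A\to\mathbb R$, $L:\mathbb R^{d_1}\times\mathbb R^{d_2}\to\mathbb R$ satisfy the following. * *(Regularity)* All derivatives $\nabla_x^k\nabla_a^l b$ with $k+l\le 4$ exist, are jointly continuous, and satisfy $|\nabla_x^k\nabla_a^l b(x,a)|\le C(1+|a|^{k+1})(1+|x|^l)$; $b(x,0)=0$ for all $x$. The function $\ell$ is convex and $C^2$, with $\nabla^2\ell(a)\ge c(1+|a|^2)I_{d'}$ for some $c>0$. The function $L$ is $C^3$, bounded from below, and $\sup_{x,y}\frac{|L|}{1+|x|^2+|y|^2}+\sum_{j=1}^3\frac{|\nabla^jL|}{1+|x|+|y|}<\infty$. * *(Discriminating property)* For all random variables $X,Z$ with values in $\mathbb R^{d_1}$ on a common probability space, with $Z$ integrable: if $\mathbb E[b(X,a)\cdot Z]=0$ for all $a\in A$, then $\mathbb E[Z|X]=0$ almost surely. Write $b(x,\nu)=\int_A b(x,a)\,d\nu(a)$ for a (signed) measure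 $\nu$ on $A$, and $\nu^\infty(da)=e^{-\ell(a)}da/\int_A e^{-\ell}$. Let $\mathcal C^k_p$ be the space of $C^k$ functions on $\mathbb R^{d_1}\times\mathbb R^{d_2}$ with finite norm $\sup\sum_{j\le k}|D^j\varphi|/(1+|x|^p+|y|^p)$, and let $\mathcal C^1_{2,1}$ be the space of $C^1$ functions $\varphi$ with $\varphi\in\mathcal C^0_2$, $\nabla\varphi\in\mathcal C^0_1$. Let $\mathcal P_p$ be the space of probability measures on $\mathbb R^{d_1}\times\mathbb R^{d_2}$ with finite $p$-th moment, $\mathcal P_2$ being endowed with the Monge–Kantorovich distance of order 2. **First-order system.** Let $t_0\in[0,T]$ and $\gamma_0\in\mathcal P_3$. A triple $(\nu,\gamma,u)$ solves the first-order system if: * $t\in[t_0,T]\mapsto\nu_t$ is a measurable family of probability measures on $A$ with $\int_{t_0}^T\mathcal E(\nu_t|\nu^\infty)\,dt<\infty$, where $\mathcal E$ is the relative entropy; * $\gamma\in\mathcal C([t_0,T],\mathcal P_2)$ is a weak solution, tested against $\mathcal C^1_b([t_0,T]\times\mathbb R^{d_1}\times\mathbb R^{d_2})$, of $\partial_t\gamma_t+\operatorname{div}_x(b(x,\nu_t)\gamma_t)=0$,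 $\gamma_{t_0}=\gamma_0$; * $u\in\mathcal C^{1/2}([t_0,T],\mathcal C^1_{2,1})$ satisfies $u_t=L+\int_t^Tb(x,\nu_s)\cdot\nabla_xu_s\,ds$ for all $t\in[t_0,T]$; * for every $t\in[t_0,T]$, $\nu_t$ has the density $$\nu_t(a)=\frac1{z_t}\exp\Bigl(-\ell(a)-\frac1\epsilon\int b(x,a)\cdot\nabla_xu_t(x,y)\,d\gamma_t(x,y)\Bigr),$$ with $z_t$ the normalizing constant. **Linearized system.** A triple $(\eta,\rho,v)$ solves the linearized system around $(\nu,\gamma,u)$, starting from $t_0$, if: * $t\in[t_0,T]\mapsto\eta_t$ is a measurable family of finite signed measures on $A$ with $\eta_t(A)=0$ for all $t$ and $$\int_{t_0}^T\!\int_A(1+|a|^4)\,d|\eta_t|\,dt+\sup_{t_1<t_2}\frac1{\sqrt{t_2-t_1}}\int_{t_1}^{t_2}\!\int_A(1+|a|^2)\,d|\eta_t|\,dt<\infty ;$$ * $\rho\in\mathcal C([t_0,T],(\mathcal C^2_2)^*)$ satisfies $$\sup_t\sup_{\phi\in\mathcal C^2_2,\ \|\phi\|_{\mathcal C^1_3}\le1}|\langle\phi;\rho_t\rangle|+\sup_{t_1<t_2}\frac{\|\rho_{t_2}-\rho_{t_1}\|_{(\mathcal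 C^2_2)^*}}{\sqrt{t_2-t_1}}<\infty$$ and is a weak solution of $\partial_t\rho_t+\operatorname{div}_x(b(x,\nu_t)\rho_t)=-\operatorname{div}_x(b(x,\eta_t)\gamma_t)$, $\rho_{t_0}=0$, that is, $$\langle\varphi_{t_1};\rho_{t_1}\rangle=\int_{t_0}^{t_1}\langle\partial_t\varphi_t+b(\cdot,\nu_t)\cdot\nabla_x\varphi_t;\rho_t\rangle\,dt+\int_{t_0}^{t_1}\!\int b(x,\eta_t)\cdot\nabla_x\varphi_t\,d\gamma_t\,dt$$ for all $t_1\in[t_0,T]$ and all test functions $\varphi$ such that $\varphi$ is bounded in $\mathcal C^2_2$ and continuous in $\mathcal C^1_2$, and $\partial_t\varphi,\nabla_x\varphi$ are bounded in $\mathcal C^2_1$ and continuous in $\mathcal C^1_2$ (as functions of $t\in[t_0,T]$); * $v\in\mathcal C([t_0,T],\mathcal C^1_1)$, $v_T=0$, and $v_{t_1}-v_{t_2}=\int_{t_1}^{t_2}\{b(x,\nu_t)\cdot\nabla_xv_t+b(x,\eta_t)\cdot\nabla_xu_t\}\,dt$ for all $t_1<t_2$ in $[t_0,T]$; * for every $t\in[t_0,T]$,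 $\eta_t$ has the density $$\eta_t(a)=-\frac{\nu_t(a)}\epsilon\Bigl[\langle b(\cdot,a)\cdot\nabla_xu_t;\rho_t\rangle+\int b(x,a)\cdot\nabla_xv_t(x,y)\,d\gamma_t(x,y)-c_t\Bigr],$$ with $c_t$ the constant for which $\eta_t(A)=0$. (This fixes the representative of $\eta$ at every time, so that the value $\eta_{t_0}$ is meaningful.) **Proposition.** Let $(\nu,\gamma,u)$ solve the first-order system with initial condition $(t_0,\gamma_0)$, and let $(\eta,\rho,v)$ solve the linearized system around $(\nu,\gamma,u)$, starting from $t_0$. If $\eta_{t_0}=0$, then $\eta_t=0$, $\rho_t=0$ and $v_t=0$ for all $t\in[t_0,T]$. -/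

import Mathlib

namespace NeuralODE

open MeasureTheory Set Filter Topology
open scoped ENNReal NNReal

/-- The Euclidean space `ℝᵈ`. -/
abbrev E (d : ℕ) : Type := EuclideanSpace ℝ (Fin d)

/-- The space `ℝ^{d₁} × ℝ^{d₂}` of pairs `z = (x, y)` (feature, label). -/
abbrev Phase (d₁ d₂ : ℕ) : Type := E d₁ × E d₂

noncomputable section

section Spaces

variable {d₁ d₂ : ℕ} {F : Type*} [NormedAddCommGroup F] [NormedSpace ℝ F]

/-- The norm of `𝒞ᵏ_p`, as an extended number:
`sup_{(x,y)} ∑_{j ≤ k} |Dʲ f (x,y)| / (1 + |x|ᵖ + |y|ᵖ)`. -/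
def growthNorm (k p : ℕ) (f : Phase d₁ d₂ → F) : ℝ≥0∞ :=
  ⨆ z : Phase d₁ d₂, ENNReal.ofReal
    ((∑ j ∈ Finset.range (k + 1), ‖iteratedFDeriv ℝ j f z‖) / (1 + ‖z.1‖ ^ p + ‖z.2‖ ^ p))

/-- `f ∈ 𝒞ᵏ_p`. -/
def MemGrowth (k p : ℕ) (f : Phase d₁ d₂ → F) : Prop :=
  ContDiff ℝ k f ∧ growthNorm k p f < ⊤

/-- The norm of `𝒞^{k+1}_{2,1}`: the function has quadratic growth, its derivatives of orders
`1, …, k + 1` have linear growth. -/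
def growthNorm21 (k : ℕ) (f : Phase d₁ d₂ → ℝ) : ℝ≥0∞ :=
  growthNorm 0 2 f + growthNorm k 1 (fderiv ℝ f)

theorem growthNorm_add_le {k p : ℕ} {f g : Phase d₁ d₂ → F}
    (hf : ContDiff ℝ k f) (hg : ContDiff ℝ k g) :
    growthNorm k p (f + g) ≤ growthNorm k p f + growthNorm k p g := by
  refine iSup_le fun z => ?_
  have hw : 0 ≤ 1 + ‖z.1‖ ^ p + ‖z.2‖ ^ p := by positivity
  have key : (∑ j ∈ Finset.range (k + 1), ‖iteratedFDeriv ℝ j (f + g) z‖)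
      ≤ (∑ j ∈ Finset.range (k + 1), ‖iteratedFDeriv ℝ j f z‖)
        + ∑ j ∈ Finset.range (k + 1), ‖iteratedFDeriv ℝ j g z‖ := by
    rw [← Finset.sum_add_distrib]
    refine Finset.sum_le_sum fun j hj => ?_
    have hjk : (j : WithTop ℕ∞) ≤ (k : WithTop ℕ∞) := by
      exact_mod_cast Nat.lt_succ_iff.mp (Finset.mem_range.mp hj)
    rw [iteratedFDeriv_add (hf.of_le hjk) (hg.of_le hjk)]
    exact norm_add_le _ _
  refine (ENNReal.ofReal_le_ofReal (div_le_div_of_nonneg_right key hw)).trans ?_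
  rw [add_div]
  refine ENNReal.ofReal_add_le.trans (add_le_add ?_ ?_)
  · exact le_iSup (fun z : Phase d₁ d₂ => ENNReal.ofReal
      ((∑ j ∈ Finset.range (k + 1), ‖iteratedFDeriv ℝ j f z‖) / (1 + ‖z.1‖ ^ p + ‖z.2‖ ^ p))) z
  · exact le_iSup (fun z : Phase d₁ d₂ => ENNReal.ofReal
      ((∑ j ∈ Finset.range (k + 1), ‖iteratedFDeriv ℝ j g z‖) / (1 + ‖z.1‖ ^ p + ‖z.2‖ ^ p))) z

theorem growthNorm_smul_le {k p : ℕ} (c : ℝ) {f : Phase d₁ d₂ → F} (hf : ContDiff ℝ k f) :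
    growthNorm k p (c • f) ≤ ENNReal.ofReal |c| * growthNorm k p f := by
  refine iSup_le fun z => ?_
  have key : (∑ j ∈ Finset.range (k + 1), ‖iteratedFDeriv ℝ j (c • f) z‖)
      = |c| * ∑ j ∈ Finset.range (k + 1), ‖iteratedFDeriv ℝ j f z‖ := by
    rw [Finset.mul_sum]
    refine Finset.sum_congr rfl fun j hj => ?_
    have hjk : (j : WithTop ℕ∞) ≤ (k : WithTop ℕ∞) := by
      exact_mod_cast Nat.lt_succ_iff.mp (Finset.mem_range.mp hj)
    rw [iteratedFDeriv_const_smul_apply (hf.of_le hjk).contDiffAt, norm_smul, Real.norm_eq_abs]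
  rw [key, mul_div_assoc, ENNReal.ofReal_mul (abs_nonneg c)]
  gcongr
  exact le_iSup (fun z : Phase d₁ d₂ => ENNReal.ofReal
      ((∑ j ∈ Finset.range (k + 1), ‖iteratedFDeriv ℝ j f z‖) / (1 + ‖z.1‖ ^ p + ‖z.2‖ ^ p))) z

theorem growthNorm_zero (k p : ℕ) : growthNorm k p (0 : Phase d₁ d₂ → F) = 0 := by
  have h : ∀ (j : ℕ) (z : Phase d₁ d₂), iteratedFDeriv ℝ j (0 : Phase d₁ d₂ → F) z = 0 := by
    intro j z
    have := iteratedFDeriv_fun_zero (𝕜 := ℝ) (E := Phase d₁ d₂) (F := F) (n := j)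
    exact congrFun this z
  simp [growthNorm, h]

variable (d₁ d₂) in
/-- The vector space `𝒞²_2` of real functions on `ℝ^{d₁} × ℝ^{d₂}`. -/
def C22 : Submodule ℝ (Phase d₁ d₂ → ℝ) where
  carrier := {f | MemGrowth 2 2 f}
  add_mem' := fun hf hg =>
    ⟨hf.1.add hg.1, (growthNorm_add_le hf.1 hg.1).trans_lt (ENNReal.add_lt_top.2 ⟨hf.2, hg.2⟩)⟩
  zero_mem' := ⟨contDiff_const, by rw [growthNorm_zero]; exact ENNReal.zero_lt_top⟩
  smul_mem' := fun c _ hf =>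
    ⟨hf.1.const_smul c,
      (growthNorm_smul_le c hf.1).trans_lt (ENNReal.mul_lt_top ENNReal.ofReal_lt_top hf.2)⟩

variable (d₁ d₂) in
/-- Linear forms on `𝒞²_2`; such a form belongs to the topological dual `(𝒞²_2)*` if and only if
`dualNorm 2 2` of it is finite. -/
abbrev Form : Type := Module.Dual ℝ (C22 d₁ d₂)

/-- `sup { |⟨φ ; ρ⟩| : φ ∈ 𝒞²_2, ‖φ‖_{𝒞ᵏ_p} ≤ 1 }`; for `k = p = 2` this is the norm
of `(𝒞²_2)*`. -/
def dualNorm (k p : ℕ) (ρ : Form d₁ d₂) : ℝ≥0∞ :=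
  ⨆ φ : C22 d₁ d₂, ⨆ _ : growthNorm k p (φ : Phase d₁ d₂ → ℝ) ≤ 1, ‖ρ φ‖ₑ

open scoped Classical in
/-- The duality bracket `⟨φ ; ρ⟩` for `φ ∈ 𝒞²_2` (by convention `0` for other functions `φ`). -/
def bracket (φ : Phase d₁ d₂ → ℝ) (ρ : Form d₁ d₂) : ℝ :=
  if h : φ ∈ C22 d₁ d₂ then ρ ⟨φ, h⟩ else 0

/-- The partial gradient `∇ₓ φ`. -/
def gradX (φ : Phase d₁ d₂ → ℝ) (z : Phase d₁ d₂) : E d₁ :=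
  gradient (fun x => φ (x, z.2)) z.1

/-- `t ∈ [t₀, T] ↦ f_t ∈ 𝒞ᵏ_p` is bounded. -/
def BoundedIn (k p : ℕ) (t₀ T : ℝ) (f : ℝ → Phase d₁ d₂ → F) : Prop :=
  (∀ t ∈ Icc t₀ T, ContDiff ℝ k (f t)) ∧
    ∃ C : ℝ≥0, ∀ t ∈ Icc t₀ T, growthNorm k p (f t) ≤ C

/-- `f ∈ 𝒞([t₀, T], 𝒞ᵏ_p)`. -/
def ContinuousIn (k p : ℕ) (t₀ T : ℝ) (f : ℝ → Phase d₁ d₂ → F) : Prop :=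
  (∀ t ∈ Icc t₀ T, MemGrowth k p (f t)) ∧
    ∀ t ∈ Icc t₀ T, Tendsto (fun s => growthNorm k p (f s - f t)) (𝓝[Icc t₀ T] t) (𝓝 0)

/-- `γ ∈ 𝒫_p(ℝ^{d₁} × ℝ^{d₂})`. -/
def MemP (p : ℕ) (γ : Measure (Phase d₁ d₂)) : Prop :=
  IsProbabilityMeasure γ ∧ ∫⁻ z, (‖z.1‖ₑ ^ p + ‖z.2‖ₑ ^ p) ∂γ < ⊤

/-- The square of the Monge–Kantorovich–Rubinstein distance `d₂`. -/
def wassersteinSq (μ μ' : Measure (Phase d₁ d₂)) : ℝ≥0∞ :=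
  ⨅ π : Measure (Phase d₁ d₂ × Phase d₁ d₂),
    ⨅ _ : π.map Prod.fst = μ ∧ π.map Prod.snd = μ',
      ∫⁻ w, (edist w.1.1 w.2.1 ^ 2 + edist w.1.2 w.2.2 ^ 2) ∂π

/-- `γ ∈ 𝒞([t₀, T], 𝒫₂(ℝ^{d₁} × ℝ^{d₂}))`. -/
def ContinuousInP2 (t₀ T : ℝ) (γ : ℝ → Measure (Phase d₁ d₂)) : Prop :=
  (∀ t ∈ Icc t₀ T, MemP 2 (γ t)) ∧
    ∀ t ∈ Icc t₀ T, Tendsto (fun s => wassersteinSq (γ s) (γ t)) (𝓝[Icc t₀ T] t) (𝓝 0)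

/-- The space `ℛ(t₀)`. -/
def MemR (t₀ T : ℝ) (ρ : ℝ → Form d₁ d₂) : Prop :=
  (∀ t ∈ Icc t₀ T, dualNorm 2 2 (ρ t) < ⊤) ∧
  (∀ t ∈ Icc t₀ T, Tendsto (fun s => dualNorm 2 2 (ρ s - ρ t)) (𝓝[Icc t₀ T] t) (𝓝 0)) ∧
  (∃ C : ℝ≥0, ∀ t ∈ Icc t₀ T, dualNorm 1 3 (ρ t) ≤ C) ∧
  ∃ C : ℝ≥0, ∀ t₁ t₂ : ℝ, t₀ ≤ t₁ → t₁ < t₂ → t₂ ≤ T →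
    dualNorm 2 2 (ρ t₂ - ρ t₁) ≤ C * ENNReal.ofReal (Real.sqrt (t₂ - t₁))

end Spaces

section Assumptions

variable {d₁ d₂ d' : ℕ}

/-- The regularity assumption on the data `b`, `ℓ`, `L`. -/
structure RegularData (b : E d₁ → E d' → E d₁) (ℓ : E d' → ℝ) (L : Phase d₁ d₂ → ℝ) : Prop where
  b_smooth : ContDiff ℝ 4 (fun w : E d₁ × E d' => b w.1 w.2)
  /-- `|∇ₓᵏ ∇ₐˡ b (x, a)| ≤ C (1 + |a|^{k+1}) (1 + |x|ˡ)` for `k + l ≤ 4`. -/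
  b_bound : ∃ C : ℝ, ∀ k l : ℕ, k + l ≤ 4 → ∀ (x : E d₁) (a : E d'),
    ‖iteratedFDeriv ℝ k (fun x' => iteratedFDeriv ℝ l (fun a' => b x' a') a) x‖
      ≤ C * (1 + ‖a‖ ^ (k + 1)) * (1 + ‖x‖ ^ l)
  b_zero : ∀ x, b x 0 = 0
  l_smooth : ContDiff ℝ 2 ℓ
  l_convex : ConvexOn ℝ univ ℓ
  /-- `∇²ℓ(a) ≥ c (1 + |a|²) I`. -/
  l_hess : ∃ c : ℝ, 0 < c ∧ ∀ a h : E d',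
    c * (1 + ‖a‖ ^ 2) * ‖h‖ ^ 2 ≤ iteratedFDeriv ℝ 2 ℓ a ![h, h]
  L_bddBelow : BddBelow (range L)
  L_smooth : ContDiff ℝ 3 L
  L_growth : growthNorm21 2 L < ⊤

/-- The discriminating property of `b`. -/
def Discriminating (b : E d₁ → E d' → E d₁) : Prop :=
  ∀ (Ω : Type) [MeasurableSpace Ω] (P : Measure Ω) [IsProbabilityMeasure P] (X Z : Ω → E d₁),
    Measurable X → Measurable Z → Integrable Z P →
    (∀ a : E d', ∫ ω, inner ℝ (b (X ω) a) (Z ω) ∂P = 0) →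
    P[Z | MeasurableSpace.comap X inferInstance] =ᵐ[P] 0

end Assumptions

section Systems

variable {d₁ d₂ d' : ℕ}

/-- The prior `ν^∞(da) = e^{-ℓ(a)} da / ∫ e^{-ℓ}`. -/
def prior (ℓ : E d' → ℝ) : Measure (E d') :=
  volume.withDensity fun a =>
    ENNReal.ofReal (Real.exp (-ℓ a) / ∫ a', Real.exp (-ℓ a'))

/-- `b(x, ν) = ∫ b(x, a) dν(a)` for a positive measure `ν` on the parameter space. -/
def drift (b : E d₁ → E d' → E d₁) (ν : Measure (E d')) (x : E d₁) : E d₁ :=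
  ∫ a, b x a ∂ν

/-- `b(x, η) = ∫ b(x, a) dη(a)` for a signed measure `η` on the parameter space. -/
def driftSigned (b : E d₁ → E d' → E d₁) (η : SignedMeasure (E d')) (x : E d₁) : E d₁ :=
  VectorMeasure.integral η (fun a => b x a) (ContinuousLinearMap.lsmul ℝ ℝ).flip

/-- The set `𝒜(t₀)` of admissible controls (`klDiv` is the relative entropy). -/
structure Admissible (ℓ : E d' → ℝ) (t₀ T : ℝ) (ν : ℝ → Measure (E d')) : Prop where
  prob : ∀ t ∈ Icc t₀ T, IsProbabilityMeasure (ν t)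
  meas : Measurable fun t : Icc t₀ T => ν t
  entropy : ∫⁻ t in Icc t₀ T, InformationTheory.klDiv (ν t) (prior ℓ) < ⊤

/-- The set `𝒜^ℓ(t₀)` of control perturbations: elements `η` of `𝒟(t₀)` with `η_t(A) = 0`. -/
structure Perturbation (t₀ T : ℝ) (η : ℝ → SignedMeasure (E d')) : Prop where
  meas : ∀ s : Set (E d'), MeasurableSet s → Measurable fun t : Icc t₀ T => η t s
  moment : ∫⁻ t in Icc t₀ T, ∫⁻ a, (1 + ‖a‖ₑ ^ 4) ∂(η t).totalVariation < ⊤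
  modulus : ∃ C : ℝ≥0, ∀ t₁ t₂ : ℝ, t₀ ≤ t₁ → t₁ < t₂ → t₂ ≤ T →
    ∫⁻ t in Icc t₁ t₂, ∫⁻ a, (1 + ‖a‖ₑ ^ 2) ∂(η t).totalVariation
      ≤ C * ENNReal.ofReal (Real.sqrt (t₂ - t₁))
  mass : ∀ t ∈ Icc t₀ T, η t univ = 0

/-- `γ` is a solution in `𝒞([t₀, T], 𝒫₂)` of `∂ₜγ + divₓ(b(x, ν_t) γ) = 0`, `γ_{t₀} = γ₀`: the
equation is tested against functions that are bounded with bounded, continuous first derivatives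
on `[t₀, T] × ℝ^{d₁} × ℝ^{d₂}`. -/
def SolvesContinuity (b : E d₁ → E d' → E d₁) (t₀ T : ℝ) (γ₀ : Measure (Phase d₁ d₂))
    (ν : ℝ → Measure (E d')) (γ : ℝ → Measure (Phase d₁ d₂)) : Prop :=
  ContinuousInP2 t₀ T γ ∧
  ∀ φ : ℝ → Phase d₁ d₂ → ℝ,
    ContDiff ℝ 1 (fun w : ℝ × Phase d₁ d₂ => φ w.1 w.2) →
    (∃ C : ℝ, ∀ t ∈ Icc t₀ T, ∀ z, |φ t z| ≤ C ∧
      ‖fderiv ℝ (fun w : ℝ × Phase d₁ d₂ => φ w.1 w.2) (t, z)‖ ≤ C) →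
    ∀ t₁ ∈ Icc t₀ T,
      ∫ z, φ t₁ z ∂(γ t₁) = ∫ z, φ t₀ z ∂γ₀ +
        ∫ t in t₀..t₁, ∫ z, (deriv (fun s => φ s z) t +
          inner ℝ (drift b (ν t) z.1) (gradX (φ t) z)) ∂(γ t)

/-- `u` is a solution in `𝒞^{1/2}([t₀, T], 𝒞¹_{2,1})` of the backward transport equation
`-∂ₜu - b(x, ν_t) · ∇ₓu = 0`, `u_T = L`. -/
def SolvesAdjoint (b : E d₁ → E d' → E d₁) (L : Phase d₁ d₂ → ℝ) (t₀ T : ℝ)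
    (ν : ℝ → Measure (E d')) (u : ℝ → Phase d₁ d₂ → ℝ) : Prop :=
  (∀ t ∈ Icc t₀ T, ContDiff ℝ 1 (u t) ∧ growthNorm21 0 (u t) < ⊤) ∧
  (∃ C : ℝ≥0, ∀ s ∈ Icc t₀ T, ∀ t ∈ Icc t₀ T,
    growthNorm21 0 (u s - u t) ≤ C * ENNReal.ofReal (Real.sqrt |s - t|)) ∧
  ∀ t ∈ Icc t₀ T, ∀ z,
    u t z = L z + ∫ s in t..T, inner ℝ (drift b (ν s) z.1) (gradX (u s) z)

/-- The unnormalised density `exp(-ℓ(a) - ε⁻¹ ∫ b(x, a) · ∇ₓu(x, y) dγ(x, y))`. -/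
def gibbsWeight (b : E d₁ → E d' → E d₁) (ℓ : E d' → ℝ) (ε : ℝ)
    (γ : Measure (Phase d₁ d₂)) (u : Phase d₁ d₂ → ℝ) (a : E d') : ℝ :=
  Real.exp (-ℓ a - (1 / ε) * ∫ z, inner ℝ (b z.1 a) (gradX u z) ∂γ)

/-- The Gibbs density, i.e. `gibbsWeight` divided by its integral. -/
def gibbsDensity (b : E d₁ → E d' → E d₁) (ℓ : E d' → ℝ) (ε : ℝ)
    (γ : Measure (Phase d₁ d₂)) (u : Phase d₁ d₂ → ℝ) (a : E d') : ℝ :=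
  gibbsWeight b ℓ ε γ u a / ∫ a', gibbsWeight b ℓ ε γ u a'

/-- `(ν, γ, u)` solves the first-order optimality system with initial condition `(t₀, γ₀)`. -/
structure SolvesFirstOrder (b : E d₁ → E d' → E d₁) (ℓ : E d' → ℝ) (L : Phase d₁ d₂ → ℝ)
    (ε t₀ T : ℝ) (γ₀ : Measure (Phase d₁ d₂)) (ν : ℝ → Measure (E d'))
    (γ : ℝ → Measure (Phase d₁ d₂)) (u : ℝ → Phase d₁ d₂ → ℝ) : Prop where
  admissible : Admissible ℓ t₀ T ν
  gibbs : ∀ t ∈ Icc t₀ T,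
    ν t = volume.withDensity fun a => ENNReal.ofReal (gibbsDensity b ℓ ε (γ t) (u t) a)
  continuity : SolvesContinuity b t₀ T γ₀ ν γ
  adjoint : SolvesAdjoint b L t₀ T ν u

/-- Test functions `φ` for the linearized continuity equation; `ψ` is `∂ₜφ`. -/
structure IsTest (t₀ T : ℝ) (φ ψ : ℝ → Phase d₁ d₂ → ℝ) : Prop where
  hasDeriv : ∀ t ∈ Icc t₀ T, ∀ z,
    HasDerivWithinAt (fun s => φ s z) (ψ t z) (Icc t₀ T) t
  bdd : BoundedIn 2 2 t₀ T φ
  cont : ContinuousIn 1 2 t₀ T φ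
  bdd_dt : BoundedIn 2 1 t₀ T ψ
  bdd_grad : BoundedIn 2 1 t₀ T (fun t => gradX (φ t))
  cont_dt : ContinuousIn 1 2 t₀ T ψ
  cont_grad : ContinuousIn 1 2 t₀ T (fun t => gradX (φ t))

/-- `ρ` is a solution in `ℛ(t₀)` of the linearized continuity equation
`∂ₜρ + divₓ(b(x, ν_t) ρ) = -divₓ(b(x, η_t) γ_t)`, `ρ_{t₀} = 0`. -/
def SolvesLinContinuity (b : E d₁ → E d' → E d₁) (t₀ T : ℝ)
    (ν : ℝ → Measure (E d')) (γ : ℝ → Measure (Phase d₁ d₂))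
    (η : ℝ → SignedMeasure (E d')) (ρ : ℝ → Form d₁ d₂) : Prop :=
  MemR t₀ T ρ ∧ ρ t₀ = 0 ∧
  ∀ φ ψ : ℝ → Phase d₁ d₂ → ℝ, IsTest t₀ T φ ψ → ∀ t₁ ∈ Icc t₀ T,
    bracket (φ t₁) (ρ t₁) =
      (∫ t in t₀..t₁,
        bracket (fun z => ψ t z + inner ℝ (drift b (ν t) z.1) (gradX (φ t) z)) (ρ t)) +
      ∫ t in t₀..t₁, ∫ z, inner ℝ (driftSigned b (η t) z.1) (gradX (φ t) z) ∂(γ t)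

/-- `v` is a solution in `𝒞([t₀, T], 𝒞¹_1)` of the linearized transport equation
`-∂ₜv - b(x, ν_t) · ∇ₓv = b(x, η_t) · ∇ₓu`, `v_T = 0`. -/
def SolvesLinAdjoint (b : E d₁ → E d' → E d₁) (t₀ T : ℝ)
    (ν : ℝ → Measure (E d')) (u : ℝ → Phase d₁ d₂ → ℝ)
    (η : ℝ → SignedMeasure (E d')) (v : ℝ → Phase d₁ d₂ → ℝ) : Prop :=
  ContinuousIn 1 1 t₀ T v ∧ v T = 0 ∧
  ∀ t₁ ∈ Icc t₀ T, ∀ t₂ ∈ Icc t₀ T, t₁ < t₂ → ∀ z,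
    v t₁ z - v t₂ z = ∫ t in t₁..t₂,
      (inner ℝ (drift b (ν t) z.1) (gradX (v t) z) +
        inner ℝ (driftSigned b (η t) z.1) (gradX (u t) z))

/-- `(η, ρ, v)` solves the linearized optimality system, starting from `t₀`, around `(ν, γ, u)`.
For every `t ∈ [t₀, T]`, `η_t` has the density
`a ↦ -(ν_t(a)/ε) [⟨b(·, a) · ∇ₓu_t ; ρ_t⟩ + ∫ b(x, a) · ∇ₓv_t(x, y) dγ_t(x, y) - c_t]`, where
`ν_t(a)` is the Gibbs density of `ν_t` and the constant `c_t` is the one for which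
`η_t(A) = 0`. -/
structure SolvesLinearized (b : E d₁ → E d' → E d₁) (ℓ : E d' → ℝ) (ε t₀ T : ℝ)
    (ν : ℝ → Measure (E d')) (γ : ℝ → Measure (Phase d₁ d₂)) (u : ℝ → Phase d₁ d₂ → ℝ)
    (η : ℝ → SignedMeasure (E d')) (ρ : ℝ → Form d₁ d₂) (v : ℝ → Phase d₁ d₂ → ℝ) : Prop where
  perturbation : Perturbation t₀ T η
  formula : ∃ c : ℝ → ℝ, ∀ t ∈ Icc t₀ T,
    η t = (volume : Measure (E d')).withDensityᵥ fun a =>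
      -(gibbsDensity b ℓ ε (γ t) (u t) a / ε) *
        (bracket (fun z => inner ℝ (b z.1 a) (gradX (u t) z)) (ρ t) +
          (∫ z, inner ℝ (b z.1 a) (gradX (v t) z) ∂(γ t)) - c t)
  linAdjoint : SolvesLinAdjoint b t₀ T ν u η v
  linContinuity : SolvesLinContinuity b t₀ T ν γ η ρ

end Systems

end

end NeuralODE

/-! The system runs forward in `γ`, `ρ` and backward in `u`, `v`, so a priori the linearization is a
two-point problem in time. The mechanism of the proof is that `η t₀ = 0` removes the backward part:
what remains is a forward inequality, closed by a Gronwall iteration.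

Let Ψ_t be the flow of b(·, ν_t) on features from time t₀, with the label kept fixed, and let Θ_t be
its inverse. By characteristics, γ_t is the image of γ₀ under Ψ_t and u_t ∘ Ψ_t = W, where W = L ∘
Ψ_T (`IsFlow.eq_map`, `IsFlow.adjoint_eq`). Put ξ_t(x) = ∫_{t₀}^t DΘ_r(Ψ_r x) b(Ψ_r x, η_r) dr, the
`displacement`. Duhamel's formula then gives v_t ∘ Ψ_t = D_xW · (ξ_T - ξ_t) and ⟨φ ; ρ_t⟩ = ∫ D_x(φ
∘ Ψ_t) · ξ_t dγ₀ (`IsFlow.linAdjoint_eq`, `IsFlow.linContinuity_eq`). Everything is thus expressed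
through η.

Write w_a for the field b(·, a) pulled back to time t₀ by the flow; it depends on x only. The
potential of η_t becomes ∫ D_x(D_xW · w_a) · ξ_t dγ₀ + ∫ D_x(D_xW · (ξ_T - ξ_t)) · w_a dγ₀. The
future enters only through D_xW · ξ_T = v_{t₀}. At time t₀ one has ρ = 0, and η = 0 forces ∫ b(x, a)
· ∇ₓv_{t₀} dγ₀ to be independent of a; it vanishes because b(x, 0) = 0. The discriminating property
says that ∇ₓv_{t₀} has zero conditional expectation given x, so its integral against w_a is zero and
ξ_T drops out (`integral_fderiv_initial_eq_zero`).

Hence the potential at time t is at most a constant times the bounded-Lipschitz size of ξ_t times a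
polynomial weight in a (`IsFlow.abs_potential_le`). The Gibbs density integrates that weight, so the
same size controls η_t; and ξ_t is controlled by the time integral of the size of η.
`nonpos_of_iterated_bound` concludes.

Two devices carry the regularity. The coefficient is written b(x, a) = weight(a) g(x)(a) with g a C³
map into bounded continuous functions of a, so that integrating against ν_t or η_t is a bounded
linear operation on g(x). Functions of time are treated as points of C([t₀, T], ·), so that
smoothness of the flow and of its inverse, uniformly in time, comes from inverting maps of path
spaces. -/

namespace NeuralODE

open MeasureTheory Set Filter Topology
open scoped ENNReal NNReal BoundedContinuousFunction

set_option linter.unusedSectionVars false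

/-! ### Superposition operators on path spaces, and contractive perturbations of the identity. -/

section Superposition

universe u

variable {I : Type u} [TopologicalSpace I] [CompactSpace I]
variable {X Y F : Type u} [NormedAddCommGroup X] [NormedSpace ℝ X]
  [NormedAddCommGroup Y] [NormedSpace ℝ Y] [NormedAddCommGroup F] [NormedSpace ℝ F]

/-- The bilinear map between spaces of continuous maps induced by a bilinear map. -/
noncomputable def bilinC (I : Type u) [TopologicalSpace I] [CompactSpace I]
    (B : X →L[ℝ] Y →L[ℝ] F) : C(I, X) →L[ℝ] C(I, Y) →L[ℝ] C(I, F) :=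
  LinearMap.mkContinuous₂
    (LinearMap.mk₂ ℝ (fun (f : C(I, X)) (g : C(I, Y)) =>
        (⟨fun t => B (f t) (g t), by fun_prop⟩ : C(I, F)))
      (fun _ _ _ => by ext; simp) (fun _ _ _ => by ext; simp)
      (fun _ _ _ => by ext; simp) (fun _ _ _ => by ext; simp)) ‖B‖
    (fun f g => by
      refine (ContinuousMap.norm_le _ (by positivity)).2 fun t => ?_
      refine (B.le_opNorm₂ _ _).trans ?_
      gcongr
      · exact f.norm_coe_le_norm t
      · exact g.norm_coe_le_norm t)

/-- Pointwise application of a path of linear maps to a path of vectors. -/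
noncomputable abbrev applyC : C(I, X →L[ℝ] F) →L[ℝ] C(I, X) →L[ℝ] C(I, F) :=
  bilinC I (ContinuousLinearMap.id ℝ (X →L[ℝ] F))

/-- The mean value inequality applies at each time; what is needed is that `g'` be close to `g' (α
t)` near `α t` uniformly in t. No local compactness of X is assumed: uniformity comes from
continuity of postcomposition by `g'` in the sup norm. -/
theorem hasFDerivAt_postcomp {g : X → F} {g' : X → X →L[ℝ] F}
    (hg : ∀ x, HasFDerivAt g (g' x) x) (hc : Continuous g) (hc' : Continuous g') (α : C(I, X)) :
    HasFDerivAt (fun α : C(I, X) => (⟨g, hc⟩ : C(X, F)).comp α)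
      (applyC ((⟨g', hc'⟩ : C(X, X →L[ℝ] F)).comp α)) α := by
  rw [hasFDerivAt_iff_isLittleO_nhds_zero, Asymptotics.isLittleO_iff]
  intro ε hε
  have hcont : Continuous fun β : C(I, X) => (⟨g', hc'⟩ : C(X, X →L[ℝ] F)).comp β :=
    ContinuousMap.continuous_postcomp _
  obtain ⟨δ, hδ, H⟩ := (Metric.continuousAt_iff (α := C(I, X)) (β := C(I, X →L[ℝ] F))).1
    hcont.continuousAt ε hε
  have key : ∀ t, ∀ y ∈ Metric.ball (α t) δ, ‖g' y - g' (α t)‖ ≤ ε := by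
    intro t y hy
    -- Translating the whole path by the constant y - α t makes the perturbed path pass through y at
    -- time t, so sup-norm continuity at α yields an estimate with δ independent of t.
    have h1 : dist (α + ContinuousMap.const I (y - α t)) α < δ := by
      rw [dist_eq_norm, add_sub_cancel_left]
      refine (ContinuousMap.norm_lt_iff _ hδ).2 fun s => ?_
      simpa [dist_eq_norm] using hy
    have h2 := (ContinuousMap.dist_lt_iff hε).1 (H h1) t
    simp only [ContinuousMap.comp_apply, ContinuousMap.coe_mk, ContinuousMap.add_apply,
      ContinuousMap.const_apply, add_sub_cancel, dist_eq_norm] at h2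
    exact h2.le
  filter_upwards [Metric.ball_mem_nhds (0 : C(I, X)) hδ] with h hh
  refine (ContinuousMap.norm_le _ (by positivity)).2 fun t => ?_
  have hht : ‖h t‖ < δ := (h.norm_coe_le_norm t).trans_lt (by simpa using hh)
  have h3 := (convex_ball (α t) δ).norm_image_sub_le_of_norm_hasFDerivWithin_le' (f := g)
    (f' := g') (φ := g' (α t)) (C := ε) (x := α t) (y := α t + h t)
    (fun y _ => (hg y).hasFDerivWithinAt) (fun y hy => key t y hy) (Metric.mem_ball_self hδ)
    (by simpa [dist_eq_norm] using hht)
  simp only [add_sub_cancel_left] at h3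
  refine h3.trans ?_
  gcongr
  exact h.norm_coe_le_norm t

/-- The derivative is again a postcomposition, by `fderiv ℝ g`, followed by a bounded bilinear map.
The target changes from F to X →L[ℝ] F at each step of the induction, hence the quantifier over F
inside the statement and the common universe. -/
theorem contDiff_postcomp (n : ℕ) : ∀ {F : Type u} [NormedAddCommGroup F] [NormedSpace ℝ F]
    (g : C(X, F)), ContDiff ℝ n g → ContDiff ℝ n fun α : C(I, X) => g.comp α := by
  induction n with
  | zero =>
    intro F _ _ g _
    exact contDiff_zero.2 (ContinuousMap.continuous_postcomp g)
  | succ n ih =>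
    intro F _ _ g hg
    have hg' : ContDiff ℝ n (fderiv ℝ g) := (contDiff_succ_iff_fderiv.1 (by exact_mod_cast hg)).2.2
    have hd : ∀ x, HasFDerivAt g (fderiv ℝ g x) x := fun x =>
      ((hg.differentiable (by simp)) x).hasFDerivAt
    have h := ih (⟨fderiv ℝ g, hg'.continuous⟩ : C(X, X →L[ℝ] F)) hg'
    have : ContDiff ℝ ((n : WithTop ℕ∞) + 1) fun α : C(I, X) => g.comp α := by
      refine contDiff_succ_iff_hasFDerivAt.2 ⟨_, applyC.contDiff.comp h, fun α => ?_⟩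
      exact hasFDerivAt_postcomp hd g.continuous hg'.continuous α
    exact_mod_cast this

/-- Evaluation on the diagonal. -/
noncomputable def diagC : C(I, C(I, F)) →L[ℝ] C(I, F) :=
  LinearMap.mkContinuous
    { toFun := fun f => ⟨fun t => f t t, by
        have : Continuous fun p : I × I => f p.1 p.2 := by fun_prop
        exact this.comp (continuous_id.prodMk continuous_id)⟩
      map_add' := fun _ _ => by ext; simp
      map_smul' := fun _ _ => by ext; simp } 1
    (fun f => by
      rw [one_mul]
      refine (ContinuousMap.norm_le _ (by positivity)).2 fun t => ?_
      exact ((f t).norm_coe_le_norm t).trans (f.norm_coe_le_norm t))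

/-- The superposition operator `α ↦ (t ↦ f (α t) t)`. -/
noncomputable def superpos (f : C(X, C(I, F))) (α : C(I, X)) : C(I, F) := diagC (f.comp α)

@[simp] theorem superpos_apply (f : C(X, C(I, F))) (α : C(I, X)) (t : I) :
    superpos f α t = f (α t) t := rfl

theorem contDiff_superpos {n : ℕ} (f : C(X, C(I, F))) (hf : ContDiff ℝ n f) :
    ContDiff ℝ n (superpos f) :=
  (diagC (I := I) (F := F)).contDiff.comp (contDiff_postcomp n f hf)

/-- The derivative in `x`, at time `t`, of a function with values in a space of paths. -/
theorem hasFDerivAt_eval {f : X → C(I, F)} (hf : Differentiable ℝ f) (t : I) (x : X) :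
    HasFDerivAt (fun x => f x t) ((ContinuousMap.evalCLM ℝ t).comp (fderiv ℝ f x)) x :=
  (ContinuousMap.evalCLM ℝ t : C(I, F) →L[ℝ] F).hasFDerivAt.comp x (hf x).hasFDerivAt

theorem fderiv_eval {f : X → C(I, F)} (hf : Differentiable ℝ f) (t : I) (x h : X) :
    fderiv ℝ (fun x => f x t) x h = fderiv ℝ f x h t := by
  rw [(hasFDerivAt_eval hf t x).fderiv]; rfl

theorem contDiff_eval {n : WithTop ℕ∞} {f : X → C(I, F)} (hf : ContDiff ℝ n f) (t : I) :
    ContDiff ℝ n fun x => f x t :=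
  (ContinuousMap.evalCLM ℝ t : C(I, F) →L[ℝ] F).contDiff.comp hf

theorem hasFDerivAt_superpos (f : C(X, C(I, F))) (hf : ContDiff ℝ 1 f) (α : C(I, X)) :
    ∃ A : C(I, X) →L[ℝ] C(I, F), HasFDerivAt (superpos f) A α ∧
      ∀ h t, A h t = fderiv ℝ (fun x => f x t) (α t) (h t) := by
  have hd : Differentiable ℝ f := hf.differentiable (by simp)
  have hc' : Continuous (fderiv ℝ f) := hf.continuous_fderiv (by simp)
  have := hasFDerivAt_postcomp (fun x => (hd x).hasFDerivAt) f.continuous hc' α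
  refine ⟨_, (diagC (I := I) (F := F)).hasFDerivAt.comp α this, fun h t => ?_⟩
  rw [fderiv_eval hd]
  rfl

/-- A contraction perturbs the identity into a diffeomorphism. -/
theorem exists_contDiff_rightInverse_id_sub [CompleteSpace X] {n : WithTop ℕ∞} (hn : n ≠ 0)
    {R : X → X} (hR : ContDiff ℝ n R) {c : ℝ≥0} (hc : c < 1) (hL : LipschitzWith c R) :
    ∃ Q : X → X, ContDiff ℝ n Q ∧ ∀ x, Q x - R (Q x) = x := by
  have happ : ApproximatesLinearOn (fun x => x - R x)
      ((ContinuousLinearEquiv.refl ℝ X : X ≃L[ℝ] X) : X →L[ℝ] X) univ c := by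
    intro x _ y _
    have : x - R x - (y - R y) - ((ContinuousLinearEquiv.refl ℝ X : X ≃L[ℝ] X) : X →L[ℝ] X) (x - y)
        = R y - R x := by
      simp only [ContinuousLinearEquiv.coe_coe, ContinuousLinearEquiv.coe_refl', id]; abel
    rw [this, norm_sub_rev]
    exact hL.norm_sub_le x y
  have hc' : Subsingleton X ∨
      c < ‖((ContinuousLinearEquiv.refl ℝ X : X ≃L[ℝ] X).symm : X →L[ℝ] X)‖₊⁻¹ := by
    rcases subsingleton_or_nontrivial X with h | h
    · exact Or.inl h
    · right
      have : ‖((ContinuousLinearEquiv.refl ℝ X : X ≃L[ℝ] X).symm : X →L[ℝ] X)‖₊ = 1 :=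
        Subtype.ext (ContinuousLinearMap.norm_id (𝕜 := ℝ) (E := X))
      rw [this, inv_one]; exact hc
  let Φ : X ≃ₜ X := happ.toHomeomorph _ hc'
  have hΦ : ∀ x, Φ x = x - R x := fun x => rfl
  have hu : ∀ a, ‖fderiv ℝ R a‖ < 1 := fun a =>
    (norm_fderiv_le_of_lipschitz ℝ hL).trans_lt (by exact_mod_cast hc)
  -- The derivative 1 - DR(a) is invertible by the Neumann series, since the Lipschitz constant of R
  -- bounds ‖DR(a)‖ by c < 1.
  refine ⟨Φ.symm, Φ.contDiff_symm
    (f₀' := fun a => ContinuousLinearEquiv.unitsEquiv ℝ X (Units.oneSub (fderiv ℝ R a) (hu a)))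
    (fun a => ?_) (contDiff_id.sub hR), fun x => ?_⟩
  · have h1 : HasFDerivAt (fun x => x - R x) (ContinuousLinearMap.id ℝ X - fderiv ℝ R a) a :=
      (hasFDerivAt_id a).sub ((hR.differentiable hn) a).hasFDerivAt
    exact h1
  · rw [← hΦ, Φ.apply_symm_apply]

end Superposition

/-! ### The Picard operator on paths and smooth dependence on the initial value. -/

section Paths

variable {t₀ T : ℝ}
variable {X : Type} [NormedAddCommGroup X] [NormedSpace ℝ X] [CompleteSpace X]

/-- The primitive of a path, vanishing at the initial time. -/
noncomputable def primitiveC (h : t₀ ≤ T) : C(Icc t₀ T, X) →L[ℝ] C(Icc t₀ T, X) :=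
  LinearMap.mkContinuous
    { toFun := fun f => ⟨fun t => ∫ s in t₀..t, IccExtend h f s, by
        have hc : Continuous (IccExtend h f) := f.continuous.Icc_extend'
        exact (intervalIntegral.continuous_primitive
          (fun a b => hc.intervalIntegrable a b) t₀).comp continuous_subtype_val⟩
      map_add' := fun f g => by
        ext t
        have hf : Continuous (IccExtend h f) := f.continuous.Icc_extend'
        have hg : Continuous (IccExtend h g) := g.continuous.Icc_extend'
        simpa [IccExtend] using intervalIntegral.integral_add (hf.intervalIntegrable t₀ t)
          (hg.intervalIntegrable t₀ t)
      map_smul' := fun c f => by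
        ext t
        simp [IccExtend] } (T - t₀)
    (fun f => by
      have hT : 0 ≤ T - t₀ := sub_nonneg.2 h
      refine (ContinuousMap.norm_le _ (by positivity)).2 fun t => ?_
      have := intervalIntegral.norm_integral_le_of_norm_le_const (a := t₀) (b := t) (C := ‖f‖)
        (f := IccExtend h f) (fun s _ => f.norm_coe_le_norm _)
      refine this.trans ?_
      rw [mul_comm, abs_of_nonneg (sub_nonneg.2 t.2.1)]
      gcongr
      exact t.2.2)

theorem primitiveC_apply (h : t₀ ≤ T) (f : C(Icc t₀ T, X)) (t : Icc t₀ T) :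
    primitiveC h f t = ∫ s in t₀..t, IccExtend h f s := rfl

/-- Multiplication of a path by `exp (c t)`. -/
noncomputable def expMulC (t₀ T c : ℝ) : C(Icc t₀ T, X) →L[ℝ] C(Icc t₀ T, X) :=
  bilinC (Icc t₀ T) (ContinuousLinearMap.lsmul ℝ ℝ) ⟨fun t => Real.exp (c * t), by fun_prop⟩

@[simp] theorem expMulC_apply (c : ℝ) (f : C(Icc t₀ T, X)) (t : Icc t₀ T) :
    expMulC t₀ T c f t = Real.exp (c * t) • f t := rfl

/-- Conjugating the Picard operator by exp(lt), as in a Bielecki norm, brings its Lipschitz constant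
down to K / l. The choice l = 2K + 1 makes this at most 1/2 whatever the length of the interval, so
no gluing of short-time solutions is needed. -/
theorem lipschitzWith_weighted_primitive (h : t₀ ≤ T) (V : C(X, C(Icc t₀ T, X))) {K : ℝ≥0}
    (hK : ∀ t, LipschitzWith K fun x => V x t) :
    LipschitzWith (1 / 2) fun α : C(Icc t₀ T, X) =>
      expMulC t₀ T (-(2 * K + 1)) (primitiveC h (superpos V (expMulC t₀ T (2 * K + 1) α))) := by
  set l : ℝ := 2 * K + 1 with hl
  have hl0 : 0 < l := by positivity
  refine LipschitzWith.of_dist_le_mul fun α β => ?_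
  refine (ContinuousMap.dist_le (by positivity)).2 fun t => ?_
  rw [dist_eq_norm, dist_eq_norm]
  simp only [expMulC_apply, primitiveC_apply]
  rw [← smul_sub, ← intervalIntegral.integral_sub]
  rotate_left
  · exact (ContinuousMap.continuous _).Icc_extend'.intervalIntegrable _ _
  · exact (ContinuousMap.continuous _).Icc_extend'.intervalIntegrable _ _
  rw [norm_smul, Real.norm_of_nonneg (Real.exp_pos _).le]
  have hbound : ‖∫ s in t₀..t, (IccExtend h (superpos V (expMulC t₀ T l α)) s
        - IccExtend h (superpos V (expMulC t₀ T l β)) s)‖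
      ≤ ∫ s in t₀..(t : ℝ), K * ‖α - β‖ * Real.exp (l * s) := by
    refine intervalIntegral.norm_integral_le_of_norm_le t.2.1 (ae_of_all _ fun s hs => ?_)
      (Continuous.intervalIntegrable (by fun_prop) _ _)
    have hsI : s ∈ Icc t₀ T := ⟨hs.1.le, hs.2.trans t.2.2⟩
    rw [IccExtend_of_mem h _ hsI, IccExtend_of_mem h _ hsI]
    simp only [superpos_apply, expMulC_apply]
    refine ((hK ⟨s, hsI⟩).norm_sub_le _ _).trans ?_
    rw [← smul_sub, norm_smul, Real.norm_of_nonneg (Real.exp_pos _).le, mul_assoc,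
      mul_comm (Real.exp _)]
    gcongr
    exact (α - β).norm_coe_le_norm _
  have hint : ∫ s in t₀..(t : ℝ), K * ‖α - β‖ * Real.exp (l * s)
      ≤ K * ‖α - β‖ * (Real.exp (l * t) / l) := by
    rw [intervalIntegral.integral_const_mul]
    have : ∫ s in t₀..(t : ℝ), Real.exp (l * s) = (Real.exp (l * t) - Real.exp (l * t₀)) / l := by
      rw [intervalIntegral.integral_comp_mul_left (fun s => Real.exp s) hl0.ne', integral_exp,
        smul_eq_mul]
      field_simp
    rw [this]
    gcongr
    linarith [Real.exp_pos (l * t₀)]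
  calc _ ≤ Real.exp (-l * t) * (K * ‖α - β‖ * (Real.exp (l * t) / l)) := by
        gcongr; exact hbound.trans hint
    _ = (K / l) * ‖α - β‖ := by
        rw [neg_mul, Real.exp_neg]
        field_simp
    _ ≤ _ := by
        gcongr
        simp only [NNReal.coe_div, NNReal.coe_one, NNReal.coe_ofNat]
        rw [div_le_div_iff₀ hl0 (by norm_num)]
        rw [hl]; linarith [K.2]

/-- Smooth dependence of the solution of an ordinary differential equation on its initial value. -/
theorem exists_contDiff_integral_curves (h : t₀ ≤ T) {n : ℕ} (hn : n ≠ 0)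
    (V : C(X, C(Icc t₀ T, X))) (hV : ContDiff ℝ n V) {K : ℝ≥0}
    (hK : ∀ t, LipschitzWith K fun x => V x t) :
    ∃ Ψ : X → C(Icc t₀ T, X), ContDiff ℝ n Ψ ∧
      ∀ x, Ψ x = ContinuousMap.const _ x + primitiveC h (superpos V (Ψ x)) := by
  set l : ℝ := 2 * K + 1 with hl
  have hR : ContDiff ℝ n fun α : C(Icc t₀ T, X) =>
      expMulC t₀ T (-(2 * K + 1)) (primitiveC h (superpos V (expMulC t₀ T (2 * K + 1) α))) :=
    (expMulC t₀ T _).contDiff.comp ((primitiveC h).contDiff.comp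
      ((contDiff_superpos V hV).comp (expMulC t₀ T _).contDiff))
  obtain ⟨Q, hQ, hQe⟩ := exists_contDiff_rightInverse_id_sub (by exact_mod_cast hn) hR
    (by rw [← NNReal.coe_lt_coe]; norm_num) (lipschitzWith_weighted_primitive h V hK)
  have hinv : ∀ α : C(Icc t₀ T, X), expMulC t₀ T l (expMulC t₀ T (-l) α) = α := by
    intro α; ext t
    simp [smul_smul, ← Real.exp_add]
  let cst : X →L[ℝ] C(Icc t₀ T, X) := ContinuousLinearMap.mk
    { toFun := fun x => ContinuousMap.const _ x
      map_add' := fun _ _ => rfl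
      map_smul' := fun _ _ => rfl } ContinuousMap.continuous_const'
  -- The integral equation says that id minus the Picard operator sends the curve to the constant
  -- path x; Q inverts the conjugated version, and the outer factors undo the conjugation.
  refine ⟨fun x => expMulC t₀ T l (Q (expMulC t₀ T (-l) (cst x))), ?_, fun x => ?_⟩
  · exact (expMulC t₀ T l).contDiff.comp
      (hQ.comp ((expMulC t₀ T (-l)).contDiff.comp cst.contDiff))
  · have := congrArg (expMulC t₀ T l) (hQe (expMulC t₀ T (-l) (cst x)))
    rw [map_sub, hinv] at this
    rw [sub_eq_iff_eq_add] at this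
    refine this.trans ?_
    rw [hinv]
    rfl

end Paths

/-! ### Gronwall estimates in both directions of time. -/

section Gronwall

variable {X : Type*} [NormedAddCommGroup X] [NormedSpace ℝ X]

theorem hasDerivWithinAt_Ici_of_Icc {f : ℝ → X} {f' : X} {a b t : ℝ} (ht : t ∈ Ico a b)
    (hf : HasDerivWithinAt f f' (Icc a b) t) : HasDerivWithinAt f f' (Ici t) t :=
  hf.mono_of_mem_nhdsWithin (Filter.mem_of_superset (Icc_mem_nhdsGE ht.2)
    (Icc_subset_Icc_left ht.1))

theorem norm_le_mul_exp_of_hasDerivWithinAt {f f' : ℝ → X} {a b δ K : ℝ}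
    (hf : ∀ t ∈ Icc a b, HasDerivWithinAt f (f' t) (Icc a b) t) (ha : ‖f a‖ ≤ δ)
    (hK : ∀ t ∈ Icc a b, ‖f' t‖ ≤ K * ‖f t‖) :
    ∀ t ∈ Icc a b, ‖f t‖ ≤ δ * Real.exp (K * (t - a)) := by
  intro t ht
  rw [← gronwallBound_ε0]
  exact norm_le_gronwallBound_of_norm_deriv_right_le (f' := f')
    (fun t ht => (hf t ht).continuousWithinAt)
    (fun t ht => hasDerivWithinAt_Ici_of_Icc ht (hf t (Ico_subset_Icc_self ht))) ha
    (fun t ht => by simpa using hK t (Ico_subset_Icc_self ht)) t ht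

/-- Time reversal s ↦ t + a - s of the forward estimate. This backward bound later yields
injectivity of the flow and of its differential. -/
theorem norm_initial_le_mul_exp {f f' : ℝ → X} {a b K : ℝ}
    (hf : ∀ t ∈ Icc a b, HasDerivWithinAt f (f' t) (Icc a b) t)
    (hK : ∀ t ∈ Icc a b, ‖f' t‖ ≤ K * ‖f t‖) :
    ∀ t ∈ Icc a b, ‖f a‖ ≤ ‖f t‖ * Real.exp (K * (t - a)) := by
  intro t ht
  have hmaps : MapsTo (fun s => t + a - s) (Icc a t) (Icc a b) := fun s hs =>
    ⟨by linarith [hs.2], by linarith [hs.1, ht.2]⟩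
  have := norm_le_mul_exp_of_hasDerivWithinAt (f := fun s => f (t + a - s))
    (f' := fun s => -f' (t + a - s)) (a := a) (b := t) (δ := ‖f t‖) (K := K)
    (fun s hs => by
      have h1 := (hf _ (hmaps hs)).scomp s
        (((hasDerivAt_id s).const_sub (t + a)).hasDerivWithinAt (s := Icc a t)) hmaps
      simpa [Function.comp_def] using h1)
    (by simp) (fun s hs => by simpa using hK _ (hmaps hs)) t ⟨ht.1, le_rfl⟩
  simpa using this

end Gronwall

/-! ### First variation of the flow and its Lipschitz dependence on the initial point. -/

section Flow

variable {t₀ T : ℝ}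
variable {X : Type} [NormedAddCommGroup X] [NormedSpace ℝ X] [CompleteSpace X]

theorem hasDerivWithinAt_of_eq_primitiveC (h : t₀ ≤ T) {α g : C(Icc t₀ T, X)} {x : X}
    (hα : α = ContinuousMap.const _ x + primitiveC h g) :
    ∀ t ∈ Icc t₀ T, HasDerivWithinAt (IccExtend h α) (IccExtend h g t) (Icc t₀ T) t := by
  intro t ht
  have hc : Continuous (IccExtend h g) := g.continuous.Icc_extend'
  have h1 : HasDerivAt (fun s => x + ∫ r in t₀..s, IccExtend h g r) (IccExtend h g t) t :=
    (intervalIntegral.integral_hasDerivAt_right (hc.intervalIntegrable _ _)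
      (hc.stronglyMeasurableAtFilter _ _) hc.continuousAt).const_add x
  have heq : ∀ s ∈ Icc t₀ T, IccExtend h α s = x + ∫ r in t₀..s, IccExtend h g r := by
    intro s hs
    rw [IccExtend_of_mem h _ hs, hα]
    rfl
  exact h1.hasDerivWithinAt.congr heq (heq t ht)

/-- The hypotheses on a time-dependent vector field which has a smooth global flow. -/
structure FlowField (V : C(X, C(Icc t₀ T, X))) (K : ℝ≥0) : Prop where
  smooth : ContDiff ℝ 3 V
  lip : ∀ t, LipschitzWith K fun x => V x t
  bdd : ∀ x t, ‖V x t‖ ≤ K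
  lip_fderiv : ∀ t, LipschitzWith K (fderiv ℝ fun x => V x t)

/-- `Ψ` is the flow of `V` starting at the initial time and `Θ` is the family of its inverses. -/
structure IsFlow (h : t₀ ≤ T) (V : C(X, C(Icc t₀ T, X))) (Ψ Θ : X → C(Icc t₀ T, X))
    (C : ℝ≥0) : Prop where
  smooth : ContDiff ℝ 3 Ψ
  smooth_inv : ContDiff ℝ 3 Θ
  eq : ∀ x, Ψ x = ContinuousMap.const _ x + primitiveC h (superpos V (Ψ x))
  right_inv : ∀ t x, Ψ (Θ x t) t = x
  left_inv : ∀ t x, Θ (Ψ x t) t = x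
  lip : ∀ t, LipschitzWith C fun x => Ψ x t
  lip_inv : ∀ t, LipschitzWith C fun x => Θ x t
  lip_fderiv : ∀ t, LipschitzWith C (fderiv ℝ fun x => Ψ x t)
  lip_fderiv_inv : ∀ t, LipschitzWith C (fderiv ℝ fun x => Θ x t)
  norm_sub_le : ∀ t x, ‖Ψ x t - x‖ ≤ C

theorem path_eq_iff (h : t₀ ≤ T) {V : C(X, C(Icc t₀ T, X))} {Ψ : X → C(Icc t₀ T, X)}
    (he : ∀ x, Ψ x = ContinuousMap.const _ x + primitiveC h (superpos V (Ψ x))) (x x' : X) :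
    Ψ x - Ψ x' = ContinuousMap.const _ (x - x')
      + primitiveC h (superpos V (Ψ x) - superpos V (Ψ x')) := by
  rw [map_sub]
  nth_rewrite 1 [he x, he x']
  ext t
  simp only [ContinuousMap.sub_apply, ContinuousMap.add_apply, ContinuousMap.const_apply]
  abel

variable {h : t₀ ≤ T} {V : C(X, C(Icc t₀ T, X))} {K : ℝ≥0} {Ψ : X → C(Icc t₀ T, X)}

theorem initial_eq (he : ∀ x, Ψ x = ContinuousMap.const _ x + primitiveC h (superpos V (Ψ x)))
    (x : X) : Ψ x ⟨t₀, left_mem_Icc.2 h⟩ = x := by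
  rw [he x]
  simp [primitiveC_apply]

/-- Two-sided Gronwall estimate for a path with a linearly bounded derivative. -/
theorem path_gronwall (h : t₀ ≤ T) {α g : C(Icc t₀ T, X)} {x : X} {K : ℝ≥0}
    (hα : α = ContinuousMap.const _ x + primitiveC h g) (hg : ∀ t, ‖g t‖ ≤ K * ‖α t‖)
    (t : Icc t₀ T) :
    ‖α t‖ ≤ Real.exp (K * (T - t₀)) * ‖x‖ ∧ ‖x‖ ≤ Real.exp (K * (T - t₀)) * ‖α t‖ := by
  have hd := hasDerivWithinAt_of_eq_primitiveC h hα
  have hb : ∀ s ∈ Icc t₀ T, ‖IccExtend h g s‖ ≤ K * ‖IccExtend h α s‖ := fun s hs => by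
    rw [IccExtend_of_mem h _ hs, IccExtend_of_mem h _ hs]; exact hg _
  have h0 : IccExtend h α t₀ = x := by
    rw [IccExtend_left, hα]; simp [primitiveC_apply]
  have ht : IccExtend h α t = α t := by rw [IccExtend_of_mem h _ t.2]
  have hexp : Real.exp (K * (t - t₀)) ≤ Real.exp (K * (T - t₀)) := by
    gcongr; exact t.2.2
  constructor
  · have h1 := norm_le_mul_exp_of_hasDerivWithinAt hd (le_of_eq (by rw [h0])) hb t t.2
    rw [ht, mul_comm] at h1
    exact h1.trans (by gcongr)
  · have h1 := norm_initial_le_mul_exp hd hb t t.2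
    rw [h0, ht, mul_comm] at h1
    exact h1.trans (by gcongr)

theorem flow_gronwall (hK : ∀ t, LipschitzWith K fun x => V x t)
    (he : ∀ x, Ψ x = ContinuousMap.const _ x + primitiveC h (superpos V (Ψ x)))
    (t : Icc t₀ T) (x x' : X) :
    ‖Ψ x t - Ψ x' t‖ ≤ Real.exp (K * (T - t₀)) * ‖x - x'‖ ∧
      ‖x - x'‖ ≤ Real.exp (K * (T - t₀)) * ‖Ψ x t - Ψ x' t‖ :=
  path_gronwall h (path_eq_iff h he x x') (fun s => (hK s).norm_sub_le _ _) t

/-- The variational equation, obtained by differentiating the integral equation for Ψ as an identity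
between path-valued maps; it is again an integral equation, so the path estimates apply to it. -/
theorem flow_variational (hV : ContDiff ℝ 3 V) (hΨ : ContDiff ℝ 3 Ψ)
    (he : ∀ x, Ψ x = ContinuousMap.const _ x + primitiveC h (superpos V (Ψ x))) (x k : X) :
    ∃ g : C(Icc t₀ T, X), fderiv ℝ Ψ x k = ContinuousMap.const _ k + primitiveC h g ∧
      ∀ t, g t = fderiv ℝ (fun x => V x t) (Ψ x t) (fderiv ℝ Ψ x k t) := by
  obtain ⟨A, hA, hA'⟩ := hasFDerivAt_superpos V (hV.of_le (by norm_num)) (Ψ x)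
  have hd := (hΨ.differentiable (by simp) x).hasFDerivAt
  let cst : X →L[ℝ] C(Icc t₀ T, X) := ContinuousLinearMap.mk
    { toFun := fun x => ContinuousMap.const _ x
      map_add' := fun _ _ => rfl
      map_smul' := fun _ _ => rfl } ContinuousMap.continuous_const'
  have h1 : HasFDerivAt Ψ (cst + (primitiveC h).comp (A.comp (fderiv ℝ Ψ x))) x := by
    have := cst.hasFDerivAt.add ((primitiveC h).hasFDerivAt.comp x (hA.comp x hd))
    exact this.congr_of_eventuallyEq (Eventually.of_forall he)
  refine ⟨A (fderiv ℝ Ψ x k), ?_, fun t => hA' _ _⟩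
  nth_rewrite 1 [h1.fderiv]
  rfl

/-- The variational equation is linear with coefficient of norm at most K. The lower bound is the
one that makes DΨ_t invertible with control uniform in t and x. -/
theorem flow_fderiv_gronwall (hV : FlowField V K) (hΨ : ContDiff ℝ 3 Ψ)
    (he : ∀ x, Ψ x = ContinuousMap.const _ x + primitiveC h (superpos V (Ψ x)))
    (t : Icc t₀ T) (x k : X) :
    ‖fderiv ℝ (fun x => Ψ x t) x k‖ ≤ Real.exp (K * (T - t₀)) * ‖k‖ ∧
      ‖k‖ ≤ Real.exp (K * (T - t₀)) * ‖fderiv ℝ (fun x => Ψ x t) x k‖ := by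
  obtain ⟨g, hg, hg'⟩ := flow_variational hV.smooth hΨ he x k
  rw [fderiv_eval (hΨ.differentiable (by simp))]
  refine path_gronwall h hg (fun s => ?_) t
  rw [hg']
  exact (ContinuousLinearMap.le_opNorm _ _).trans (by
    gcongr; exact norm_fderiv_le_of_lipschitz ℝ (hV.lip s))

/-- The difference of the variations at x and x' starts from zero and solves the variational
equation at x with forcing (DV(Ψx) - DV(Ψx')) q, of size at most K · M‖x - x'‖ · M‖k‖.
`gronwallBound` with zero initial value is linear in the forcing, which produces the factor ‖x -
x'‖. -/
theorem flow_fderiv_sub_le (hV : FlowField V K) (hΨ : ContDiff ℝ 3 Ψ)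
    (he : ∀ x, Ψ x = ContinuousMap.const _ x + primitiveC h (superpos V (Ψ x))) :
    ∃ C : ℝ≥0, ∀ t, LipschitzWith C (fderiv ℝ fun x => Ψ x t) := by
  set M := Real.exp (K * (T - t₀)) with hM
  have hM0 : 0 < M := Real.exp_pos _
  have hG0 : 0 ≤ gronwallBound 0 K (K * M * M) (T - t₀) := by
    have := gronwallBound_mono (δ := 0) (ε := K * M * M) (K := K) le_rfl (by positivity) K.2
      (sub_nonneg.2 h)
    rwa [gronwallBound_x0] at this
  refine ⟨⟨_, hG0⟩, fun t => ?_⟩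
  refine LipschitzWith.of_dist_le_mul fun x x' => ?_
  rw [dist_eq_norm, dist_eq_norm]
  refine ContinuousLinearMap.opNorm_le_bound _ (mul_nonneg hG0 (norm_nonneg _)) fun k => ?_
  have hd : Differentiable ℝ Ψ := hΨ.differentiable (by simp)
  obtain ⟨g, hg, hg'⟩ := flow_variational hV.smooth hΨ he x k
  obtain ⟨g₂, hg₂, hg₂'⟩ := flow_variational hV.smooth hΨ he x' k
  set p := fderiv ℝ Ψ x k
  set q := fderiv ℝ Ψ x' k
  have heq : p - q = ContinuousMap.const _ (0 : X) + primitiveC h (g - g₂) := by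
    rw [map_sub, hg, hg₂]; ext s; simp
  have hder := hasDerivWithinAt_of_eq_primitiveC h heq
  have hq : ∀ s, ‖q s‖ ≤ M * ‖k‖ := fun s => by
    have := (flow_fderiv_gronwall hV hΨ he s x' k).1
    rwa [fderiv_eval hd] at this
  have hb : ∀ s : Icc t₀ T, ‖(g - g₂) s‖ ≤ K * ‖(p - q) s‖ + K * M * M * ‖x - x'‖ * ‖k‖ := by
    intro s
    have e : (g - g₂) s = fderiv ℝ (fun x => V x s) (Ψ x s) ((p - q) s)
        + (fderiv ℝ (fun x => V x s) (Ψ x s) - fderiv ℝ (fun x => V x s) (Ψ x' s)) (q s) := by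
      rw [ContinuousMap.sub_apply, hg', hg₂']
      simp
    rw [e]
    refine (norm_add_le _ _).trans (add_le_add ?_ ?_)
    · exact (ContinuousLinearMap.le_opNorm _ _).trans (by
        gcongr; exact norm_fderiv_le_of_lipschitz ℝ (hV.lip s))
    · refine (ContinuousLinearMap.le_opNorm _ _).trans ?_
      have h1 := ((hV.lip_fderiv s).norm_sub_le (Ψ x s) (Ψ x' s)).trans
        (mul_le_mul_of_nonneg_left (flow_gronwall hV.lip he s x x').1 K.2)
      calc _ ≤ (K * (M * ‖x - x'‖)) * (M * ‖k‖) := by gcongr; exact hq s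
        _ = _ := by ring
  have hG := norm_le_gronwallBound_of_norm_deriv_right_le (f := IccExtend h (p - q))
    (f' := IccExtend h (g - g₂)) (δ := 0) (K := K) (ε := K * M * M * ‖x - x'‖ * ‖k‖)
    (a := t₀) (b := T) (fun t ht => (hder t ht).continuousWithinAt)
    (fun t ht => hasDerivWithinAt_Ici_of_Icc ht (hder t (Ico_subset_Icc_self ht)))
    (by rw [IccExtend_left, heq]; simp [primitiveC_apply])
    (fun s hs => by
      have hs' := Ico_subset_Icc_self hs
      rw [IccExtend_of_mem h _ hs', IccExtend_of_mem h _ hs']; exact hb _) t t.2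
  rw [IccExtend_of_mem h _ t.2] at hG
  have e2 : (fderiv ℝ (fun x => Ψ x t) x - fderiv ℝ (fun x => Ψ x t) x') k = (p - q) t := by
    rw [sub_apply, fderiv_eval hd, fderiv_eval hd]; rfl
  rw [e2]
  refine hG.trans ?_
  have hmono := gronwallBound_mono (δ := 0) (ε := K * M * M * ‖x - x'‖ * ‖k‖) (K := K) le_rfl
    (by positivity) K.2 (show (t : ℝ) - t₀ ≤ T - t₀ by linarith [t.2.2])
  refine hmono.trans (le_of_eq ?_)
  change _ = gronwallBound 0 K (K * M * M) (T - t₀) * ‖x - x'‖ * ‖k‖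
  simp only [gronwallBound]
  split_ifs <;> ring

end Flow

/-! ### The inverse flow as a smooth path-valued map. -/

section InverseFlow

variable {t₀ T : ℝ} {h : t₀ ≤ T}
variable {X : Type} [NormedAddCommGroup X] [NormedSpace ℝ X] [FiniteDimensional ℝ X]
variable {V : C(X, C(Icc t₀ T, X))} {K : ℝ≥0} {Ψ : X → C(Icc t₀ T, X)}

/-- The lower Gronwall bound gives injectivity, and finite dimension does the rest. -/
theorem exists_equiv_fderiv_flow [CompleteSpace X] (hV : FlowField V K) (hΨ : ContDiff ℝ 3 Ψ)
    (he : ∀ x, Ψ x = ContinuousMap.const _ x + primitiveC h (superpos V (Ψ x)))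
    (t : Icc t₀ T) (x : X) :
    ∃ D : X ≃L[ℝ] X, (D : X →L[ℝ] X) = fderiv ℝ (fun x => Ψ x t) x := by
  have hinj : Function.Injective (fderiv ℝ (fun x => Ψ x t) x : X →ₗ[ℝ] X) := by
    refine (injective_iff_map_eq_zero _).2 fun k hk => ?_
    have := (flow_fderiv_gronwall hV hΨ he t x k).2
    have hk' : fderiv ℝ (fun x => Ψ x t) x k = 0 := hk
    rw [hk', norm_zero, mul_zero] at this
    exact norm_le_zero_iff.1 this
  exact ⟨(LinearEquiv.ofInjectiveEndo _ hinj).toContinuousLinearEquiv, by ext; rfl⟩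

/-- The range is closed because Ψ_t is antilipschitz, open because its differential is invertible,
and the space is connected. This avoids solving the equation backward in time. -/
theorem flow_surjective [CompleteSpace X] (hV : FlowField V K) (hΨ : ContDiff ℝ 3 Ψ)
    (he : ∀ x, Ψ x = ContinuousMap.const _ x + primitiveC h (superpos V (Ψ x)))
    (t : Icc t₀ T) : Function.Surjective fun x => Ψ x t := by
  have hsm : ContDiff ℝ 3 fun x => Ψ x t := contDiff_eval hΨ t
  have hanti : AntilipschitzWith ⟨Real.exp (K * (T - t₀)), (Real.exp_pos _).le⟩
      fun x => Ψ x t := by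
    refine AntilipschitzWith.of_le_mul_dist fun x x' => ?_
    rw [dist_eq_norm, dist_eq_norm]
    exact (flow_gronwall hV.lip he t x x').2
  have hclosed : IsClosed (range fun x => Ψ x t) := by
    refine hanti.isClosed_range ?_
    have : LipschitzWith ⟨Real.exp (K * (T - t₀)), (Real.exp_pos _).le⟩ fun x => Ψ x t := by
      refine LipschitzWith.of_dist_le_mul fun x x' => ?_
      rw [dist_eq_norm, dist_eq_norm]
      exact (flow_gronwall hV.lip he t x x').1
    exact this.uniformContinuous
  choose D hD using exists_equiv_fderiv_flow hV hΨ he t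
  have hopen : IsOpen (range fun x => Ψ x t) := by
    refine (isOpenMap_of_hasStrictFDerivAt_equiv (f' := D) fun x => ?_).isOpen_range
    rw [hD]
    exact hsm.contDiffAt.hasStrictFDerivAt (by simp)
  exact range_eq_univ.1 (IsClopen.eq_univ ⟨hclosed, hopen⟩ (range_nonempty _))

/-- To obtain Θ as a C³ map into paths, and not only at each fixed time, the map α ↦ (t ↦ Ψ_t(α t))
is inverted on the whole path space. It is a homeomorphism with pointwise inverse, its differential
acts pointwise by DΨ_t(α t), and restricting the C³ inverse to constant paths gives Θ. -/
theorem exists_isFlow [CompleteSpace X] (h : t₀ ≤ T) (hV : FlowField V K) :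
    ∃ Ψ Θ : X → C(Icc t₀ T, X), ∃ C : ℝ≥0, IsFlow h V Ψ Θ C := by
  obtain ⟨Ψ, hΨ, he⟩ := exists_contDiff_integral_curves h (n := 3) (by norm_num) V
    (by exact_mod_cast hV.smooth) hV.lip
  replace hΨ : ContDiff ℝ 3 Ψ := by exact_mod_cast hΨ
  have hdΨ : Differentiable ℝ Ψ := hΨ.differentiable (by simp)
  set M : ℝ≥0 := ⟨Real.exp (K * (T - t₀)), (Real.exp_pos _).le⟩ with hM
  have hG : ∀ t x x', ‖Ψ x t - Ψ x' t‖ ≤ M * ‖x - x'‖ := fun t x x' =>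
    (flow_gronwall hV.lip he t x x').1
  have hG' : ∀ t x x', ‖x - x'‖ ≤ M * ‖Ψ x t - Ψ x' t‖ := fun t x x' =>
    (flow_gronwall hV.lip he t x x').2
  choose θ hθ using fun t => flow_surjective hV hΨ he t
  replace hθ : ∀ t x, Ψ (θ t x) t = x := hθ
  have hθl : ∀ t x, θ t (Ψ x t) = x := fun t x => by
    have := hG' t (θ t (Ψ x t)) x
    rw [hθ, sub_self, norm_zero, mul_zero] at this
    exact sub_eq_zero.1 (norm_le_zero_iff.1 this)
  have hθlip : ∀ t x x', ‖θ t x - θ t x'‖ ≤ M * ‖x - x'‖ := fun t x x' => by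
    have := hG' t (θ t x) (θ t x')
    rwa [hθ, hθ] at this
  -- With t fixed, the antilipschitz bound at time s compares θ_s(α s) to the fixed point θ_t(α t)
  -- through ‖α s - Ψ_s(θ_t(α t))‖, which is continuous in s and vanishes at s = t.
  have hθc : ∀ α : C(Icc t₀ T, X), Continuous fun t => θ t (α t) := by
    intro α
    refine continuous_iff_continuousAt.2 fun t => ?_
    refine tendsto_iff_norm_sub_tendsto_zero.2 ?_
    have hlim : Tendsto (fun s => M * ‖α s - Ψ (θ t (α t)) s‖) (𝓝 t) (𝓝 0) := by
      have hc : Continuous fun s => M * ‖α s - Ψ (θ t (α t)) s‖ := by fun_prop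
      have := hc.tendsto t
      simpa [hθ] using this
    refine squeeze_zero (fun _ => norm_nonneg _) (fun s => ?_) hlim
    have := hG' s (θ s (α s)) (θ t (α t))
    rwa [hθ] at this
  let ΨC : C(X, C(Icc t₀ T, X)) := ⟨Ψ, hΨ.continuous⟩
  let inv : C(Icc t₀ T, X) → C(Icc t₀ T, X) := fun α => ⟨fun t => θ t (α t), hθc α⟩
  have hsm : ContDiff ℝ 3 (superpos ΨC) := by
    exact_mod_cast contDiff_superpos (n := 3) ΨC (by exact_mod_cast hΨ)
  let Φ : C(Icc t₀ T, X) ≃ₜ C(Icc t₀ T, X) :=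
    { toFun := superpos ΨC
      invFun := inv
      left_inv := fun α => by ext t; exact hθl t (α t)
      right_inv := fun α => by ext t; exact hθ t (α t)
      continuous_toFun := hsm.continuous
      continuous_invFun := by
        refine LipschitzWith.continuous (K := M) (LipschitzWith.of_dist_le_mul fun α β => ?_)
        refine (ContinuousMap.dist_le (by positivity)).2 fun t => ?_
        rw [dist_eq_norm]
        refine (hθlip t _ _).trans ?_
        rw [← dist_eq_norm]
        gcongr
        exact ContinuousMap.dist_apply_le_dist t }
  -- Injectivity is pointwise. For surjectivity the preimage is the pointwise one, and its
  -- continuity in t again follows from the lower bound, uniform in time, by comparison with a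
  -- frozen vector.
  have hequiv : ∀ α : C(Icc t₀ T, X), ∃ A : C(Icc t₀ T, X) ≃L[ℝ] C(Icc t₀ T, X),
      HasFDerivAt Φ (A : C(Icc t₀ T, X) →L[ℝ] C(Icc t₀ T, X)) α := by
    intro α
    obtain ⟨A, hA, hA'⟩ := hasFDerivAt_superpos ΨC (hΨ.of_le (by norm_num)) α
    have hlow : ∀ t k, ‖k‖ ≤ M * ‖fderiv ℝ (fun x => Ψ x t) (α t) k‖ := fun t k =>
      (flow_fderiv_gronwall hV hΨ he t (α t) k).2
    have hker : LinearMap.ker A.toLinearMap = ⊥ := by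
      refine LinearMap.ker_eq_bot'.2 fun p hp => ?_
      ext t
      have h1 := hlow t (p t)
      have h2 : A p t = 0 := by
        have : A p = 0 := hp
        rw [this]; rfl
      rw [hA'] at h2
      have h3 : fderiv ℝ (fun x => Ψ x t) (α t) (p t) = 0 := h2
      rw [h3, norm_zero, mul_zero] at h1
      exact norm_le_zero_iff.1 h1
    have hrange : LinearMap.range A.toLinearMap = ⊤ := by
      refine LinearMap.range_eq_top.2 fun g => ?_
      choose D hD using fun t => exists_equiv_fderiv_flow hV hΨ he t (α t)
      have hDp : ∀ t, fderiv ℝ (fun x => Ψ x t) (α t) ((D t).symm (g t)) = g t := fun t => by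
        rw [← hD]; exact (D t).apply_symm_apply _
      have hcont : Continuous fun t => (D t).symm (g t) := by
        refine continuous_iff_continuousAt.2 fun t => ?_
        refine tendsto_iff_norm_sub_tendsto_zero.2 ?_
        set k := (D t).symm (g t) with hk
        have hck : Continuous fun s => fderiv ℝ (fun x => Ψ x s) (α s) k := by
          simp_rw [fderiv_eval hdΨ]
          have : Continuous fun s => fderiv ℝ Ψ (α s) k :=
            ((hΨ.continuous_fderiv (by simp)).comp α.continuous).clm_apply continuous_const
          fun_prop
        have hlim : Tendsto (fun s => M * ‖g s - fderiv ℝ (fun x => Ψ x s) (α s) k‖) (𝓝 t)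
            (𝓝 0) := by
          have hc : Continuous fun s => M * ‖g s - fderiv ℝ (fun x => Ψ x s) (α s) k‖ := by
            fun_prop
          have := hc.tendsto t
          rwa [hk, hDp, sub_self, norm_zero, mul_zero] at this
        refine squeeze_zero (fun _ => norm_nonneg _) (fun s => ?_) hlim
        have := hlow s ((D s).symm (g s) - k)
        rwa [map_sub, hDp] at this
      refine ⟨⟨_, hcont⟩, ?_⟩
      ext t
      exact (hA' _ t).trans (hDp t)
    refine ⟨ContinuousLinearEquiv.ofBijective A hker hrange, ?_⟩
    exact hA
  choose A hA using hequiv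
  have hΦs : ContDiff ℝ 3 Φ.symm := Φ.contDiff_symm hA hsm
  let cst : X →L[ℝ] C(Icc t₀ T, X) := ContinuousLinearMap.mk
    { toFun := fun x => ContinuousMap.const _ x
      map_add' := fun _ _ => rfl
      map_smul' := fun _ _ => rfl } ContinuousMap.continuous_const'
  have hΘ : ContDiff ℝ 3 fun x => inv (ContinuousMap.const _ x) := hΦs.comp cst.contDiff
  obtain ⟨C₂, hC₂⟩ := flow_fderiv_sub_le hV hΨ he
  have hlip : ∀ t, LipschitzWith M fun x => Ψ x t := fun t =>
    LipschitzWith.of_dist_le_mul fun x x' => by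
      rw [dist_eq_norm, dist_eq_norm]; exact hG t x x'
  have hlip' : ∀ t, LipschitzWith M fun x => inv (ContinuousMap.const _ x) t := fun t =>
    LipschitzWith.of_dist_le_mul fun x x' => by
      rw [dist_eq_norm, dist_eq_norm]; exact hθlip t x x'
  have hlipD : ∀ t, LipschitzWith (M * (C₂ * M) * M)
      (fderiv ℝ fun x => inv (ContinuousMap.const _ x) t) := by
    intro t
    set N := fderiv ℝ fun x => inv (ContinuousMap.const _ x) t
    have hN : ∀ x, ‖N x‖ ≤ M := fun x => norm_fderiv_le_of_lipschitz ℝ (hlip' t)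
    have hdN : ∀ x, HasFDerivAt (fun x => θ t x) (N x) x := fun x =>
      ((contDiff_eval hΘ t).differentiable (by simp) x).hasFDerivAt
    have hdΨt : ∀ x, HasFDerivAt (fun x => Ψ x t) (fderiv ℝ (fun x => Ψ x t) x) x := fun x =>
      ((contDiff_eval hΨ t).differentiable (by simp) x).hasFDerivAt
    have e1 : ∀ x, (fderiv ℝ (fun x => Ψ x t) (θ t x)).comp (N x) = ContinuousLinearMap.id ℝ X := by
      intro x
      have h1 := (hdΨt (θ t x)).comp x (hdN x)
      have h2 : ((fun x => Ψ x t) ∘ fun x => θ t x) = id := funext fun x => hθ t x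
      rw [h2] at h1
      exact h1.unique (hasFDerivAt_id x)
    have e2 : ∀ x, (N x).comp (fderiv ℝ (fun x => Ψ x t) (θ t x)) = ContinuousLinearMap.id ℝ X := by
      intro x
      have h1 := (hdN (Ψ (θ t x) t)).comp (θ t x) (hdΨt (θ t x))
      have h2 : ((fun x => θ t x) ∘ fun x => Ψ x t) = id := funext fun x => hθl t x
      rw [h2, hθ] at h1
      exact h1.unique (hasFDerivAt_id _)
    refine LipschitzWith.of_dist_le_mul fun x x' => ?_
    rw [dist_eq_norm, dist_eq_norm]
    -- The resolvent identity P⁻¹ - Q⁻¹ = P⁻¹(Q - P)Q⁻¹, which transfers the Lipschitz bound from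
    -- DΨ_t to DΘ_t.
    have e3 : N x - N x' = (N x).comp ((fderiv ℝ (fun x => Ψ x t) (θ t x')
        - fderiv ℝ (fun x => Ψ x t) (θ t x)).comp (N x')) := by
      rw [ContinuousLinearMap.sub_comp, ContinuousLinearMap.comp_sub, e1,
        ← ContinuousLinearMap.comp_assoc, e2]
      ext; simp
    rw [e3]
    calc _ ≤ ‖N x‖ * (‖fderiv ℝ (fun x => Ψ x t) (θ t x')
        - fderiv ℝ (fun x => Ψ x t) (θ t x)‖ * ‖N x'‖) :=
          (ContinuousLinearMap.opNorm_comp_le _ _).trans (by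
            gcongr; exact ContinuousLinearMap.opNorm_comp_le _ _)
      _ ≤ M * ((C₂ * (M * ‖x' - x‖)) * M) := by
          gcongr
          · exact hN x
          · exact ((hC₂ t).norm_sub_le _ _).trans (by gcongr; exact hθlip t _ _)
          · exact hN x'
      _ = _ := by rw [norm_sub_rev]; push_cast; ring
  have hsub : ∀ t x, ‖Ψ x t - x‖ ≤ K * (T - t₀) := by
    intro t x
    rw [he x]
    simp only [ContinuousMap.add_apply, ContinuousMap.const_apply, add_sub_cancel_left,
      primitiveC_apply]
    refine (intervalIntegral.norm_integral_le_of_norm_le_const (C := K) fun s _ => ?_).trans ?_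
    · exact hV.bdd _ _
    · rw [abs_of_nonneg (sub_nonneg.2 t.2.1)]
      gcongr
      exact t.2.2
  obtain ⟨C₄, hC₄⟩ : ∃ C₄ : ℝ≥0, K * (T - t₀) ≤ C₄ :=
    ⟨⟨K * (T - t₀), mul_nonneg K.2 (sub_nonneg.2 h)⟩, le_rfl⟩
  let C := max (max M C₂) (max (M * (C₂ * M) * M) C₄)
  have l1 : M ≤ C := (le_max_left _ _).trans (le_max_left _ _)
  have l2 : C₂ ≤ C := (le_max_right _ _).trans (le_max_left _ _)
  have l3 : M * (C₂ * M) * M ≤ C := (le_max_left _ _).trans (le_max_right _ _)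
  have l4 : C₄ ≤ C := (le_max_right _ _).trans (le_max_right _ _)
  exact ⟨Ψ, fun x => inv (ContinuousMap.const _ x), C,
    { smooth := hΨ
      smooth_inv := hΘ
      eq := he
      right_inv := fun t x => hθ t x
      left_inv := fun t x => hθl t x
      lip := fun t => (hlip t).weaken l1
      lip_inv := fun t => (hlip' t).weaken l1
      lip_fderiv := fun t => (hC₂ t).weaken l2
      lip_fderiv_inv := fun t => (hlipD t).weaken l3
      norm_sub_le := fun t x => (hsub t x).trans (hC₄.trans (by exact_mod_cast l4)) }⟩

end InverseFlow

/-! ### Smooth maps into bounded continuous functions of a parameter. -/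

section ParametricSmoothness

variable {A X : Type} [NormedAddCommGroup A] [NormedSpace ℝ A]
  [NormedAddCommGroup X] [NormedSpace ℝ X]

/-- A bounded continuous family of linear maps, seen as a linear map with values in bounded
continuous functions. -/
noncomputable def flipB (A X F : Type) [NormedAddCommGroup A]
    [NormedAddCommGroup X] [NormedSpace ℝ X] [NormedAddCommGroup F] [NormedSpace ℝ F] :
    (A →ᵇ (X →L[ℝ] F)) →L[ℝ] X →L[ℝ] (A →ᵇ F) :=
  LinearMap.mkContinuous₂
    (LinearMap.mk₂ ℝ (fun (φ : A →ᵇ (X →L[ℝ] F)) (k : X) =>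
        (ContinuousLinearMap.apply ℝ F k).compLeftContinuousBounded A φ)
      (fun _ _ _ => by ext; simp) (fun _ _ _ => by ext; simp)
      (fun _ _ _ => by ext; simp) (fun _ _ _ => by ext; simp)) 1
    (fun φ k => by
      refine (BoundedContinuousFunction.norm_le (by positivity)).2 fun a => ?_
      rw [one_mul]
      change ‖φ a k‖ ≤ _
      exact ((φ a).le_opNorm k).trans (by gcongr; exact φ.norm_coe_le_norm a))

@[simp] theorem flipB_apply {F : Type} [NormedAddCommGroup F] [NormedSpace ℝ F]
    (φ : A →ᵇ (X →L[ℝ] F)) (k : X) (a : A) : flipB A X F φ k a = φ a k := rfl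

theorem norm_flipB_le {F : Type} [NormedAddCommGroup F] [NormedSpace ℝ F]
    (φ : A →ᵇ (X →L[ℝ] F)) : ‖flipB A X F φ‖ ≤ ‖φ‖ := by
  refine ContinuousLinearMap.opNorm_le_bound _ (norm_nonneg φ) fun k => ?_
  refine (BoundedContinuousFunction.norm_le (by positivity)).2 fun a => ?_
  change ‖φ a k‖ ≤ _
  exact ((φ a).le_opNorm k).trans (by gcongr; exact φ.norm_coe_le_norm a)

variable {F : Type} [NormedAddCommGroup F] [NormedSpace ℝ F]

theorem lipschitzWith_bcf {f : X → A → F} {C : ℝ≥0} (hf : ∀ a, Differentiable ℝ fun x => f x a)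
    (hC : ∀ x a, ‖fderiv ℝ (fun x => f x a) x‖ ≤ C) {g : X → (A →ᵇ F)}
    (hg : ∀ x a, g x a = f x a) : LipschitzWith C g := by
  refine LipschitzWith.of_dist_le_mul fun x x' => ?_
  refine (BoundedContinuousFunction.dist_le (by positivity)).2 fun a => ?_
  rw [hg, hg]
  exact (lipschitzWith_of_nnnorm_fderiv_le (hf a) (fun x => hC x a)).dist_le_mul x x'

/-- The remainder must be small uniformly over the noncompact parameter space. A Lipschitz bound on
the x-derivative that does not depend on a supplies this. -/
theorem hasFDerivAt_bcf {f : X → A → F} {C : ℝ≥0} (hf : ∀ a, Differentiable ℝ fun x => f x a)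
    (hC : ∀ x x' a, ‖fderiv ℝ (fun x => f x a) x - fderiv ℝ (fun x => f x a) x'‖ ≤ C * ‖x - x'‖)
    {g : X → (A →ᵇ F)} (hg : ∀ x a, g x a = f x a) {g' : X → (A →ᵇ (X →L[ℝ] F))}
    (hg' : ∀ x a, g' x a = fderiv ℝ (fun x => f x a) x) (x : X) :
    HasFDerivAt g (flipB A X F (g' x)) x := by
  rw [hasFDerivAt_iff_isLittleO_nhds_zero, Asymptotics.isLittleO_iff]
  intro ε hε
  have hδ : 0 < ε / (C + 1) := by positivity
  filter_upwards [Metric.ball_mem_nhds (0 : X) hδ] with k hk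
  refine (BoundedContinuousFunction.norm_le (by positivity)).2 fun a => ?_
  simp only [BoundedContinuousFunction.sub_apply, flipB_apply, hg, hg']
  have hkn : ‖k‖ < ε / (C + 1) := by simpa using hk
  have h3 := (convex_ball x (ε / (C + 1))).norm_image_sub_le_of_norm_hasFDerivWithin_le'
    (f := fun x => f x a) (f' := fderiv ℝ fun x => f x a) (φ := fderiv ℝ (fun x => f x a) x)
    (C := ε) (x := x) (y := x + k) (fun y _ => (hf a y).hasFDerivAt.hasFDerivWithinAt)
    (fun y hy => by
      refine (hC y x a).trans ?_
      have h1 : ‖y - x‖ < ε / (C + 1) := by rwa [mem_ball_iff_norm] at hy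
      calc (C : ℝ) * ‖y - x‖ ≤ (C + 1) * (ε / (C + 1)) := by gcongr; linarith
        _ = ε := by field_simp) (Metric.mem_ball_self hδ) (by simpa [dist_eq_norm] using hkn)
  simpa only [add_sub_cancel_left] using h3

theorem exists_bcf {f : X → A → F} {n : WithTop ℕ∞}
    (hf : ContDiff ℝ n fun p : X × A => f p.1 p.2) {C : ℝ} (hC : ∀ x a, ‖f x a‖ ≤ C) :
    ∃ g : X → (A →ᵇ F), ∀ x a, g x a = f x a :=
  ⟨fun x => BoundedContinuousFunction.ofNormedAddCommGroup (f x)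
    (hf.continuous.comp (by fun_prop : Continuous fun a : A => (x, a))) C (hC x), fun _ _ => rfl⟩

theorem contDiff_fderiv_param {f : X → A → F} {n : ℕ}
    (hf : ContDiff ℝ (n + 1) fun p : X × A => f p.1 p.2) :
    ContDiff ℝ n fun p : X × A => fderiv ℝ (fun x => f x p.2) p.1 := by
  have h1 : ContDiff ℝ (n + 1) (Function.uncurry fun (p : X × A) (x : X) => f x p.2) :=
    hf.comp (by fun_prop : ContDiff ℝ (n + 1) fun q : (X × A) × X => (q.2, q.1.2))
  exact ContDiff.fderiv h1 contDiff_fst le_rfl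

theorem contDiff_section {f : X → A → F} {n : WithTop ℕ∞}
    (hf : ContDiff ℝ n fun p : X × A => f p.1 p.2) (a : A) : ContDiff ℝ n fun x => f x a :=
  hf.comp (by fun_prop : ContDiff ℝ n fun x : X => (x, a))

/-- One derivative is lost: the bound on order n + 1 serves only to make the derivative of order n
continuous in x uniformly in the parameter. Four derivatives of b therefore give C³. -/
theorem contDiff_bcf (n : ℕ) : ∀ {F : Type} [NormedAddCommGroup F] [NormedSpace ℝ F]
    {f : X → A → F} {C : ℝ≥0}, ContDiff ℝ (n + 1 : ℕ) (fun p : X × A => f p.1 p.2) →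
    (∀ j ≤ n + 1, ∀ x a, ‖iteratedFDeriv ℝ j (fun x => f x a) x‖ ≤ C) →
    ∀ {g : X → (A →ᵇ F)}, (∀ x a, g x a = f x a) → ContDiff ℝ n g := by
  induction n with
  | zero =>
    intro F _ _ f C hf hC g hg
    refine contDiff_zero.2 (lipschitzWith_bcf (f := f) (C := C) (fun a =>
      (contDiff_section hf a).differentiable (by simp)) (fun x a => ?_) hg).continuous
    have := hC 1 le_rfl x a
    rwa [norm_iteratedFDeriv_one] at this
  | succ n ih =>
    intro F _ _ f C hf hC g hg
    have hf' : ContDiff ℝ (n + 1 : ℕ) fun p : X × A => fderiv ℝ (fun x => f x p.2) p.1 :=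
      contDiff_fderiv_param (n := n + 1) (by exact_mod_cast hf)
    have hC' : ∀ j ≤ n + 1, ∀ x a,
        ‖iteratedFDeriv ℝ j (fun x => fderiv ℝ (fun x => f x a) x) x‖ ≤ C := by
      intro j hj x a
      rw [norm_iteratedFDeriv_fderiv]
      exact hC (j + 1) (by omega) x a
    obtain ⟨g', hg'⟩ := exists_bcf (f := fun x a => fderiv ℝ (fun x => f x a) x) hf'
      (C := C) (fun x a => by simpa using hC' 0 (by omega) x a)
    have h1 := ih (f := fun x a => fderiv ℝ (fun x => f x a) x) hf' hC' hg'
    have hdiff : ∀ a, Differentiable ℝ fun x => f x a := fun a =>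
      (contDiff_section hf a).differentiable (by simp)
    have hlip := lipschitzWith_bcf (f := fun x a => fderiv ℝ (fun x => f x a) x) (C := C)
      (fun a => (contDiff_section (f := fun x a => fderiv ℝ (fun x => f x a) x) hf' a).differentiable (by simp))
      (fun x a => by simpa using hC' 1 (by omega) x a) hg'
    have : ContDiff ℝ ((n : WithTop ℕ∞) + 1) g := by
      refine contDiff_succ_iff_hasFDerivAt.2 ⟨_, (flipB A X F).contDiff.comp h1, fun x => ?_⟩
      refine hasFDerivAt_bcf hdiff (C := C) (fun x x' a => ?_) hg hg' x
      rw [← hg', ← hg']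
      exact ((g' x - g' x').norm_coe_le_norm a).trans (hlip.norm_sub_le x x')
    exact_mod_cast this

/-- The data of a smooth family of bounded continuous functions. -/
structure SmoothFamily (g : X → (A →ᵇ F)) (C : ℝ≥0) : Prop where
  smooth : ContDiff ℝ 3 g
  bdd : ∀ x, ‖g x‖ ≤ C
  lip : LipschitzWith C g
  lip_fderiv : LipschitzWith C (fderiv ℝ g)

theorem exists_smoothFamily {f : X → A → F} {C : ℝ≥0}
    (hf : ContDiff ℝ 4 (fun p : X × A => f p.1 p.2))
    (hC : ∀ j ≤ 4, ∀ x a, ‖iteratedFDeriv ℝ j (fun x => f x a) x‖ ≤ C) :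
    ∃ g : X → (A →ᵇ F), (∀ x a, g x a = f x a) ∧ SmoothFamily g C := by
  obtain ⟨g, hg⟩ := exists_bcf hf (C := C) (fun x a => by simpa using hC 0 (by omega) x a)
  have hf' : ContDiff ℝ (3 : ℕ) fun p : X × A => fderiv ℝ (fun x => f x p.2) p.1 :=
    contDiff_fderiv_param (n := 3) (by norm_num; exact hf)
  have hC1 : ∀ x a, ‖fderiv ℝ (fun x => f x a) x‖ ≤ C := fun x a => by
    have := hC 1 (by omega) x a
    rwa [norm_iteratedFDeriv_one] at this
  have hC2 : ∀ x a, ‖fderiv ℝ (fun x => fderiv ℝ (fun x => f x a) x) x‖ ≤ C := fun x a => by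
    have := hC 2 (by omega) x a
    rw [← norm_iteratedFDeriv_fderiv] at this
    rwa [norm_iteratedFDeriv_one] at this
  obtain ⟨g', hg'⟩ := exists_bcf (f := fun x a => fderiv ℝ (fun x => f x a) x) hf' hC1
  have hdiff : ∀ a, Differentiable ℝ fun x => f x a := fun a =>
    (contDiff_section hf a).differentiable (by simp)
  have hlip := lipschitzWith_bcf (f := fun x a => fderiv ℝ (fun x => f x a) x) (C := C)
    (fun a => (contDiff_section (f := fun x a => fderiv ℝ (fun x => f x a) x) hf' a).differentiable (by simp)) hC2 hg'
  refine ⟨g, hg, ?_, fun x => ?_, lipschitzWith_bcf hdiff hC1 hg, ?_⟩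
  · have := contDiff_bcf 3 (f := f) (C := C) (by exact_mod_cast hf) hC hg
    exact_mod_cast this
  · refine (BoundedContinuousFunction.norm_le C.2).2 fun a => ?_
    rw [hg]
    simpa using hC 0 (by omega) x a
  · have hd : ∀ x, fderiv ℝ g x = flipB A X F (g' x) := fun x =>
      (hasFDerivAt_bcf hdiff (C := C) (fun x x' a => by
        rw [← hg', ← hg']
        exact ((g' x - g' x').norm_coe_le_norm a).trans (hlip.norm_sub_le x x')) hg hg' x).fderiv
    refine LipschitzWith.of_dist_le_mul fun x x' => ?_
    rw [dist_eq_norm, dist_eq_norm, hd, hd, ← map_sub]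
    exact (norm_flipB_le _).trans (hlip.norm_sub_le x x')

end ParametricSmoothness

/-! ### Factoring the coefficient as a polynomial weight times a bounded family. -/

section Coefficient

variable {d₁ d₂ d' : ℕ}

/-- The weight `(1 + |a|²)³` on the parameter space. -/
noncomputable def weight (a : E d') : ℝ := (1 + ‖a‖ ^ 2) ^ 3

theorem one_le_weight (a : E d') : 1 ≤ weight a := one_le_pow₀ (by nlinarith [sq_nonneg ‖a‖])

theorem weight_pos (a : E d') : 0 < weight a := zero_lt_one.trans_le (one_le_weight a)

theorem contDiff_weight {n : WithTop ℕ∞} : ContDiff ℝ n (weight : E d' → ℝ) := by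
  unfold weight
  exact (contDiff_const.add (contDiff_norm_sq ℝ)).pow 3

theorem pow_le_weight (a : E d') {j : ℕ} (hj : j ≤ 6) : ‖a‖ ^ j ≤ weight a := by
  rcases le_total ‖a‖ 1 with h | h
  · exact (pow_le_one₀ (norm_nonneg _) h).trans (one_le_weight a)
  · calc ‖a‖ ^ j ≤ ‖a‖ ^ 6 := pow_le_pow_right₀ h hj
      _ = (‖a‖ ^ 2) ^ 3 := by ring
      _ ≤ weight a := by unfold weight; gcongr; linarith

/-- Four x-derivatives of b grow at most like |a|⁵, which the weight of degree 6 dominates; an even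
degree keeps the weight smooth in a. -/
theorem exists_coefficient {b : E d₁ → E d' → E d₁} {ℓ : E d' → ℝ} {L : Phase d₁ d₂ → ℝ}
    (hreg : RegularData b ℓ L) :
    ∃ g : E d₁ → (E d' →ᵇ E d₁), ∃ C : ℝ≥0, SmoothFamily g C ∧ ∀ x a, b x a = weight a • g x a := by
  obtain ⟨C, hC⟩ := hreg.b_bound
  have hC0 : 0 ≤ C := by
    have := (norm_nonneg _).trans (hC 0 0 (by omega) 0 0)
    simp at this
    linarith
  obtain ⟨g, hg, hs⟩ := exists_smoothFamily (f := fun x a => (weight a)⁻¹ • b x a)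
    -- One factor 2 comes from 1 + ‖a‖^(j+1) ≤ 2 `weight a`, the other from 1 + ‖x‖⁰ = 2.
    (C := ⟨C * 2 * 2, by positivity⟩)
    (((contDiff_weight.comp contDiff_snd).inv fun p => (weight_pos _).ne').smul hreg.b_smooth)
    (fun j hj x a => by
      have hsm : ContDiff ℝ 4 fun x => b x a := contDiff_section hreg.b_smooth a
      rw [show (fun x => (weight a)⁻¹ • b x a) = (weight a)⁻¹ • fun x => b x a from rfl,
        iteratedFDeriv_const_smul_apply ((hsm.of_le (by exact_mod_cast hj)).contDiffAt), norm_smul,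
        norm_inv, Real.norm_of_nonneg (weight_pos a).le]
      have h1 := hC j 0 (by omega) x a
      have e : (fun x' => iteratedFDeriv ℝ 0 (fun a' => b x' a') a)
          = (continuousMultilinearCurryFin0 ℝ (E d') (E d₁)).symm ∘ fun x' => b x' a := rfl
      rw [e, LinearIsometryEquiv.norm_iteratedFDeriv_comp_left] at h1
      rw [inv_mul_le_iff₀ (weight_pos a)]
      refine h1.trans ?_
      change _ ≤ weight a * (C * 2 * 2)
      have h2 := pow_le_weight a (j := j + 1) (by omega)
      have h3 := one_le_weight a
      calc C * (1 + ‖a‖ ^ (j + 1)) * (1 + ‖x‖ ^ 0) ≤ C * (weight a + weight a) * (1 + 1) := by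
            simp only [pow_zero]; gcongr
        _ = weight a * (C * 2 * 2) := by ring)
  refine ⟨g, _, hs, fun x a => ?_⟩
  rw [hg, smul_smul, mul_inv_cancel₀ (weight_pos a).ne', one_smul]

end Coefficient

/-! ### Pointwise consequences of the growth norms. -/

section Growth

variable {d₁ d₂ : ℕ} {F : Type*} [NormedAddCommGroup F] [NormedSpace ℝ F]

/-- The weight `1 + |x|ᵖ + |y|ᵖ`. -/
noncomputable def gw (p : ℕ) (z : Phase d₁ d₂) : ℝ := 1 + ‖z.1‖ ^ p + ‖z.2‖ ^ p

theorem one_le_gw (p : ℕ) (z : Phase d₁ d₂) : 1 ≤ gw p z := by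
  unfold gw; nlinarith [pow_nonneg (norm_nonneg z.1) p, pow_nonneg (norm_nonneg z.2) p]

theorem gw_pos (p : ℕ) (z : Phase d₁ d₂) : 0 < gw p z := zero_lt_one.trans_le (one_le_gw p z)

theorem continuous_gw (p : ℕ) : Continuous (gw p : Phase d₁ d₂ → ℝ) := by unfold gw; fun_prop

theorem norm_le_of_growthNorm_le {k p : ℕ} {f : Phase d₁ d₂ → F} {C : ℝ≥0}
    (h : growthNorm k p f ≤ C) {j : ℕ} (hj : j ≤ k) (z : Phase d₁ d₂) :
    ‖iteratedFDeriv ℝ j f z‖ ≤ C * gw p z := by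
  have h1 := (le_iSup (fun z : Phase d₁ d₂ => ENNReal.ofReal
      ((∑ j ∈ Finset.range (k + 1), ‖iteratedFDeriv ℝ j f z‖) / (1 + ‖z.1‖ ^ p + ‖z.2‖ ^ p))) z)
  have h2 := h1.trans h
  rw [ENNReal.ofReal_le_iff_le_toReal ENNReal.coe_ne_top, ENNReal.coe_toReal] at h2
  replace h2 := (div_le_iff₀ (gw_pos p z)).1 h2
  refine le_trans ?_ h2
  exact Finset.single_le_sum (f := fun j => ‖iteratedFDeriv ℝ j f z‖)
    (fun _ _ => norm_nonneg _) (Finset.mem_range.2 (by omega))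

theorem growthNorm_le_of_forall {k p : ℕ} {f : Phase d₁ d₂ → F} {C : ℝ}
    (h : ∀ z, ∑ j ∈ Finset.range (k + 1), ‖iteratedFDeriv ℝ j f z‖ ≤ C * gw p z) :
    growthNorm k p f ≤ ENNReal.ofReal C := by
  refine iSup_le fun z => ENNReal.ofReal_le_ofReal ?_
  exact (div_le_iff₀ (gw_pos p z)).2 (h z)

theorem norm_fderiv_le_of_growthNorm21 {f : Phase d₁ d₂ → ℝ} {C : ℝ≥0} (h : growthNorm21 0 f ≤ C)
    (z : Phase d₁ d₂) : ‖fderiv ℝ f z‖ ≤ C * gw 1 z := by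
  have h1 : growthNorm 0 1 (fderiv ℝ f) ≤ C := le_add_self.trans h
  simpa using norm_le_of_growthNorm_le h1 le_rfl z

theorem norm_fderiv_le_of_growthNorm {k p : ℕ} (hk : 1 ≤ k) {f : Phase d₁ d₂ → F} {C : ℝ≥0}
    (h : growthNorm k p f ≤ C) (z : Phase d₁ d₂) : ‖fderiv ℝ f z‖ ≤ C * gw p z := by
  rw [← norm_iteratedFDeriv_one (𝕜 := ℝ)]
  exact norm_le_of_growthNorm_le h hk z

/-- Replaces partial gradients by the full differential on horizontal vectors, for which the chain
rule along the flow is available. -/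
theorem inner_gradX {φ : Phase d₁ d₂ → ℝ} {z : Phase d₁ d₂} (h : DifferentiableAt ℝ φ z)
    (w : E d₁) : inner ℝ w (gradX φ z) = fderiv ℝ φ z (w, 0) := by
  have h1 : HasFDerivAt (fun x : E d₁ => φ (x, z.2))
      ((fderiv ℝ φ z).comp (ContinuousLinearMap.inl ℝ (E d₁) (E d₂))) z.1 := by
    have h2 : HasFDerivAt (fun x : E d₁ => (x, z.2)) (ContinuousLinearMap.inl ℝ (E d₁) (E d₂)) z.1 :=
      hasFDerivAt_prodMk_left z.1 z.2
    exact HasFDerivAt.comp (g := φ) z.1 (by exact h.hasFDerivAt) h2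
  rw [gradX, gradient, h1.fderiv, real_inner_comm, InnerProductSpace.toDual_symm_apply]
  rfl

end Growth

/-! ### Time-dependent functions with gradients of linear growth. -/

section Families

variable {d₁ d₂ : ℕ} {t₀ T : ℝ}

/-- A family of `C¹` functions whose gradient has linear growth, continuously in time. -/
structure LinearGrad (t₀ T : ℝ) (f : ℝ → Phase d₁ d₂ → ℝ) : Prop where
  smooth : ∀ t ∈ Icc t₀ T, ContDiff ℝ 1 (f t)
  growth : ∀ t ∈ Icc t₀ T, ∃ C : ℝ, ∀ z, ‖fderiv ℝ (f t) z‖ ≤ C * gw 1 z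
  cont : ∀ t ∈ Icc t₀ T, ∀ ε > 0, ∀ᶠ s in 𝓝[Icc t₀ T] t, ∀ z,
    ‖fderiv ℝ (f s) z - fderiv ℝ (f t) z‖ ≤ ε * gw 1 z

theorem LinearGrad.differentiable {f : ℝ → Phase d₁ d₂ → ℝ} (hf : LinearGrad t₀ T f) {t : ℝ}
    (ht : t ∈ Icc t₀ T) : Differentiable ℝ (f t) := (hf.smooth t ht).differentiable (by simp)

/-- Continuity in time bounds the gradients near each time, and compactness of the interval patches
the local bounds. -/
theorem LinearGrad.exists_bound {f : ℝ → Phase d₁ d₂ → ℝ} (hf : LinearGrad t₀ T f) :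
    ∃ C : ℝ≥0, ∀ t ∈ Icc t₀ T, ∀ z, ‖fderiv ℝ (f t) z‖ ≤ C * gw 1 z := by
  refine isCompact_Icc.induction_on (p := fun S => ∃ C : ℝ≥0, ∀ t ∈ S, ∀ z,
    ‖fderiv ℝ (f t) z‖ ≤ C * gw 1 z) ⟨0, by simp⟩ ?_ ?_ ?_
  · rintro s t hst ⟨C, hC⟩
    exact ⟨C, fun r hr => hC r (hst hr)⟩
  · rintro s t ⟨C, hC⟩ ⟨C', hC'⟩
    refine ⟨max C C', fun r hr z => ?_⟩
    have := (gw_pos 1 z).le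
    rcases hr with hr | hr
    · exact (hC r hr z).trans (by gcongr; exact le_max_left _ _)
    · exact (hC' r hr z).trans (by gcongr; exact le_max_right _ _)
  · intro t ht
    obtain ⟨C, hC⟩ := hf.growth t ht
    refine ⟨_, hf.cont t ht 1 one_pos, ⟨max C 0 + 1, by positivity⟩, fun s hs z => ?_⟩
    have h1 := hs z
    have h2 := hC z
    have h3 := norm_le_insert' (fderiv ℝ (f s) z) (fderiv ℝ (f t) z)
    have h4 : C * gw 1 z ≤ max C 0 * gw 1 z :=
      mul_le_mul_of_nonneg_right (le_max_left _ _) (gw_pos 1 z).le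
    change _ ≤ (max C 0 + 1) * gw 1 z
    linarith

theorem LinearGrad.continuousOn {f : ℝ → Phase d₁ d₂ → ℝ} (hf : LinearGrad t₀ T f) :
    ContinuousOn (fun q : ℝ × Phase d₁ d₂ => fderiv ℝ (f q.1) q.2) (Icc t₀ T ×ˢ univ) := by
  rintro ⟨t, z⟩ ⟨ht, -⟩
  have hc : Continuous (fderiv ℝ (f t)) := (hf.smooth t ht).continuous_fderiv (by simp)
  rw [ContinuousWithinAt, tendsto_iff_norm_sub_tendsto_zero]
  rw [Metric.tendsto_nhds]
  intro ε hε
  have hfst : Tendsto (fun q : ℝ × Phase d₁ d₂ => q.1) (𝓝[Icc t₀ T ×ˢ univ] (t, z))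
      (𝓝[Icc t₀ T] t) :=
    tendsto_nhdsWithin_iff.2 ⟨continuous_fst.continuousAt.mono_left nhdsWithin_le_nhds, by
      filter_upwards [self_mem_nhdsWithin] with q hq using hq.1⟩
  have hgw : ∀ᶠ q : ℝ × Phase d₁ d₂ in 𝓝[Icc t₀ T ×ˢ univ] (t, z), gw 1 q.2 < gw 1 z + 1 :=
    have hc1 : Continuous fun q : ℝ × Phase d₁ d₂ => gw 1 q.2 :=
      (continuous_gw 1).comp continuous_snd
    ((hc1.tendsto (t, z)).mono_left nhdsWithin_le_nhds).eventually (gt_mem_nhds (lt_add_one _))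
  have hclose : ∀ᶠ q : ℝ × Phase d₁ d₂ in 𝓝[Icc t₀ T ×ˢ univ] (t, z),
      ‖fderiv ℝ (f t) q.2 - fderiv ℝ (f t) z‖ < ε / 2 := by
    have hc2 : Continuous fun q : ℝ × Phase d₁ d₂ => ‖fderiv ℝ (f t) q.2 - fderiv ℝ (f t) z‖ := by
      fun_prop
    have := hc2.tendsto (t, z)
    simp only [sub_self, norm_zero] at this
    exact (this.mono_left nhdsWithin_le_nhds).eventually (gt_mem_nhds (half_pos hε))
  have hpos : 0 < ε / (2 * (gw 1 z + 1)) := by have := gw_pos 1 z; positivity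
  filter_upwards [hfst.eventually (hf.cont t ht _ hpos), hgw, hclose] with q h1 h2 h3
  rw [Real.dist_eq, sub_zero, abs_norm]
  have h4 := h1 q.2
  have h5 : ε / (2 * (gw 1 z + 1)) * gw 1 q.2 ≤ ε / 2 := by
    have := gw_pos 1 z
    calc _ ≤ ε / (2 * (gw 1 z + 1)) * (gw 1 z + 1) := by gcongr
      _ = ε / 2 := by field_simp
  calc _ ≤ ‖fderiv ℝ (f q.1) q.2 - fderiv ℝ (f t) q.2‖ + ‖fderiv ℝ (f t) q.2 - fderiv ℝ (f t) z‖ :=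
        norm_sub_le_norm_sub_add_norm_sub _ _ _
    _ < ε := by linarith

theorem linearGrad_of_solvesAdjoint {d' : ℕ} {b : E d₁ → E d' → E d₁} {L : Phase d₁ d₂ → ℝ}
    {ν : ℝ → Measure (E d')} {u : ℝ → Phase d₁ d₂ → ℝ} (hu : SolvesAdjoint b L t₀ T ν u) :
    LinearGrad t₀ T u := by
  obtain ⟨h1, ⟨C, hC⟩, -⟩ := hu
  refine ⟨fun t ht => (h1 t ht).1, fun t ht => ?_, fun t ht ε hε => ?_⟩
  · lift growthNorm21 0 (u t) to ℝ≥0 using (h1 t ht).2.ne with c hc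
    exact ⟨c, norm_fderiv_le_of_growthNorm21 hc.ge⟩
  · have hlim : Tendsto (fun s => C * Real.sqrt |s - t|) (𝓝[Icc t₀ T] t) (𝓝 0) := by
      have hc : Continuous fun s => C * Real.sqrt |s - t| := by fun_prop
      have := hc.tendsto t
      simp only [sub_self, abs_zero, Real.sqrt_zero, mul_zero] at this
      exact this.mono_left nhdsWithin_le_nhds
    filter_upwards [hlim.eventually (gt_mem_nhds hε), self_mem_nhdsWithin] with s hs hsI z
    have h2 := hC s hsI t ht
    rw [← ENNReal.ofReal_coe_nnreal, ← ENNReal.ofReal_mul C.coe_nonneg] at h2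
    have h3 := norm_fderiv_le_of_growthNorm21 (C := (C * Real.sqrt |s - t|).toNNReal) h2 z
    rw [Real.coe_toNNReal _ (by positivity), fderiv_sub ((h1 s hsI).1.differentiable (by simp) z)
      ((h1 t ht).1.differentiable (by simp) z)] at h3
    exact h3.trans (by have := gw_pos 1 z; gcongr)

theorem linearGrad_of_continuousIn {v : ℝ → Phase d₁ d₂ → ℝ} (hv : ContinuousIn 1 1 t₀ T v) :
    LinearGrad t₀ T v := by
  obtain ⟨h1, h2⟩ := hv
  have hs : ∀ t ∈ Icc t₀ T, ContDiff ℝ 1 (v t) := fun t ht => by exact_mod_cast (h1 t ht).1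
  refine ⟨hs, fun t ht => ?_, fun t ht ε hε => ?_⟩
  · lift growthNorm 1 1 (v t) to ℝ≥0 using (h1 t ht).2.ne with c hc
    exact ⟨c, norm_fderiv_le_of_growthNorm le_rfl hc.ge⟩
  · lift ε to ℝ≥0 using hε.le
    have hε' : (0 : ℝ≥0∞) < ε := by exact_mod_cast hε
    filter_upwards [(h2 t ht).eventually (gt_mem_nhds hε'), self_mem_nhdsWithin] with s h3 hsI z
    have h4 := norm_fderiv_le_of_growthNorm le_rfl h3.le z
    rwa [fderiv_sub ((hs s hsI).differentiable (by simp) z)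
      ((hs t ht).differentiable (by simp) z)] at h4

end Families

/-! ### Convergence of integrals along curves that are continuous in the Monge–Kantorovich distance.
-/

section Wasserstein

variable {d₁ d₂ : ℕ} {t₀ T : ℝ}

theorem MemP.lintegral_gw_lt_top {p : ℕ} {μ : Measure (Phase d₁ d₂)} (h : MemP p μ) :
    Integrable (gw p) μ := by
  have := h.1
  refine ⟨(continuous_gw p).aestronglyMeasurable, ?_⟩
  rw [hasFiniteIntegral_iff_enorm]
  have e : ∀ z : Phase d₁ d₂, ‖gw p z‖ₑ = 1 + (‖z.1‖ₑ ^ p + ‖z.2‖ₑ ^ p) := by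
    intro z
    rw [Real.enorm_of_nonneg (gw_pos p z).le, gw, add_assoc, ENNReal.ofReal_add zero_le_one
      (by positivity), ENNReal.ofReal_one, ENNReal.ofReal_add (by positivity) (by positivity),
      ENNReal.ofReal_pow (norm_nonneg _), ENNReal.ofReal_pow (norm_nonneg _), ofReal_norm,
      ofReal_norm]
  simp_rw [e]
  rw [lintegral_add_left measurable_const]
  simp only [lintegral_const, measure_univ, mul_one]
  exact ENNReal.add_lt_top.2 ⟨ENNReal.one_lt_top, h.2⟩

theorem gw_le_mul_gw {p q : ℕ} (hpq : p ≤ q) (z : Phase d₁ d₂) : gw p z ≤ 3 * gw q z := by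
  have key : ∀ r : ℝ, 0 ≤ r → r ^ p ≤ 1 + r ^ q := fun r hr => by
    rcases le_total r 1 with h | h
    · exact (pow_le_one₀ hr h).trans (by linarith [pow_nonneg hr q])
    · exact (pow_le_pow_right₀ h hpq).trans (by linarith)
  have h1 := key _ (norm_nonneg z.1)
  have h2 := key _ (norm_nonneg z.2)
  have h3 := pow_nonneg (norm_nonneg z.1) q
  have h4 := pow_nonneg (norm_nonneg z.2) q
  unfold gw
  linarith

theorem MemP.integrable_gw {p q : ℕ} (hqp : q ≤ p) {μ : Measure (Phase d₁ d₂)} (h : MemP p μ) :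
    Integrable (gw q) μ :=
  (h.lintegral_gw_lt_top.const_mul 3).mono' (continuous_gw q).aestronglyMeasurable
    (ae_of_all _ fun z => by
      rw [Real.norm_of_nonneg (gw_pos q z).le]; exact gw_le_mul_gw hqp z)

theorem MemP.integrable_of_norm_le {G : Type*} [NormedAddCommGroup G] {p q : ℕ} (hqp : q ≤ p)
    {μ : Measure (Phase d₁ d₂)} (h : MemP p μ) {f : Phase d₁ d₂ → G}
    (hf : AEStronglyMeasurable f μ) {C : ℝ} (hC : ∀ z, ‖f z‖ ≤ C * gw q z) : Integrable f μ :=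
  ((h.integrable_gw hqp).const_mul C).mono' hf (ae_of_all _ hC)

/-- Take a coupling of cost below δ². The elementary inequality q ≤ δ + q²/δ replaces
Cauchy–Schwarz, at the price of the factor 2. -/
theorem abs_integral_sub_le_of_wasserstein {μ μ' : Measure (Phase d₁ d₂)} [IsProbabilityMeasure μ]
    {f : Phase d₁ d₂ → ℝ} {K : ℝ≥0} (hf : LipschitzWith K f) (hi : Integrable f μ)
    (hi' : Integrable f μ') {δ : ℝ} (hδ : 0 < δ)
    (hW : wassersteinSq μ μ' < ENNReal.ofReal (δ ^ 2)) :
    |∫ z, f z ∂μ - ∫ z, f z ∂μ'| ≤ K * (2 * δ) := by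
  obtain ⟨π, hπ⟩ := iInf_lt_iff.1 hW
  obtain ⟨⟨h1, h2⟩, hπ⟩ := iInf_lt_iff.1 hπ
  have hprob : π univ = 1 := by
    rw [← measure_univ (μ := μ), ← h1, Measure.map_apply measurable_fst MeasurableSet.univ]
    rfl
  have hi1 : Integrable (fun w : Phase d₁ d₂ × Phase d₁ d₂ => f w.1) π := by
    rw [← h1] at hi
    exact (integrable_map_measure hf.continuous.aestronglyMeasurable measurable_fst.aemeasurable).1 hi
  have hi2 : Integrable (fun w : Phase d₁ d₂ × Phase d₁ d₂ => f w.2) π := by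
    rw [← h2] at hi'
    exact (integrable_map_measure hf.continuous.aestronglyMeasurable
      measurable_snd.aemeasurable).1 hi'
  have e : ∫ z, f z ∂μ - ∫ z, f z ∂μ' = ∫ w, (f w.1 - f w.2) ∂π := by
    rw [integral_sub hi1 hi2]
    nth_rewrite 1 [← h1]
    nth_rewrite 1 [← h2]
    rw [integral_map measurable_fst.aemeasurable hf.continuous.aestronglyMeasurable,
      integral_map measurable_snd.aemeasurable hf.continuous.aestronglyMeasurable]
  rw [e, ← Real.norm_eq_abs, ← ENNReal.ofReal_le_ofReal_iff (by positivity), ofReal_norm]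
  refine (enorm_integral_le_lintegral_enorm _).trans ?_
  have hpt : ∀ w : Phase d₁ d₂ × Phase d₁ d₂, ‖f w.1 - f w.2‖ₑ ≤ ENNReal.ofReal K *
      (ENNReal.ofReal δ + ENNReal.ofReal δ⁻¹ *
        (edist w.1.1 w.2.1 ^ 2 + edist w.1.2 w.2.2 ^ 2)) := by
    intro w
    rw [← ofReal_norm, edist_dist, edist_dist, ← ENNReal.ofReal_pow dist_nonneg,
      ← ENNReal.ofReal_pow dist_nonneg, ← ENNReal.ofReal_add (by positivity) (by positivity),
      ← ENNReal.ofReal_mul (by positivity), ← ENNReal.ofReal_add (by positivity) (by positivity),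
      ← ENNReal.ofReal_mul (by positivity)]
    refine ENNReal.ofReal_le_ofReal ?_
    rw [← dist_eq_norm]
    refine (hf.dist_le_mul _ _).trans ?_
    gcongr
    rw [Prod.dist_eq]
    set r := dist w.1.1 w.2.1
    set s := dist w.1.2 w.2.2
    have hr : 0 ≤ r := dist_nonneg
    have hs : 0 ≤ s := dist_nonneg
    have hkey : ∀ q : ℝ, q ≤ δ + δ⁻¹ * q ^ 2 := fun q => by
      have : δ + δ⁻¹ * q ^ 2 - q = δ⁻¹ * ((q - δ / 2) ^ 2 + 3 / 4 * δ ^ 2) := by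
        field_simp; ring
      have : 0 ≤ δ + δ⁻¹ * q ^ 2 - q := by rw [this]; positivity
      linarith
    have hδi : 0 < δ⁻¹ := inv_pos.2 hδ
    refine max_le ((hkey r).trans ?_) ((hkey s).trans ?_)
    · nlinarith [mul_nonneg hδi.le (sq_nonneg s)]
    · nlinarith [mul_nonneg hδi.le (sq_nonneg r)]
  refine (lintegral_mono hpt).trans ?_
  rw [lintegral_const_mul' _ _ ENNReal.ofReal_ne_top, lintegral_add_left measurable_const,
    lintegral_const, hprob, mul_one, lintegral_const_mul' _ _ ENNReal.ofReal_ne_top,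
    ENNReal.ofReal_mul K.coe_nonneg]
  gcongr
  calc _ ≤ ENNReal.ofReal δ + ENNReal.ofReal δ⁻¹ * ENNReal.ofReal (δ ^ 2) := by gcongr
    _ = ENNReal.ofReal (2 * δ) := by
      rw [← ENNReal.ofReal_mul (by positivity), ← ENNReal.ofReal_add hδ.le (by positivity)]
      congr 1
      field_simp
      ring

theorem tendsto_integral_lipschitz {γ : ℝ → Measure (Phase d₁ d₂)} (hγ : ContinuousInP2 t₀ T γ)
    {t : ℝ} (ht : t ∈ Icc t₀ T) {f : Phase d₁ d₂ → ℝ} {K : ℝ≥0} (hf : LipschitzWith K f)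
    (hi : ∀ s ∈ Icc t₀ T, Integrable f (γ s)) :
    Tendsto (fun s => ∫ z, f z ∂(γ s)) (𝓝[Icc t₀ T] t) (𝓝 (∫ z, f z ∂(γ t))) := by
  rw [Metric.tendsto_nhds]
  intro ε hε
  set δ := ε / (2 * (K + 1) + 1) with hδ
  have hδ0 : 0 < δ := by positivity
  have hpos : (0 : ℝ≥0∞) < ENNReal.ofReal (δ ^ 2) := ENNReal.ofReal_pos.2 (by positivity)
  filter_upwards [(hγ.2 t ht).eventually (gt_mem_nhds hpos), self_mem_nhdsWithin] with s hs hsI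
  have := (hγ.1 s hsI).1
  refine (abs_integral_sub_le_of_wasserstein hf (hi s hsI) (hi t ht) hδ0 hs).trans_lt ?_
  rw [hδ]
  have hK := K.coe_nonneg
  rw [← mul_assoc, mul_div_assoc', div_lt_iff₀ (by positivity)]
  nlinarith

theorem lipschitz_gw_one : LipschitzWith 2 (gw 1 : Phase d₁ d₂ → ℝ) := by
  refine LipschitzWith.of_dist_le_mul fun z w => ?_
  rw [Real.dist_eq, Prod.dist_eq, dist_eq_norm, dist_eq_norm]
  have h1 := abs_norm_sub_norm_le z.1 w.1
  have h2 := abs_norm_sub_norm_le z.2 w.2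
  have h3 := le_max_left ‖z.1 - w.1‖ ‖z.2 - w.2‖
  have h4 := le_max_right ‖z.1 - w.1‖ ‖z.2 - w.2‖
  have e : gw 1 z - gw 1 w = (‖z.1‖ - ‖w.1‖) + (‖z.2‖ - ‖w.2‖) := by unfold gw; ring
  rw [e]
  refine (abs_add_le _ _).trans ?_
  norm_num
  linarith

/-- Truncate f at level n. The truncated function is bounded and continuous, so weak convergence
handles it; the error is dominated by the positive part of C(1 + |x| + |y|) - n, which is itself
Lipschitz, so its integral converges too and is small in the limit. -/
theorem tendsto_integral_of_continuousInP2 {γ : ℝ → Measure (Phase d₁ d₂)}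
    (hγ : ContinuousInP2 t₀ T γ) {t : ℝ} (ht : t ∈ Icc t₀ T) {f : Phase d₁ d₂ → ℝ}
    (hf : Continuous f) {C : ℝ≥0} (hC : ∀ z, |f z| ≤ C * gw 1 z) :
    Tendsto (fun s => ∫ z, f z ∂(γ s)) (𝓝[Icc t₀ T] t) (𝓝 (∫ z, f z ∂(γ t))) := by
  have hlipW : ∀ R : ℝ, LipschitzWith (C * 2) fun z : Phase d₁ d₂ => max (C * gw 1 z - R) 0 := by
    intro R
    have h0 : LipschitzWith (C * 2) fun z : Phase d₁ d₂ => C * gw 1 z := by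
      refine LipschitzWith.of_dist_le_mul fun z w => ?_
      have := (lipschitz_gw_one (d₁ := d₁) (d₂ := d₂)).dist_le_mul z w
      rw [Real.dist_eq] at this ⊢
      rw [← mul_sub, abs_mul, abs_of_nonneg C.coe_nonneg]
      push_cast at this ⊢
      rw [mul_assoc]
      gcongr
    have h1 : LipschitzWith (C * 2) fun z : Phase d₁ d₂ => C * gw 1 z - R := by
      refine LipschitzWith.of_dist_le_mul fun z w => ?_
      have := h0.dist_le_mul z w
      rwa [dist_sub_right]
    exact h1.max_const 0
  have hWi : ∀ R : ℝ, 0 ≤ R → ∀ s ∈ Icc t₀ T,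
      Integrable (fun z : Phase d₁ d₂ => max (C * gw 1 z - R) 0) (γ s) := by
    intro R hR s hs
    refine (hγ.1 s hs).integrable_of_norm_le (q := 1) one_le_two
      (hlipW R).continuous.aestronglyMeasurable (C := C) fun z => ?_
    have := mul_nonneg C.coe_nonneg (gw_pos 1 z).le
    rw [Real.norm_of_nonneg (le_max_right _ _)]
    exact max_le (by linarith) this
  have hfi : ∀ s ∈ Icc t₀ T, Integrable f (γ s) := fun s hs =>
    (hγ.1 s hs).integrable_of_norm_le (q := 1) one_le_two hf.aestronglyMeasurable hC
  have htail : Tendsto (fun n : ℕ => ∫ z, max (C * gw 1 z - n) 0 ∂(γ t)) atTop (𝓝 0) := by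
    suffices h : Tendsto (fun n : ℕ => ∫ z, max (C * gw 1 z - n) 0 ∂(γ t)) atTop
        (𝓝 (∫ _, (0 : ℝ) ∂(γ t))) by simpa using h
    refine tendsto_integral_of_dominated_convergence (F := fun (n : ℕ) z => max (C * gw 1 z - n) 0)
      (f := fun _ => 0) (fun z => C * gw 1 z) (fun n => (hlipW n).continuous.aestronglyMeasurable)
      (((hγ.1 t ht).integrable_gw one_le_two).const_mul _) (fun n => ae_of_all _ fun z => ?_)
      (ae_of_all _ fun z => ?_)
    · have := mul_nonneg C.coe_nonneg (gw_pos 1 z).le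
      rw [Real.norm_of_nonneg (le_max_right _ _)]
      exact max_le (by linarith [Nat.cast_nonneg (α := ℝ) n]) this
    · obtain ⟨N, hN⟩ := exists_nat_ge (C * gw 1 z)
      refine tendsto_const_nhds.congr' ?_
      filter_upwards [eventually_ge_atTop N] with n hn
      have : (N : ℝ) ≤ n := by exact_mod_cast hn
      rw [max_eq_right (by linarith)]
  have hweak : ∀ R : ℝ, 0 ≤ R → Tendsto (fun s => ∫ z, max (-R) (min (f z) R) ∂(γ s))
      (𝓝[Icc t₀ T] t) (𝓝 (∫ z, max (-R) (min (f z) R) ∂(γ t))) := by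
    intro R hR
    rw [tendsto_iff_seq_tendsto]
    intro σ hσ
    have hσI : ∀ᶠ n in atTop, σ n ∈ Icc t₀ T := hσ.eventually self_mem_nhdsWithin
    -- The value outside the interval is immaterial, as the sequence is eventually inside.
    let μs : ℕ → ProbabilityMeasure (Phase d₁ d₂) := fun n =>
      if hn : σ n ∈ Icc t₀ T then ⟨γ (σ n), (hγ.1 _ hn).1⟩ else ⟨γ t, (hγ.1 t ht).1⟩
    let μ : ProbabilityMeasure (Phase d₁ d₂) := ⟨γ t, (hγ.1 t ht).1⟩
    have hμs : ∀ n, σ n ∈ Icc t₀ T → (μs n : Measure (Phase d₁ d₂)) = γ (σ n) := fun n hn => by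
      have h : μs n = ⟨γ (σ n), (hγ.1 _ hn).1⟩ := dif_pos hn
      rw [h]
      rfl
    have hμ : Tendsto μs atTop (𝓝 μ) := by
      rw [tendsto_iff_forall_lipschitz_integral_tendsto]
      rintro g ⟨M, hM⟩ ⟨K, hK⟩
      have hgi : ∀ s ∈ Icc t₀ T, Integrable g (γ s) := fun s hs => by
        have := (hγ.1 s hs).1
        refine Integrable.of_bound hK.continuous.aestronglyMeasurable (‖g 0‖ + M)
          (ae_of_all _ fun z => ?_)
        have h1 := norm_le_insert' (g z) (g 0)
        have h2 := hM z 0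
        rw [dist_eq_norm] at h2
        linarith
      have := (tendsto_integral_lipschitz hγ ht hK hgi).comp hσ
      refine this.congr' ?_
      filter_upwards [hσI] with n hn
      rw [hμs n hn]
      rfl
    let g : Phase d₁ d₂ →ᵇ ℝ := BoundedContinuousFunction.ofNormedAddCommGroup
      (fun z => max (-R) (min (f z) R)) (by fun_prop) R (fun z => by
        rw [Real.norm_eq_abs, abs_le]
        exact ⟨le_max_left _ _, max_le (by linarith) (min_le_right _ _)⟩)
    have := (ProbabilityMeasure.tendsto_iff_forall_integral_tendsto.1 hμ) g
    refine this.congr' ?_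
    filter_upwards [hσI] with n hn
    rw [hμs n hn]
    rfl
  rw [Metric.tendsto_nhds]
  intro ε hε
  obtain ⟨n, hn⟩ := (htail.eventually (gt_mem_nhds (show 0 < ε / 5 by positivity))).exists
  have hn0 : (0 : ℝ) ≤ n := Nat.cast_nonneg n
  have h1 := (tendsto_integral_lipschitz hγ ht (hlipW n) (hWi n hn0)).eventually
    (gt_mem_nhds (show _ < ∫ z, max (C * gw 1 z - n) 0 ∂(γ t) + ε / 5 by linarith))
  have h2 := Metric.tendsto_nhds.1 (hweak n hn0) (ε / 5) (by positivity)
  have hdiff : ∀ s ∈ Icc t₀ T, |∫ z, f z ∂(γ s) - ∫ z, max (-(n : ℝ)) (min (f z) n) ∂(γ s)|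
      ≤ ∫ z, max (C * gw 1 z - n) 0 ∂(γ s) := by
    intro s hs
    have := (hγ.1 s hs).1
    have hti : Integrable (fun z => max (-(n : ℝ)) (min (f z) n)) (γ s) := by
      refine Integrable.of_bound (by fun_prop) n (ae_of_all _ fun z => ?_)
      rw [Real.norm_eq_abs, abs_le]
      exact ⟨le_max_left _ _, max_le (by linarith) (min_le_right _ _)⟩
    rw [← integral_sub (hfi s hs) hti, ← Real.norm_eq_abs]
    refine norm_integral_le_of_norm_le (hWi n hn0 s hs) (ae_of_all _ fun z => ?_)
    rw [Real.norm_eq_abs]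
    have h3 := hC z
    have h4 := abs_le.1 h3
    rcases le_total (f z) n with h5 | h5
    · rw [min_eq_left h5]
      rcases le_total (-(n : ℝ)) (f z) with h6 | h6
      · rw [max_eq_right h6, sub_self, abs_zero]; exact le_max_right _ _
      · rw [max_eq_left h6, abs_of_nonpos (by linarith)]
        exact le_max_of_le_left (by linarith)
    · rw [min_eq_right h5, max_eq_right (by linarith), abs_of_nonneg (by linarith)]
      exact le_max_of_le_left (by linarith)
  filter_upwards [h1, h2, self_mem_nhdsWithin] with s h1 h2 hs
  have h3 := hdiff s hs
  have h4 := hdiff t ht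
  rw [Real.dist_eq] at h2 ⊢
  rw [abs_le] at h3 h4
  rw [abs_lt] at h2 ⊢
  constructor <;> linarith [h2.1, h2.2, h3.1, h3.2, h4.1, h4.2]

end Wasserstein

/-! ### Coercivity of ℓ and integrable majorants. -/

section Prior

variable {d₁ d₂ d' : ℕ}

/-- Taylor's formula along the ray through a, carried out by two monotonicity arguments. -/
theorem quadratic_lower_bound {ℓ : E d' → ℝ} (hℓ : ContDiff ℝ 2 ℓ) {c : ℝ}
    (hc : ∀ a h : E d', c * ‖h‖ ^ 2 ≤ iteratedFDeriv ℝ 2 ℓ a ![h, h]) (a : E d') :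
    ℓ 0 + fderiv ℝ ℓ 0 a + c / 2 * ‖a‖ ^ 2 ≤ ℓ a := by
  have hd : Differentiable ℝ ℓ := hℓ.differentiable (by simp)
  have hd' : Differentiable ℝ (fderiv ℝ ℓ) :=
    (hℓ.fderiv_right (m := 1) (by norm_num)).differentiable (by simp)
  have hline : ∀ s : ℝ, HasDerivAt (fun s : ℝ => s • a) a s := fun s => by
    simpa using (hasDerivAt_id s).smul_const a
  have h1 : ∀ s : ℝ, HasDerivAt (fun s : ℝ => ℓ (s • a)) (fderiv ℝ ℓ (s • a) a) s := fun s =>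
    (hd _).hasFDerivAt.comp_hasDerivAt s (hline s)
  have h2 : ∀ s : ℝ, HasDerivAt (fun s : ℝ => fderiv ℝ ℓ (s • a) a)
      (fderiv ℝ (fderiv ℝ ℓ) (s • a) a a) s := fun s =>
    ((hd' _).hasFDerivAt.comp_hasDerivAt s (hline s)).clm_apply (hasDerivAt_const s a)
      |>.congr_deriv (by simp)
  have h3 : ∀ s : ℝ, c * ‖a‖ ^ 2 ≤ fderiv ℝ (fderiv ℝ ℓ) (s • a) a a := fun s => by
    simpa [iteratedFDeriv_two_apply] using hc (s • a) a
  have hF' : ∀ s : ℝ, HasDerivAt (fun s : ℝ => fderiv ℝ ℓ (s • a) a - c * ‖a‖ ^ 2 * s)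
      (fderiv ℝ (fderiv ℝ ℓ) (s • a) a a - c * ‖a‖ ^ 2) s := fun s =>
    ((h2 s).sub ((hasDerivAt_id s).const_mul (c * ‖a‖ ^ 2))).congr_deriv (by simp)
  have hmono : Monotone fun s : ℝ => fderiv ℝ ℓ (s • a) a - c * ‖a‖ ^ 2 * s :=
    monotone_of_deriv_nonneg (fun s => (hF' s).differentiableAt) fun s => by
      rw [(hF' s).deriv]; linarith [h3 s]
  have hF : ∀ s : ℝ, HasDerivAt
      (fun s : ℝ => ℓ (s • a) - c / 2 * ‖a‖ ^ 2 * s ^ 2 - fderiv ℝ ℓ 0 a * s)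
      (fderiv ℝ ℓ (s • a) a - c * ‖a‖ ^ 2 * s - fderiv ℝ ℓ 0 a) s := fun s => by
    refine (((h1 s).sub ((hasDerivAt_pow 2 s).const_mul (c / 2 * ‖a‖ ^ 2))).sub
      ((hasDerivAt_id s).const_mul (fderiv ℝ ℓ 0 a))).congr_deriv ?_
    simp
    ring
  have hmono2 := monotoneOn_of_deriv_nonneg (convex_Ici (0 : ℝ))
    (fun s _ => (hF s).continuousAt.continuousWithinAt)
    (fun s _ => (hF s).differentiableAt.differentiableWithinAt) (fun s hs => by
      rw [interior_Ici] at hs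
      rw [(hF s).deriv]
      have := hmono (le_of_lt hs)
      simp only [zero_smul, mul_zero, sub_zero] at this
      linarith)
  have := hmono2 (a := 0) (b := 1) (by simp) (by simp) zero_le_one
  simp only [zero_smul, one_smul] at this
  norm_num at this
  linarith

/-- The quadratic growth of ℓ absorbs both the linear term in the exponent and the polynomial. The
weight is squared because the potential of η may grow like one weight and is then integrated against
another. -/
theorem exists_dominating {b : E d₁ → E d' → E d₁} {ℓ : E d' → ℝ} {L : Phase d₁ d₂ → ℝ}
    (hreg : RegularData b ℓ L) (D : ℝ) :
    ∃ dom : E d' → ℝ, Integrable dom ∧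
      ∀ a, Real.exp (-ℓ a + D * (1 + ‖a‖)) * weight a ^ 2 ≤ dom a := by
  obtain ⟨c, hc, hhess⟩ := hreg.l_hess
  have hlow := quadratic_lower_bound hreg.l_smooth (c := c) fun a h => by
    refine le_trans ?_ (hhess a h)
    have : 0 ≤ c * ‖h‖ ^ 2 := by positivity
    nlinarith [sq_nonneg ‖a‖]
  -- The twelve powers dominate the squared weight; the other d' + 1 leave a factor integrable in
  -- dimension d'.
  set N : ℕ := 12 + (d' + 1) with hN
  -- Total slope of the linear terms: differential of ℓ at the origin, given exponent, and exp(1 +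
  -- s) used to absorb the power N. Completing the square bounds qs - cs²/2 by q²/(2c).
  set q := ‖fderiv ℝ ℓ 0‖ + |D| + 1 with hq
  set M : ℝ := Real.exp (-ℓ 0 + |D| + 1 + q ^ 2 / (2 * c)) * N.factorial with hM
  refine ⟨fun a => M * (1 + ‖a‖) ^ (-(d' + 1 : ℝ)), ?_, fun a => ?_⟩
  · refine (integrable_one_add_norm ?_).const_mul M
    simp
  · set s := ‖a‖ with hs
    have hs0 : 0 ≤ s := norm_nonneg a
    have h1 : fderiv ℝ ℓ 0 a ≥ -(‖fderiv ℝ ℓ 0‖ * s) := by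
      have := (fderiv ℝ ℓ 0).le_opNorm a
      rw [Real.norm_eq_abs] at this
      exact (abs_le.1 this).1
    have h2 : D * (1 + s) ≤ |D| * (1 + s) := by gcongr; exact le_abs_self D
    have h3 := hlow a
    have hw : weight a ^ 2 ≤ (1 + s) ^ 12 := by
      unfold weight
      calc ((1 + ‖a‖ ^ 2) ^ 3) ^ 2 ≤ (((1 + s) ^ 2) ^ 3) ^ 2 := by gcongr; nlinarith
        _ = (1 + s) ^ 12 := by ring
    have hpoly : (1 + s) ^ N ≤ N.factorial * Real.exp (1 + s) := by
      have := Real.pow_div_factorial_le_exp (1 + s) (by positivity) N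
      rw [div_le_iff₀ (by positivity)] at this
      linarith
    have hsq : q * s - c / 2 * s ^ 2 ≤ q ^ 2 / (2 * c) := by
      have : q ^ 2 / (2 * c) - (q * s - c / 2 * s ^ 2) = (q - c * s) ^ 2 / (2 * c) := by
        field_simp; ring
      have h5 : 0 ≤ (q - c * s) ^ 2 / (2 * c) := by positivity
      linarith
    have hexp : Real.exp (-ℓ a + D * (1 + s)) * Real.exp (1 + s)
        ≤ Real.exp (-ℓ 0 + |D| + 1 + q ^ 2 / (2 * c)) := by
      rw [← Real.exp_add]
      refine Real.exp_le_exp.2 ?_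
      have : q * s = ‖fderiv ℝ ℓ 0‖ * s + |D| * s + s := by rw [hq]; ring
      linarith
    have hrp : (1 + s) ^ (-(d' + 1 : ℝ)) = ((1 + s) ^ (d' + 1))⁻¹ := by
      rw [Real.rpow_neg (by positivity)]
      congr 1
      exact_mod_cast Real.rpow_natCast (1 + s) (d' + 1)
    show _ ≤ M * (1 + s) ^ (-(d' + 1 : ℝ))
    rw [hrp, ← div_eq_mul_inv, le_div_iff₀ (by positivity)]
    calc Real.exp (-ℓ a + D * (1 + s)) * weight a ^ 2 * (1 + s) ^ (d' + 1)
        ≤ Real.exp (-ℓ a + D * (1 + s)) * (1 + s) ^ 12 * (1 + s) ^ (d' + 1) := by gcongr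
      _ = Real.exp (-ℓ a + D * (1 + s)) * (1 + s) ^ N := by rw [hN, pow_add _ 12]; ring
      _ ≤ Real.exp (-ℓ a + D * (1 + s)) * (N.factorial * Real.exp (1 + s)) := by gcongr
      _ = Real.exp (-ℓ a + D * (1 + s)) * Real.exp (1 + s) * N.factorial := by ring
      _ ≤ M := by rw [hM]; gcongr

theorem exists_linear_bound {b : E d₁ → E d' → E d₁} {ℓ : E d' → ℝ} {L : Phase d₁ d₂ → ℝ}
    (hreg : RegularData b ℓ L) : ∃ C : ℝ≥0, ∀ x a, ‖b x a‖ ≤ C * (1 + ‖a‖) := by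
  obtain ⟨C, hC⟩ := hreg.b_bound
  refine ⟨(C * 2).toNNReal, fun x a => ?_⟩
  have h := hC 0 0 (by omega) x a
  simp only [norm_iteratedFDeriv_zero, zero_add, pow_one, pow_zero] at h
  refine h.trans ?_
  have h2 := Real.le_coe_toNNReal (C * 2)
  have h3 : 0 ≤ 1 + ‖a‖ := by positivity
  nlinarith

end Prior

/-! ### Continuity and uniform domination of the Gibbs densities. -/

section Gibbs

variable {d₁ d₂ d' : ℕ} {t₀ T : ℝ}

theorem norm_prodMk_zero (w : E d₁) : ‖((w, 0) : Phase d₁ d₂)‖ = ‖w‖ := by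
  simp [Prod.norm_def]

theorem continuous_fderiv_apply_inl {f : Phase d₁ d₂ → ℝ} (hf : ContDiff ℝ 1 f)
    {w : Phase d₁ d₂ → E d₁} (hw : Continuous w) :
    Continuous fun z => fderiv ℝ f z (w z, 0) :=
  (hf.continuous_fderiv (by simp)).clm_apply (hw.prodMk continuous_const)

theorem norm_fderiv_inl_le {f : Phase d₁ d₂ → ℝ} {C B : ℝ} {z : Phase d₁ d₂} {w : E d₁}
    (hf : ‖fderiv ℝ f z‖ ≤ C * gw 1 z) (hw : ‖w‖ ≤ B) :
    ‖fderiv ℝ f z (w, 0)‖ ≤ B * C * gw 1 z := by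
  refine (ContinuousLinearMap.le_opNorm _ _).trans ?_
  rw [norm_prodMk_zero]
  calc _ ≤ (C * gw 1 z) * B := mul_le_mul hf hw (norm_nonneg _) ((norm_nonneg _).trans hf)
    _ = _ := by ring

theorem continuous_coefficient {b : E d₁ → E d' → E d₁} {ℓ : E d' → ℝ} {L : Phase d₁ d₂ → ℝ}
    (hreg : RegularData b ℓ L) (a : E d') : Continuous fun z : Phase d₁ d₂ => b z.1 a :=
  hreg.b_smooth.continuous.comp (by fun_prop : Continuous fun z : Phase d₁ d₂ => (z.1, a))

theorem continuous_integral_coefficient {b : E d₁ → E d' → E d₁} {ℓ : E d' → ℝ}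
    {L : Phase d₁ d₂ → ℝ} (hreg : RegularData b ℓ L) {γ : Measure (Phase d₁ d₂)} (hγ : MemP 2 γ)
    {f : Phase d₁ d₂ → ℝ} (hf : ContDiff ℝ 1 f) {C : ℝ} (hC : ∀ z, ‖fderiv ℝ f z‖ ≤ C * gw 1 z) :
    Continuous fun a => ∫ z, inner ℝ (b z.1 a) (gradX f z) ∂γ := by
  obtain ⟨g, B, hg, hbg⟩ := exists_coefficient hreg
  have hd : Differentiable ℝ f := hf.differentiable (by simp)
  have e : ∀ a, ∫ z, inner ℝ (b z.1 a) (gradX f z) ∂γ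
      = weight a * ∫ z, fderiv ℝ f z (g z.1 a, 0) ∂γ := by
    intro a
    rw [← integral_const_mul]
    refine integral_congr_ae (ae_of_all _ fun z => ?_)
    simp only [inner_gradX (hd z), hbg]
    rw [show ((weight a • g z.1 a, 0) : Phase d₁ d₂) = weight a • (g z.1 a, 0) by simp, map_smul,
      smul_eq_mul]
  simp_rw [e]
  refine (contDiff_weight (n := 0)).continuous.mul ?_
  refine continuous_of_dominated (bound := fun z => B * C * gw 1 z) (fun a => ?_)
    (fun a => ae_of_all _ fun z => ?_) ((hγ.integrable_gw one_le_two).const_mul _)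
    (ae_of_all _ fun z => ?_)
  · have h1 : Continuous fun z : Phase d₁ d₂ => g z.1 a :=
      (continuous_eval_const a).comp (hg.smooth.continuous.comp continuous_fst)
    exact (continuous_fderiv_apply_inl hf h1).aestronglyMeasurable
  · exact norm_fderiv_inl_le (hC z) (((g z.1).norm_coe_le_norm a).trans (hg.bdd z.1))
  · have : Continuous fun a => ((g z.1 a, 0) : Phase d₁ d₂) :=
      (g z.1).continuous.prodMk continuous_const
    exact (fderiv ℝ f z).continuous.comp this

theorem abs_integral_coefficient_le {b : E d₁ → E d' → E d₁} {B : ℝ}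
    (hb : ∀ x a, ‖b x a‖ ≤ B * (1 + ‖a‖)) {γ : Measure (Phase d₁ d₂)} (hγ : MemP 2 γ)
    {f : Phase d₁ d₂ → ℝ} (hf : Differentiable ℝ f) {C : ℝ}
    (hC : ∀ z, ‖fderiv ℝ f z‖ ≤ C * gw 1 z) (a : E d') :
    |∫ z, inner ℝ (b z.1 a) (gradX f z) ∂γ| ≤ B * C * (∫ z, gw 1 z ∂γ) * (1 + ‖a‖) := by
  have h := norm_integral_le_of_norm_le (f := fun z : Phase d₁ d₂ => inner ℝ (b z.1 a) (gradX f z))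
    ((hγ.integrable_gw (q := 1) one_le_two).const_mul (B * (1 + ‖a‖) * C)) (ae_of_all _ fun z => by
    rw [inner_gradX (hf z)]
    exact norm_fderiv_inl_le (hC z) (hb z.1 a))
  rw [integral_const_mul, Real.norm_eq_abs] at h
  linarith

theorem continuousOn_integral_gw {γ : ℝ → Measure (Phase d₁ d₂)} (hγ : ContinuousInP2 t₀ T γ) :
    ContinuousOn (fun t => ∫ z, gw 1 z ∂(γ t)) (Icc t₀ T) := fun t ht =>
  tendsto_integral_of_continuousInP2 hγ ht (continuous_gw 1) (C := 1) fun z => by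
    rw [abs_of_pos (gw_pos 1 z)]; simp

theorem exists_bound_integral_gw {γ : ℝ → Measure (Phase d₁ d₂)} (hγ : ContinuousInP2 t₀ T γ) :
    ∃ C : ℝ≥0, ∀ t ∈ Icc t₀ T, ∫ z, gw 1 z ∂(γ t) ≤ C := by
  obtain ⟨C, hC⟩ := isCompact_Icc.exists_bound_of_continuousOn (continuousOn_integral_gw hγ)
  exact ⟨C.toNNReal, fun t ht => (le_abs_self _).trans ((hC t ht).trans (Real.le_coe_toNNReal C))⟩

/-- Measure and integrand both move. The change of u is small relative to the linear weight, whose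
integrals are bounded uniformly in time; with u frozen, convergence along γ applies. -/
theorem continuousOn_integral_coefficient {b : E d₁ → E d' → E d₁} {ℓ : E d' → ℝ}
    {L : Phase d₁ d₂ → ℝ} (hreg : RegularData b ℓ L) {γ : ℝ → Measure (Phase d₁ d₂)}
    (hγ : ContinuousInP2 t₀ T γ) {u : ℝ → Phase d₁ d₂ → ℝ} (hu : LinearGrad t₀ T u) (a : E d') :
    ContinuousOn (fun t => ∫ z, inner ℝ (b z.1 a) (gradX (u t) z) ∂(γ t)) (Icc t₀ T) := by
  obtain ⟨B, hB⟩ := exists_linear_bound hreg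
  obtain ⟨C, hC⟩ := hu.exists_bound
  obtain ⟨M, hM⟩ := exists_bound_integral_gw hγ
  set β : ℝ := B * (1 + ‖a‖) with hβ
  have hβ0 : 0 ≤ β := by positivity
  have hc : ∀ s ∈ Icc t₀ T, Continuous fun z : Phase d₁ d₂ => fderiv ℝ (u s) z (b z.1 a, 0) :=
    fun s hs => continuous_fderiv_apply_inl (hu.smooth s hs) (continuous_coefficient hreg a)
  have hcongr : ∀ s ∈ Icc t₀ T, ∫ z, inner ℝ (b z.1 a) (gradX (u s) z) ∂(γ s)
      = ∫ z, fderiv ℝ (u s) z (b z.1 a, 0) ∂(γ s) := fun s hs => by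
    simp_rw [inner_gradX (hu.differentiable hs _)]
  refine ContinuousOn.congr ?_ hcongr
  intro t ht
  have hint : ∀ s ∈ Icc t₀ T, ∀ r ∈ Icc t₀ T,
      Integrable (fun z : Phase d₁ d₂ => fderiv ℝ (u s) z (b z.1 a, 0)) (γ r) := fun s hs r hr =>
    (hγ.1 r hr).integrable_of_norm_le (q := 1) one_le_two (hc s hs).aestronglyMeasurable
      (C := β * C) fun z => norm_fderiv_inl_le (hC s hs z) (hB z.1 a)
  have h1 : Tendsto (fun s => ∫ z, fderiv ℝ (u t) z (b z.1 a, 0) ∂(γ s)) (𝓝[Icc t₀ T] t)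
      (𝓝 (∫ z, fderiv ℝ (u t) z (b z.1 a, 0) ∂(γ t))) :=
    tendsto_integral_of_continuousInP2 hγ ht (hc t ht) (C := ⟨β * C, by positivity⟩)
      fun z => norm_fderiv_inl_le (hC t ht z) (hB z.1 a)
  have h2 : Tendsto (fun s => (∫ z, fderiv ℝ (u s) z (b z.1 a, 0) ∂(γ s))
      - ∫ z, fderiv ℝ (u t) z (b z.1 a, 0) ∂(γ s)) (𝓝[Icc t₀ T] t) (𝓝 0) := by
    rw [Metric.tendsto_nhds]
    intro ε hε
    have hδ : 0 < ε / (β * M + 1) := by positivity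
    filter_upwards [hu.cont t ht _ hδ, self_mem_nhdsWithin] with s hs hsI
    rw [Real.dist_eq, sub_zero, ← integral_sub (hint s hsI s hsI) (hint t ht s hsI)]
    have h3 := norm_integral_le_of_norm_le
      (f := fun z : Phase d₁ d₂ => fderiv ℝ (u s) z (b z.1 a, 0) - fderiv ℝ (u t) z (b z.1 a, 0))
      (((hγ.1 s hsI).integrable_gw (q := 1) one_le_two).const_mul (ε / (β * M + 1) * β))
      (ae_of_all _ fun z => by
        rw [← sub_apply]
        refine (ContinuousLinearMap.le_opNorm _ _).trans ?_
        rw [norm_prodMk_zero]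
        calc _ ≤ (ε / (β * M + 1) * gw 1 z) * β :=
              mul_le_mul (hs z) (hB z.1 a) (norm_nonneg _) (by have := gw_pos 1 z; positivity)
          _ = _ := by ring)
    rw [integral_const_mul, Real.norm_eq_abs] at h3
    refine h3.trans_lt ?_
    calc ε / (β * M + 1) * β * ∫ z, gw 1 z ∂(γ s) ≤ ε / (β * M + 1) * β * M := by
          gcongr; exact hM s hsI
      _ < ε := by
          rw [mul_assoc, div_mul_eq_mul_div, div_lt_iff₀ (by positivity)]
          nlinarith
  have := h2.add h1
  simpa [ContinuousWithinAt] using this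

/-- Basic properties of a family of Gibbs densities. -/
structure GibbsFamily (t₀ T : ℝ) (p : ℝ → E d' → ℝ) (dom : E d' → ℝ) : Prop where
  pos : ∀ t ∈ Icc t₀ T, ∀ a, 0 < p t a
  cont : ∀ t ∈ Icc t₀ T, Continuous (p t)
  cont_time : ∀ a, ContinuousOn (fun t => p t a) (Icc t₀ T)
  integrable_dom : Integrable dom
  le_dom : ∀ t ∈ Icc t₀ T, ∀ a, p t a * weight a ^ 2 ≤ dom a
  integral_eq_one : ∀ t ∈ Icc t₀ T, ∫ a, p t a = 1

/-- The interaction term is at most D(1 + ‖a‖) uniformly in time, so the unnormalised density lies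
between exp(-ℓ ∓ D(1 + ‖a‖)). The lower bound keeps the normalising constant away from zero, the
upper one gives domination. -/
theorem exists_gibbsFamily {b : E d₁ → E d' → E d₁} {ℓ : E d' → ℝ}
    {L : Phase d₁ d₂ → ℝ} (hreg : RegularData b ℓ L) {ε : ℝ} (hε : 0 < ε)
    {γ : ℝ → Measure (Phase d₁ d₂)} (hγ : ContinuousInP2 t₀ T γ) {u : ℝ → Phase d₁ d₂ → ℝ}
    (hu : LinearGrad t₀ T u) :
    ∃ dom, GibbsFamily t₀ T (fun t => gibbsDensity b ℓ ε (γ t) (u t)) dom := by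
  obtain ⟨B, hB⟩ := exists_linear_bound hreg
  obtain ⟨C, hC⟩ := hu.exists_bound
  obtain ⟨M, hM⟩ := exists_bound_integral_gw hγ
  set G : ℝ → E d' → ℝ := fun t a => ∫ z, inner ℝ (b z.1 a) (gradX (u t) z) ∂(γ t) with hG
  set D : ℝ := (1 / ε) * (B * C * M) with hD
  have hGb : ∀ t ∈ Icc t₀ T, ∀ a, |(1 / ε) * G t a| ≤ D * (1 + ‖a‖) := fun t ht a => by
    rw [abs_mul, abs_of_pos (by positivity), hD, mul_assoc]
    gcongr
    refine (abs_integral_coefficient_le hB (hγ.1 t ht) (hu.differentiable ht) (hC t ht) a).trans ?_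
    gcongr
    exact hM t ht
  have hGc : ∀ t ∈ Icc t₀ T, Continuous (G t) := fun t ht =>
    continuous_integral_coefficient hreg (hγ.1 t ht) (hu.smooth t ht) (hC t ht)
  obtain ⟨dom, hdi, hdom⟩ := exists_dominating hreg D
  have hℓ : Continuous ℓ := hreg.l_smooth.continuous
  set W : ℝ → E d' → ℝ := fun t => gibbsWeight b ℓ ε (γ t) (u t) with hW
  have hWe : ∀ t a, W t a = Real.exp (-ℓ a - (1 / ε) * G t a) := fun _ _ => rfl
  have hWpos : ∀ t a, 0 < W t a := fun t a => Real.exp_pos _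
  have hWc : ∀ t ∈ Icc t₀ T, Continuous (W t) := fun t ht => by
    have := hGc t ht
    simp only [funext (hWe t)]
    fun_prop
  have hWle : ∀ t ∈ Icc t₀ T, ∀ a, W t a * weight a ^ 2 ≤ dom a := fun t ht a => by
    refine le_trans ?_ (hdom a)
    rw [hWe]
    gcongr
    have := (abs_le.1 (hGb t ht a)).1
    linarith
  have hWle' : ∀ t ∈ Icc t₀ T, ∀ a, ‖W t a‖ ≤ dom a := fun t ht a => by
    rw [Real.norm_of_nonneg (hWpos t a).le]
    refine le_trans ?_ (hWle t ht a)
    exact le_mul_of_one_le_right (hWpos t a).le (one_le_pow₀ (one_le_weight a))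
  have hWi : ∀ t ∈ Icc t₀ T, Integrable (W t) := fun t ht =>
    hdi.mono' (hWc t ht).aestronglyMeasurable (ae_of_all _ (hWle' t ht))
  have hlow : ∀ t ∈ Icc t₀ T, ∀ a, Real.exp (-ℓ a - D * (1 + ‖a‖)) ≤ W t a := fun t ht a => by
    rw [hWe]
    refine Real.exp_le_exp.2 ?_
    have := (abs_le.1 (hGb t ht a)).2
    linarith
  set Z := ∫ a, Real.exp (-ℓ a - D * (1 + ‖a‖)) with hZ
  have hlowi : Integrable fun a => Real.exp (-ℓ a - D * (1 + ‖a‖)) := by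
    refine hdi.mono' (by fun_prop) (ae_of_all _ fun a => ?_)
    rw [Real.norm_of_nonneg (Real.exp_pos _).le]
    refine le_trans ?_ (hdom a)
    have h1 : Real.exp (-ℓ a - D * (1 + ‖a‖)) ≤ Real.exp (-ℓ a + D * (1 + ‖a‖)) := by
      have : 0 ≤ D * (1 + ‖a‖) := by positivity
      gcongr
      linarith
    exact h1.trans (le_mul_of_one_le_right (Real.exp_pos _).le (one_le_pow₀ (one_le_weight a)))
  have hZ0 : 0 < Z := integral_exp_pos hlowi
  have hZle : ∀ t ∈ Icc t₀ T, Z ≤ ∫ a, W t a := fun t ht =>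
    integral_mono hlowi (hWi t ht) (hlow t ht)
  have hZt : ∀ t ∈ Icc t₀ T, 0 < ∫ a, W t a := fun t ht => hZ0.trans_le (hZle t ht)
  have hWt : ∀ a, ContinuousOn (fun t => W t a) (Icc t₀ T) := fun a => by
    have := continuousOn_integral_coefficient hreg hγ hu a
    simp only [hWe]
    exact Real.continuous_exp.comp_continuousOn (continuousOn_const.sub (continuousOn_const.mul this))
  have hZc : ContinuousOn (fun t => ∫ a, W t a) (Icc t₀ T) :=
    continuousOn_of_dominated (bound := dom) (fun t ht => (hWc t ht).aestronglyMeasurable)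
      (fun t ht => ae_of_all _ (hWle' t ht)) hdi (ae_of_all _ hWt)
  have hp : ∀ t a, gibbsDensity b ℓ ε (γ t) (u t) a = W t a / ∫ a, W t a := fun _ _ => rfl
  refine ⟨fun a => dom a / Z, ?_, ?_, ?_, hdi.div_const Z, ?_, ?_⟩
  · intro t ht a
    rw [hp]
    exact div_pos (hWpos t a) (hZt t ht)
  · intro t ht
    exact (hWc t ht).div_const _
  · intro a
    simp only [hp]
    exact (hWt a).div hZc fun t ht => (hZt t ht).ne'
  · intro t ht a
    simp only [hp]
    rw [div_mul_eq_mul_div]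
    exact div_le_div₀ (le_trans (by have := hWpos t a; positivity) (hWle t ht a)) (hWle t ht a) hZ0
      (hZle t ht)
  · intro t ht
    simp only [hp]
    rw [integral_div, div_self (hZt t ht).ne']

end Gibbs

/-! ### The drift as a continuous linear image of the coefficient. -/

section Expectation

variable {d₁ d₂ d' : ℕ} {t₀ T : ℝ} {p : ℝ → E d' → ℝ} {dom : E d' → ℝ}
variable {F : Type} [NormedAddCommGroup F] [NormedSpace ℝ F]

theorem GibbsFamily.norm_le_dom (hp : GibbsFamily t₀ T p dom) {t : ℝ} (ht : t ∈ Icc t₀ T)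
    (φ : E d' →ᵇ F) (a : E d') : ‖(p t a * weight a) • φ a‖ ≤ ‖φ‖ * dom a := by
  have hw := one_le_weight a
  have hp0 := (hp.pos t ht a).le
  rw [norm_smul, Real.norm_of_nonneg (by positivity), mul_comm]
  refine mul_le_mul (φ.norm_coe_le_norm a) (le_trans ?_ (hp.le_dom t ht a)) (by positivity)
    (norm_nonneg _)
  gcongr
  exact le_self_pow₀ hw two_ne_zero

theorem GibbsFamily.dom_nonneg (hp : GibbsFamily t₀ T p dom) (h : t₀ ≤ T) (a : E d') :
    0 ≤ dom a :=
  le_trans (by have := (hp.pos t₀ (left_mem_Icc.2 h) a).le; positivity)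
    (hp.le_dom t₀ (left_mem_Icc.2 h) a)

theorem GibbsFamily.aestronglyMeasurable (hp : GibbsFamily t₀ T p dom) {t : ℝ}
    (ht : t ∈ Icc t₀ T) (φ : E d' →ᵇ F) :
    AEStronglyMeasurable (fun a => (p t a * weight a) • φ a) volume := by
  have h1 := hp.cont t ht
  have h2 : Continuous (weight : E d' → ℝ) := contDiff_weight (n := 0).continuous
  exact ((h1.mul h2).smul φ.continuous).aestronglyMeasurable

theorem GibbsFamily.integrable (hp : GibbsFamily t₀ T p dom) {t : ℝ} (ht : t ∈ Icc t₀ T)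
    (φ : E d' →ᵇ F) : Integrable fun a => (p t a * weight a) • φ a :=
  (hp.integrable_dom.const_mul ‖φ‖).mono' (hp.aestronglyMeasurable ht φ)
    (ae_of_all _ (hp.norm_le_dom ht φ))

/-- The weighted expectations `∫ φ(a) w(a) p_t(a) da`, as a continuous function of time. -/
noncomputable def GibbsFamily.expectC (hp : GibbsFamily t₀ T p dom) (h : t₀ ≤ T)
    (F : Type) [NormedAddCommGroup F] [NormedSpace ℝ F] :
    (E d' →ᵇ F) →L[ℝ] C(Icc t₀ T, F) :=
  LinearMap.mkContinuous
    { toFun := fun φ => ⟨fun t => ∫ a, (p t a * weight a) • φ a,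
        continuous_of_dominated (bound := fun a => ‖φ‖ * dom a)
          (fun t => hp.aestronglyMeasurable t.2 φ)
          (fun t => ae_of_all _ (hp.norm_le_dom t.2 φ)) (hp.integrable_dom.const_mul _)
          (ae_of_all _ fun a => by
            have := continuousOn_iff_continuous_domRestrict.1 (hp.cont_time a)
            exact (this.mul continuous_const).smul continuous_const)⟩
      map_add' := fun φ ψ => by
        ext1 t
        simp only [ContinuousMap.coe_mk, ContinuousMap.add_apply, BoundedContinuousFunction.coe_add,
          Pi.add_apply, smul_add]
        exact integral_add (hp.integrable t.2 φ) (hp.integrable t.2 ψ)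
      map_smul' := fun c φ => by
        ext1 t
        simp only [ContinuousMap.coe_mk, ContinuousMap.smul_apply,
          BoundedContinuousFunction.coe_smul, RingHom.id_apply, smul_comm _ c]
        exact integral_smul c _ } (∫ a, dom a)
    (fun φ => by
      have h0 : 0 ≤ ∫ a, dom a := integral_nonneg (hp.dom_nonneg h)
      refine (ContinuousMap.norm_le _ (by positivity)).2 fun t => ?_
      refine (norm_integral_le_of_norm_le (hp.integrable_dom.const_mul ‖φ‖)
        (ae_of_all _ (hp.norm_le_dom t.2 φ))).trans ?_
      rw [integral_const_mul, mul_comm])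

theorem GibbsFamily.expectC_apply (hp : GibbsFamily t₀ T p dom) (h : t₀ ≤ T) (φ : E d' →ᵇ F)
    (t : Icc t₀ T) : hp.expectC h F φ t = ∫ a, (p t a * weight a) • φ a := rfl

/-- A bounded operator into paths keeps all the bounds up to its norm. With Λ = `expectC`, the drift
b(·, ν_t) inherits from g what is needed for a global smooth flow. -/
theorem flowField_comp {X B : Type} [NormedAddCommGroup X] [NormedSpace ℝ X]
    [NormedAddCommGroup B] [NormedSpace ℝ B] (Λ : B →L[ℝ] C(Icc t₀ T, X)) {g : X → B} {C : ℝ≥0}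
    (hs : ContDiff ℝ 3 g) (hb : ∀ x, ‖g x‖ ≤ C) (hl : LipschitzWith C g)
    (hl' : LipschitzWith C (fderiv ℝ g)) :
    FlowField (⟨fun x => Λ (g x), Λ.continuous.comp hs.continuous⟩ : C(X, C(Icc t₀ T, X)))
      (‖Λ‖₊ * C) where
  smooth := Λ.contDiff.comp hs
  lip t := LipschitzWith.of_dist_le_mul fun x x' => by
    refine (ContinuousMap.dist_apply_le_dist t).trans ?_
    exact (Λ.lipschitz.comp hl).dist_le_mul x x'
  bdd x t := by
    refine (ContinuousMap.norm_coe_le_norm _ t).trans ((Λ.le_opNorm _).trans ?_)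
    exact mul_le_mul_of_nonneg_left (hb x) (norm_nonneg _)
  lip_fderiv t := LipschitzWith.of_dist_le_mul fun x x' => by
    have hd : Differentiable ℝ g := hs.differentiable (by simp)
    have e : ∀ x k, fderiv ℝ (fun x => Λ (g x) t) x k = Λ (fderiv ℝ g x k) t := fun x k => by
      have h1 : HasFDerivAt (fun x => Λ (g x)) (Λ.comp (fderiv ℝ g x)) x :=
        Λ.hasFDerivAt.comp x (hd x).hasFDerivAt
      rw [fderiv_eval (f := fun x => Λ (g x)) (Λ.differentiable.comp hd), h1.fderiv]
      rfl
    rw [dist_eq_norm]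
    refine ContinuousLinearMap.opNorm_le_bound _ (by positivity) fun k => ?_
    simp only [ContinuousMap.coe_mk]
    rw [sub_apply, e, e, ← ContinuousMap.sub_apply, ← map_sub, ← sub_apply]
    refine (ContinuousMap.norm_coe_le_norm _ t).trans ((Λ.le_opNorm _).trans ?_)
    rw [NNReal.coe_mul, coe_nnnorm, mul_assoc, mul_assoc]
    gcongr
    refine (ContinuousLinearMap.le_opNorm _ k).trans ?_
    rw [← mul_assoc]
    gcongr
    rw [← dist_eq_norm]
    exact hl'.dist_le_mul x x'

theorem drift_eq_expectC (hp : GibbsFamily t₀ T p dom) (h : t₀ ≤ T) {b : E d₁ → E d' → E d₁}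
    {g : E d₁ → (E d' →ᵇ E d₁)} (hbg : ∀ x a, b x a = weight a • g x a)
    {ν : ℝ → Measure (E d')} {t : Icc t₀ T}
    (hν : ν t = volume.withDensity fun a => ENNReal.ofReal (p t a)) (x : E d₁) :
    drift b (ν t) x = hp.expectC h (E d₁) (g x) t := by
  rw [drift, hν, integral_withDensity_eq_integral_toReal_smul
    (hp.cont t t.2).measurable.ennreal_ofReal (ae_of_all _ fun _ => ENNReal.ofReal_lt_top),
    hp.expectC_apply]
  refine integral_congr_ae (ae_of_all _ fun a => ?_)
  simp only
  rw [ENNReal.toReal_ofReal (hp.pos t t.2 a).le, hbg, smul_smul]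

end Expectation

/-! ### Differentiation of time-dependent functions along curves. -/

section Curves

variable {X F : Type*} [NormedAddCommGroup X] [NormedSpace ℝ X] [NormedAddCommGroup F]
  [NormedSpace ℝ F]

/-- The derivative along a curve of a time-dependent function, the time being frozen. -/
theorem hasDerivWithinAt_along_curve {S : Set ℝ} {h : ℝ → X → F}
    (hd : ∀ s ∈ S, Differentiable ℝ (h s))
    (hc : ContinuousOn (fun q : ℝ × X => fderiv ℝ (h q.1) q.2) (S ×ˢ univ)) {c : ℝ → X} {c' : X}
    {t : ℝ} (ht : t ∈ S) (hcd : HasDerivWithinAt c c' S t) :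
    HasDerivWithinAt (fun s => h s (c s) - h s (c t)) (fderiv ℝ (h t) (c t) c') S t := by
  have key : (fun s => h s (c s) - h s (c t) - fderiv ℝ (h t) (c t) (c s - c t))
      =o[𝓝[S] t] fun s => s - t := by
    -- An error that is o(c s - c t) is enough since c is differentiable at t; joint continuity of
    -- the spatial derivative allows `h s`, rather than `h t`, to be linearized.
    refine Asymptotics.IsLittleO.trans_isBigO (g := fun s => c s - c t) ?_ hcd.differentiableWithinAt.isBigO_sub
    rw [Asymptotics.isLittleO_iff]
    intro ε hε
    have h1 := hc (t, c t) ⟨ht, mem_univ _⟩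
    have h2 : ∀ᶠ q : ℝ × X in 𝓝[S] t ×ˢ 𝓝 (c t),
        ‖fderiv ℝ (h q.1) q.2 - fderiv ℝ (h t) (c t)‖ ≤ ε := by
      rw [ContinuousWithinAt, nhdsWithin_prod_eq, nhdsWithin_univ] at h1
      filter_upwards [Metric.tendsto_nhds.1 h1 ε hε] with q hq
      rw [← dist_eq_norm]; exact hq.le
    obtain ⟨P, hP, Q, hQ, hPQ⟩ := Filter.eventually_prod_iff.1 h2
    obtain ⟨δ, hδ, hball⟩ := Metric.eventually_nhds_iff_ball.1 hQ
    have h3 : ∀ᶠ s in 𝓝[S] t, c s ∈ Metric.ball (c t) δ :=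
      hcd.continuousWithinAt (Metric.ball_mem_nhds _ hδ)
    filter_upwards [hP, h3, self_mem_nhdsWithin] with s hs hs' hsS
    exact (convex_ball (c t) δ).norm_image_sub_le_of_norm_fderiv_le' (f := h s)
      (fun z _ => hd s hsS z) (fun z hz => hPQ hs (hball z hz)) (Metric.mem_ball_self hδ) hs'
  have h1 : HasDerivWithinAt (fun s => fderiv ℝ (h t) (c t) (c s))
      (fderiv ℝ (h t) (c t) c') S t :=
    (fderiv ℝ (h t) (c t)).hasFDerivAt.comp_hasDerivWithinAt t hcd
  have h2 := HasDerivWithinAt.sub_const (fderiv ℝ (h t) (c t) (c t)) h1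
  have h3 : HasDerivWithinAt
      (fun s => h s (c s) - h s (c t) - fderiv ℝ (h t) (c t) (c s - c t)) 0 S t := by
    rw [hasDerivWithinAt_iff_isLittleO]
    simpa using key
  refine ((h3.add h2).congr (fun s _ => ?_) ?_).congr_deriv (zero_add _)
  · simp
  · simp

theorem hasDerivWithinAt_comp_curve {S : Set ℝ} {h : ℝ → X → F}
    (hd : ∀ s ∈ S, Differentiable ℝ (h s))
    (hc : ContinuousOn (fun q : ℝ × X => fderiv ℝ (h q.1) q.2) (S ×ˢ univ)) {c : ℝ → X} {c' : X}
    {e : F} {t : ℝ} (ht : t ∈ S) (hcd : HasDerivWithinAt c c' S t)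
    (he : HasDerivWithinAt (fun s => h s (c t)) e S t) :
    HasDerivWithinAt (fun s => h s (c s)) (fderiv ℝ (h t) (c t) c' + e) S t :=
  ((hasDerivWithinAt_along_curve hd hc ht hcd).add he).congr (fun s _ => by simp) (by simp)

theorem eq_of_hasDerivWithinAt_zero {f : ℝ → F} {a b : ℝ}
    (hf : ∀ t ∈ Icc a b, HasDerivWithinAt f 0 (Icc a b) t) {s t : ℝ} (hs : s ∈ Icc a b)
    (ht : t ∈ Icc a b) : f s = f t := by
  have := (convex_Icc a b).norm_image_sub_le_of_norm_hasDerivWithin_le (C := 0) hf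
    (fun _ _ => by simp) ht hs
  rw [zero_mul, norm_le_zero_iff, sub_eq_zero] at this
  exact this

end Curves

/-! ### The transport equation for functions constant along the flow. -/

section InverseVelocity

variable {t₀ T : ℝ} {X F : Type} [NormedAddCommGroup X] [NormedSpace ℝ X]
  [NormedAddCommGroup F] [NormedSpace ℝ F]

theorem continuous_fderiv_eval [FiniteDimensional ℝ X] {I : Type} [TopologicalSpace I]
    [CompactSpace I] {f : X → C(I, F)} (hf : ContDiff ℝ 1 f) :
    Continuous fun q : I × X => fderiv ℝ (fun x => f x q.1) q.2 := by
  have hd : Differentiable ℝ f := hf.differentiable (by simp)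
  refine continuous_clm_apply.2 fun k => ?_
  simp_rw [fderiv_eval hd]
  have h1 : Continuous fun q : I × X => fderiv ℝ f q.2 k :=
    ((hf.continuous_fderiv (by simp)).comp continuous_snd).clm_apply continuous_const
  exact Continuous.eval h1 continuous_fst

theorem continuousOn_fderiv_IccExtend [FiniteDimensional ℝ X] (h : t₀ ≤ T)
    {f : X → C(Icc t₀ T, F)} (hf : ContDiff ℝ 1 f) (S : Set (ℝ × X)) :
    ContinuousOn (fun q : ℝ × X => fderiv ℝ (fun x => IccExtend h (f x) q.1) q.2) S :=
  ((continuous_fderiv_eval hf).comp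
    ((continuous_projIcc (h := h)).prodMap continuous_id)).continuousOn

/-- The function `t ↦ -D f(x)_t (V(x)_t)`. -/
noncomputable def transportVelocity {I : Type} [TopologicalSpace I] [CompactSpace I]
    (f : X → C(I, F)) (V : X → C(I, X)) (x : X) : C(I, F) :=
  -diagC (applyC (ContinuousMap.const I (fderiv ℝ f x)) (V x))

theorem transportVelocity_apply {I : Type} [TopologicalSpace I] [CompactSpace I]
    {f : X → C(I, F)} (hf : Differentiable ℝ f) (V : X → C(I, X)) (x : X) (t : I) :
    transportVelocity f V x t = -fderiv ℝ (fun x => f x t) x (V x t) := by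
  rw [fderiv_eval hf]; rfl

/-- Constant functions, as a continuous linear map. -/
noncomputable def constC (I F : Type) [TopologicalSpace I] [CompactSpace I]
    [NormedAddCommGroup F] [NormedSpace ℝ F] : F →L[ℝ] C(I, F) where
  toFun x := ContinuousMap.const I x
  map_add' _ _ := rfl
  map_smul' _ _ := rfl
  cont := ContinuousMap.continuous_const'

theorem contDiff_transportVelocity {I : Type} [TopologicalSpace I] [CompactSpace I] {n : WithTop ℕ∞}
    {f : X → C(I, F)} (hf : ContDiff ℝ (n + 1) f) {V : X → C(I, X)} (hV : ContDiff ℝ n V) :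
    ContDiff ℝ n (transportVelocity f V) := by
  have h1 : ContDiff ℝ n (fderiv ℝ f) := hf.fderiv_right le_rfl
  have h0 : ContDiff ℝ n fun x => constC I (X →L[ℝ] C(I, F)) (fderiv ℝ f x) :=
    (constC I (X →L[ℝ] C(I, F))).contDiff.comp h1
  have h2 : ContDiff ℝ n fun x =>
      applyC (I := I) (X := X) (F := C(I, F)) (constC I (X →L[ℝ] C(I, F)) (fderiv ℝ f x)) :=
    h0.continuousLinearMap_comp (applyC (I := I) (X := X) (F := C(I, F)))
  exact ((diagC (I := I) (F := F)).contDiff.comp (h2.clm_apply hV)).neg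

/-- A function which is constant along a family of curves solves the transport equation. -/
theorem hasDerivWithinAt_transport [FiniteDimensional ℝ X] {h : t₀ ≤ T} {V : X → C(Icc t₀ T, X)}
    {Ψ Θ : X → C(Icc t₀ T, X)}
    (hΨ : ∀ x, ∀ t (ht : t ∈ Icc t₀ T),
      HasDerivWithinAt (IccExtend h (Ψ x)) (V (Ψ x ⟨t, ht⟩) ⟨t, ht⟩) (Icc t₀ T) t)
    (hr : ∀ t x, Ψ (Θ x t) t = x) {f : X → C(Icc t₀ T, F)} (hf : ContDiff ℝ 1 f) {f₀ : X → F}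
    (hc : ∀ x t, f (Ψ x t) t = f₀ x) (x : X) {t : ℝ} (ht : t ∈ Icc t₀ T) :
    HasDerivWithinAt (IccExtend h (f x)) (transportVelocity f V x ⟨t, ht⟩) (Icc t₀ T) t := by
  have hd : Differentiable ℝ f := hf.differentiable (by simp)
  have h1 := hasDerivWithinAt_along_curve (S := Icc t₀ T) (h := fun s x => IccExtend h (f x) s)
    (fun s _ => (contDiff_eval hf _).differentiable (by simp))
    (continuousOn_fderiv_IccExtend h hf _) ht (hΨ (Θ x ⟨t, ht⟩) t ht)
  have e : IccExtend h (Ψ (Θ x ⟨t, ht⟩)) t = x := by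
    rw [IccExtend_of_mem h _ ht, hr]
  rw [hr, e] at h1
  -- Along the characteristic through (t, x) the function is constant, so its variation in time at
  -- fixed x is minus its spatial variation along that characteristic; no time differentiability of
  -- f is presupposed.
  have e' : ∀ s ∈ Icc t₀ T, IccExtend h (f x) s = f₀ (Θ x ⟨t, ht⟩) -
      (IccExtend h (f (IccExtend h (Ψ (Θ x ⟨t, ht⟩)) s)) s - IccExtend h (f x) s) := fun s hs => by
    simp only [IccExtend_of_mem h _ hs, hc]
    simp
  have h2 := (h1.const_sub (f₀ (Θ x ⟨t, ht⟩))).congr e' (e' t ht)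
  rw [transportVelocity_apply hd]
  simpa only [IccExtend_of_mem h _ ht] using h2

variable {h : t₀ ≤ T} {V : C(X, C(Icc t₀ T, X))} {Ψ Θ : X → C(Icc t₀ T, X)} {C : ℝ≥0}

theorem IsFlow.hasDerivWithinAt [CompleteSpace X] (hF : IsFlow h V Ψ Θ C) (x : X) {t : ℝ}
    (ht : t ∈ Icc t₀ T) :
    HasDerivWithinAt (IccExtend h (Ψ x)) (V (Ψ x ⟨t, ht⟩) ⟨t, ht⟩) (Icc t₀ T) t := by
  have := hasDerivWithinAt_of_eq_primitiveC h (hF.eq x) t ht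
  rwa [IccExtend_of_mem h _ ht] at this

end InverseVelocity

/-! ### Extension of functions on a time interval to all times. -/

section Extension

variable {t₀ T : ℝ} {X F : Type} [NormedAddCommGroup X] [NormedSpace ℝ X] [FiniteDimensional ℝ X]
  [NormedAddCommGroup F] [NormedSpace ℝ F] [CompleteSpace F]

theorem continuous_integral_IccExtend (h : t₀ ≤ T) {Y : Type*} [TopologicalSpace Y]
    {g : Y → C(Icc t₀ T, F)} (hg : Continuous g) :
    Continuous fun q : ℝ × Y => ∫ r in t₀..q.1, IccExtend h (g q.2) r := by
  refine intervalIntegral.continuous_parametric_intervalIntegral_of_continuous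
    (f := fun (q : ℝ × Y) r => IccExtend h (g q.2) r) ?_ continuous_fst
  exact Continuous.eval (hg.comp (continuous_snd.comp continuous_fst))
    ((continuous_projIcc (h := h)).comp continuous_snd)

/-- A `C¹` family of `C¹` functions on an interval extends to a `C¹` function of all times. -/
theorem exists_contDiff_extension (h : t₀ ≤ T) {α β : X → C(Icc t₀ T, F)} (hα : ContDiff ℝ 1 α)
    (hβ : ContDiff ℝ 1 β)
    (hd : ∀ x, ∀ t (ht : t ∈ Icc t₀ T),
      HasDerivWithinAt (IccExtend h (α x)) (β x ⟨t, ht⟩) (Icc t₀ T) t) :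
    ∃ e : ℝ → X → F, ContDiff ℝ 1 (fun w : ℝ × X => e w.1 w.2) ∧
      (∀ x t (ht : t ∈ Icc t₀ T), e t x = α x ⟨t, ht⟩) ∧
      (∀ x t (ht : t ∈ Icc t₀ T), HasDerivAt (fun s => e s x) (β x ⟨t, ht⟩) t) ∧
      ∀ x t (ht : t ∈ Icc t₀ T), ∀ w : ℝ × X, fderiv ℝ (fun w : ℝ × X => e w.1 w.2) (t, x) w
        = w.1 • β x ⟨t, ht⟩ + fderiv ℝ (fun x => α x ⟨t, ht⟩) x w.2 := by
  set i₀ : Icc t₀ T := ⟨t₀, left_mem_Icc.2 h⟩ with hi₀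
  have hc : ∀ g : C(Icc t₀ T, F), Continuous (IccExtend h g) := fun g => g.continuous.Icc_extend'
  have hαd : Differentiable ℝ α := hα.differentiable (by simp)
  have hβd : Differentiable ℝ β := hβ.differentiable (by simp)
  -- Integrating the clamped velocity continues the function affinely beyond the interval and keeps
  -- it C¹, as the test functions of `SolvesContinuity` must be differentiable on the whole time
  -- line.
  let e : ℝ → X → F := fun t x => α x i₀ + ∫ r in t₀..t, IccExtend h (β x) r
  let P : ℝ → C(Icc t₀ T, F) →L[ℝ] F := fun t =>
    { toFun := fun g => ∫ r in t₀..t, IccExtend h g r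
      map_add' := fun f g => by
        rw [← intervalIntegral.integral_add ((hc f).intervalIntegrable _ _)
          ((hc g).intervalIntegrable _ _)]
        rfl
      map_smul' := fun c g => by
        rw [RingHom.id_apply, ← intervalIntegral.integral_smul]
        rfl
      cont := (continuous_integral_IccExtend h continuous_id).comp
        (by fun_prop : Continuous fun g : C(Icc t₀ T, F) => (t, g)) }
  have hed : ∀ x t, HasDerivAt (fun s => e s x) (IccExtend h (β x) t) t := fun x t =>
    (intervalIntegral.integral_hasDerivAt_right ((hc _).intervalIntegrable _ _)
      ((hc _).stronglyMeasurableAtFilter _ _) (hc _).continuousAt).const_add _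
  let f₁ : ℝ → X → ℝ →L[ℝ] F := fun t x => ContinuousLinearMap.toSpanSingleton ℝ (IccExtend h (β x) t)
  let f₂ : ℝ → X → X →L[ℝ] F := fun t x =>
    fderiv ℝ (fun x => α x i₀) x + (P t).comp (fderiv ℝ β x)
  have c₁ : Continuous fun q : ℝ × X => f₁ q.1 q.2 := by
    have h1 : Continuous fun q : ℝ × X => IccExtend h (β q.2) q.1 :=
      Continuous.eval (hβ.continuous.comp continuous_snd)
        ((continuous_projIcc (h := h)).comp continuous_fst)
    exact (ContinuousLinearMap.toSpanSingletonCLE (𝕜 := ℝ) (E := F)).continuous.comp h1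
  have c₂ : Continuous fun q : ℝ × X => f₂ q.1 q.2 := by
    refine continuous_clm_apply.2 fun k => ?_
    refine Continuous.add ?_ ?_
    · exact (((contDiff_eval hα i₀).continuous_fderiv (by simp)).comp
        continuous_snd).clm_apply continuous_const
    · exact continuous_integral_IccExtend h (g := fun x => fderiv ℝ β x k)
        ((hβ.continuous_fderiv (by simp)).clm_apply continuous_const)
  have hstrict : ∀ q : ℝ × X, HasFDerivAt (fun w : ℝ × X => e w.1 w.2)
      ((f₁ q.1 q.2).coprod (f₂ q.1 q.2)) q := fun q => by
    refine (hasStrictFDerivAt_uncurry_coprod (f := e) (f₁ := f₁) (f₂ := f₂) ?_ ?_ c₁.continuousAt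
      c₂.continuousAt).hasFDerivAt
    · exact Eventually.of_forall fun v => (hed v.2 v.1).hasFDerivAt
    · refine Eventually.of_forall fun v => ?_
      exact ((contDiff_eval hα i₀).differentiable (by simp) v.2).hasFDerivAt.add
        ((P v.1).hasFDerivAt.comp v.2 (hβd v.2).hasFDerivAt)
  have heα : ∀ x t (ht : t ∈ Icc t₀ T), e t x = α x ⟨t, ht⟩ := fun x t ht => by
    have h0 : t₀ ∈ Icc t₀ T := left_mem_Icc.2 h
    have h1 := eq_of_hasDerivWithinAt_zero (f := fun s => e s x - IccExtend h (α x) s)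
      (a := t₀) (b := T) (fun s hs => ((hed x s).hasDerivWithinAt.sub (hd x s hs)).congr_deriv (by
        rw [IccExtend_of_mem h _ hs, sub_self])) ht h0
    simp only [IccExtend_of_mem h _ ht, IccExtend_of_mem h _ h0] at h1
    have h2 : e t₀ x = α x i₀ := by simp [e]
    rw [h2, hi₀, sub_self, sub_eq_zero] at h1
    exact h1
  refine ⟨e, contDiff_one_iff_hasFDerivAt.2 ⟨_, ?_, hstrict⟩, heα, fun x t ht => ?_,
    fun x t ht w => ?_⟩
  · refine continuous_clm_apply.2 fun k => ?_
    simp only [ContinuousLinearMap.coprod_apply]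
    exact (c₁.clm_apply continuous_const).add (c₂.clm_apply continuous_const)
  · have := hed x t
    rwa [IccExtend_of_mem h _ ht] at this
  · have h1 : fderiv ℝ (fun x => α x ⟨t, ht⟩) x = f₂ t x := by
      have h2 : (fun x => α x ⟨t, ht⟩) = fun x => e t x := funext fun x => (heα x t ht).symm
      rw [h2]
      exact (((contDiff_eval hα i₀).differentiable (by simp) x).hasFDerivAt.add
        ((P t).hasFDerivAt.comp x (hβd x).hasFDerivAt)).fderiv
    rw [(hstrict (t, x)).fderiv, h1, ContinuousLinearMap.coprod_apply]
    simp [f₁, IccExtend_of_mem h _ ht]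

end Extension

/-! ### Lifting the flow to the phase space, and transport by its inverse. -/

section Lift

variable {d₁ d₂ : ℕ} {t₀ T : ℝ}

/-- The lift to the phase space of paths in the feature space, the label being constant. -/
noncomputable def liftC (Ψ : E d₁ → C(Icc t₀ T, E d₁)) (z : Phase d₁ d₂) :
    C(Icc t₀ T, Phase d₁ d₂) := (Ψ z.1).prodMk (ContinuousMap.const _ z.2)

/-- The lift to the phase space of a time-dependent vector field. -/
noncomputable def liftField (V : E d₁ → C(Icc t₀ T, E d₁)) (z : Phase d₁ d₂) :
    C(Icc t₀ T, Phase d₁ d₂) := (V z.1).prodMk 0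

@[simp] theorem liftC_apply (Ψ : E d₁ → C(Icc t₀ T, E d₁)) (z : Phase d₁ d₂) (t : Icc t₀ T) :
    liftC Ψ z t = (Ψ z.1 t, z.2) := rfl

@[simp] theorem liftField_apply (V : E d₁ → C(Icc t₀ T, E d₁)) (z : Phase d₁ d₂)
    (t : Icc t₀ T) : liftField V z t = (V z.1 t, 0) := rfl

theorem contDiff_liftField {n : WithTop ℕ∞} {V : E d₁ → C(Icc t₀ T, E d₁)} (hV : ContDiff ℝ n V) :
    ContDiff ℝ n (liftField V : Phase d₁ d₂ → C(Icc t₀ T, Phase d₁ d₂)) :=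
  (hV.comp contDiff_fst).continuousLinearMap_comp
    ((ContinuousLinearMap.inl ℝ (E d₁) (E d₂)).compLeftContinuous ℝ (Icc t₀ T))

theorem contDiff_liftC {n : WithTop ℕ∞} {Ψ : E d₁ → C(Icc t₀ T, E d₁)} (hΨ : ContDiff ℝ n Ψ) :
    ContDiff ℝ n (liftC Ψ : Phase d₁ d₂ → C(Icc t₀ T, Phase d₁ d₂)) := by
  have h1 := contDiff_liftField (d₂ := d₂) hΨ
  have h2 : ContDiff ℝ n fun z : Phase d₁ d₂ => constC (Icc t₀ T) (Phase d₁ d₂) (0, z.2) :=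
    ContDiff.continuousLinearMap_comp (constC (Icc t₀ T) (Phase d₁ d₂))
      (contDiff_const.prodMk contDiff_snd)
  have e : (liftC Ψ : Phase d₁ d₂ → C(Icc t₀ T, Phase d₁ d₂)) =
      fun z => liftField Ψ z + constC (Icc t₀ T) (Phase d₁ d₂) (0, z.2) := by
    ext1 z
    ext1 t
    change (Ψ z.1 t, z.2) = (Ψ z.1 t, 0) + (0, z.2)
    simp
  rw [e]
  exact h1.add h2

variable {h : t₀ ≤ T} {V : C(E d₁, C(Icc t₀ T, E d₁))} {Ψ Θ : E d₁ → C(Icc t₀ T, E d₁)} {C : ℝ≥0}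

theorem IsFlow.hasDerivWithinAt_lift (hF : IsFlow h V Ψ Θ C) (z : Phase d₁ d₂) {t : ℝ}
    (ht : t ∈ Icc t₀ T) :
    HasDerivWithinAt (IccExtend h (liftC Ψ z))
      (liftField V (liftC Ψ z ⟨t, ht⟩) ⟨t, ht⟩) (Icc t₀ T) t :=
  (hF.hasDerivWithinAt z.1 ht).prodMk (hasDerivWithinAt_const t (Icc t₀ T) z.2)

theorem IsFlow.lift_right_inv (hF : IsFlow h V Ψ Θ C) (t : Icc t₀ T) (z : Phase d₁ d₂) :
    liftC Ψ (liftC Θ z t) t = z := by simp [hF.right_inv]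

theorem IsFlow.lift_left_inv (hF : IsFlow h V Ψ Θ C) (t : Icc t₀ T) (z : Phase d₁ d₂) :
    liftC Θ (liftC Ψ z t) t = z := by simp [hF.left_inv]

theorem IsFlow.lift_initial (hF : IsFlow h V Ψ Θ C) (z : Phase d₁ d₂) :
    liftC Ψ z ⟨t₀, left_mem_Icc.2 h⟩ = z := by
  rw [liftC_apply, initial_eq hF.eq]

theorem IsFlow.lift_inv_initial (hF : IsFlow h V Ψ Θ C) (z : Phase d₁ d₂) :
    liftC Θ z ⟨t₀, left_mem_Icc.2 h⟩ = z := by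
  have h1 := hF.lift_left_inv (d₂ := d₂) ⟨t₀, left_mem_Icc.2 h⟩ z
  rwa [hF.lift_initial] at h1

theorem lipschitz_liftC {Ψ : E d₁ → C(Icc t₀ T, E d₁)} {t : Icc t₀ T} {C : ℝ≥0}
    (hΨ : LipschitzWith C fun x => Ψ x t) :
    LipschitzWith (max C 1) fun z : Phase d₁ d₂ => liftC Ψ z t := by
  simpa using (hΨ.comp LipschitzWith.prod_fst).prodMk (LipschitzWith.prod_snd (α := E d₁) (β := E d₂))

/-- Transport by the inverse flow. -/
noncomputable def transportC (Θ : E d₁ → C(Icc t₀ T, E d₁)) (ψ : C(Phase d₁ d₂, ℝ))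
    (z : Phase d₁ d₂) : C(Icc t₀ T, ℝ) := ψ.comp (liftC Θ z)

@[simp] theorem transportC_apply (Θ : E d₁ → C(Icc t₀ T, E d₁)) (ψ : C(Phase d₁ d₂, ℝ))
    (z : Phase d₁ d₂) (t : Icc t₀ T) : transportC Θ ψ z t = ψ (liftC Θ z t) := rfl

theorem IsFlow.contDiff_transportC (hF : IsFlow h V Ψ Θ C) {ψ : C(Phase d₁ d₂, ℝ)}
    (hψ : ContDiff ℝ 3 ψ) : ContDiff ℝ 3 (transportC Θ ψ) :=
  (contDiff_postcomp 3 ψ hψ).comp (contDiff_liftC hF.smooth_inv)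

theorem IsFlow.hasDerivWithinAt_transportC (hF : IsFlow h V Ψ Θ C) {ψ : C(Phase d₁ d₂, ℝ)}
    (hψ : ContDiff ℝ 3 ψ) (z : Phase d₁ d₂) {t : ℝ} (ht : t ∈ Icc t₀ T) :
    HasDerivWithinAt (IccExtend h (transportC Θ ψ z))
      (transportVelocity (transportC Θ ψ) (liftField V) z ⟨t, ht⟩) (Icc t₀ T) t :=
  hasDerivWithinAt_transport (Ψ := liftC Ψ) (Θ := liftC Θ) (V := liftField V)
    (fun z _ ht => hF.hasDerivWithinAt_lift z ht) hF.lift_right_inv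
    ((hF.contDiff_transportC hψ).of_le (by norm_num)) (f₀ := ψ)
    (fun z t => by rw [transportC_apply, hF.lift_left_inv]) z ht

theorem IsFlow.contDiff_velocity (hF : IsFlow h V Ψ Θ C) {n : WithTop ℕ∞} (hn : n + 1 ≤ 3)
    (hV : ContDiff ℝ 3 V)
    {ψ : C(Phase d₁ d₂, ℝ)} (hψ : ContDiff ℝ 3 ψ) :
    ContDiff ℝ n (transportVelocity (transportC Θ ψ) (liftField V)) :=
  contDiff_transportVelocity ((hF.contDiff_transportC hψ).of_le hn)
    (contDiff_liftField (hV.of_le (le_self_add.trans hn)))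

end Lift

/-! ### Representation of γ and u by characteristics. -/

section Pushforward

variable {d₁ d₂ d' : ℕ} {t₀ T : ℝ} {h : t₀ ≤ T} {V : C(E d₁, C(Icc t₀ T, E d₁))}
  {Ψ Θ : E d₁ → C(Icc t₀ T, E d₁)} {C K : ℝ≥0}

/-- Test the equation against f ∘ Ψ_t ∘ Θ_s at time s. It is constant along the flow, so the
integrand vanishes; it equals f at s = t and f ∘ Ψ_t at s = t₀. Uniqueness for the continuity
equation thus comes out by duality. -/
theorem IsFlow.integral_pushforward (hF : IsFlow h V Ψ Θ C) (hV : FlowField V K)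
    {b : E d₁ → E d' → E d₁} {ν : ℝ → Measure (E d')}
    (hdrift : ∀ (t : Icc t₀ T) x, drift b (ν t) x = V x t) {γ₀ : Measure (Phase d₁ d₂)}
    {γ : ℝ → Measure (Phase d₁ d₂)} (hγ : SolvesContinuity b t₀ T γ₀ ν γ)
    {f : Phase d₁ d₂ → ℝ} (hf : ContDiff ℝ 3 f) {B : ℝ} (hfb : ∀ z, |f z| ≤ B) {M : ℝ≥0}
    (hfl : LipschitzWith M f) (t : Icc t₀ T) :
    ∫ z, f z ∂(γ t) = ∫ z, f (liftC Ψ z t) ∂γ₀ := by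
  set ψ : C(Phase d₁ d₂, ℝ) := ⟨fun z => f (liftC Ψ z t),
    hf.continuous.comp (contDiff_eval (contDiff_liftC hF.smooth) t).continuous⟩ with hψ
  have hψs : ContDiff ℝ 3 ψ := hf.comp (contDiff_eval (contDiff_liftC hF.smooth) t)
  have hα := hF.contDiff_transportC hψs
  have hβ := hF.contDiff_velocity (n := 1) (by norm_num) hV.smooth hψs
  obtain ⟨e, he, heα, het, hef⟩ := exists_contDiff_extension h (hα.of_le (by norm_num)) hβ
    (fun z _ ht => hF.hasDerivWithinAt_transportC hψs z ht)
  have hαd : Differentiable ℝ (transportC Θ ψ) := hα.differentiable (by simp)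
  have hlip : ∀ s, LipschitzWith (M * max C 1 * max C 1) fun z => transportC Θ ψ z s := fun s =>
    (hfl.comp (lipschitz_liftC (hF.lip t))).comp (lipschitz_liftC (hF.lip_inv s))
  have hD : ∀ s z, ‖fderiv ℝ (fun z => transportC Θ ψ z s) z‖ ≤ (M * max C 1 * max C 1 : ℝ≥0) :=
    fun s z => norm_fderiv_le_of_lipschitz ℝ (hlip s)
  have hvel : ∀ (z : Phase d₁ d₂) s, ‖liftField V z s‖ ≤ K := fun z s => by
    rw [liftField_apply, norm_prodMk_zero]
    exact hV.bdd _ _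
  have hβb : ∀ z s, ‖transportVelocity (transportC Θ ψ) (liftField V) z s‖
      ≤ (M * max C 1 * max C 1 : ℝ≥0) * K := fun z s => by
    rw [transportVelocity_apply hαd, norm_neg]
    exact (ContinuousLinearMap.le_opNorm _ _).trans
      (mul_le_mul (hD s z) (hvel z s) (norm_nonneg _) (NNReal.coe_nonneg _))
  set D : ℝ := ((M * max C 1 * max C 1 : ℝ≥0) : ℝ) with hDdef
  have hD0 : 0 ≤ D := NNReal.coe_nonneg _
  have hgrad : ∀ s (hs : s ∈ Icc t₀ T) z,
      fderiv ℝ (e s) z = fderiv ℝ (fun z => transportC Θ ψ z ⟨s, hs⟩) z := fun s hs z => by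
    congr 1; exact funext fun z => heα z s hs
  have heq := hγ.2 e he ⟨max B (D * K + D), fun s hs z => ⟨?_, ?_⟩⟩ t t.2
  · have e1 : ∀ z, e t z = f z := fun z => by
      rw [heα z t t.2, transportC_apply]
      change f (liftC Ψ (liftC Θ z t) t) = f z
      rw [hF.lift_right_inv]
    have e0 : ∀ z, e t₀ z = f (liftC Ψ z t) := fun z => by
      rw [heα z t₀ (left_mem_Icc.2 h), transportC_apply]
      rw [hF.lift_inv_initial]
      rfl
    have ez : ∫ s in t₀..(t : ℝ), ∫ z, (deriv (fun s => e s z) s +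
          inner ℝ (drift b (ν s) z.1) (gradX (e s) z)) ∂(γ s) = 0 := by
      refine (intervalIntegral.integral_congr (g := fun _ => (0 : ℝ)) fun s hs => ?_).trans (by simp)
      rw [uIcc_of_le t.2.1] at hs
      have hsI : s ∈ Icc t₀ T := ⟨hs.1, hs.2.trans t.2.2⟩
      refine (integral_congr_ae (ae_of_all _ fun z => ?_)).trans (integral_zero _ _)
      have hdiff : DifferentiableAt ℝ (e s) z := by
        have : e s = fun z => transportC Θ ψ z ⟨s, hsI⟩ := funext fun z => heα z s hsI
        rw [this]
        exact (contDiff_eval hα _).differentiable (by simp) z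
      rw [(het z s hsI).deriv, inner_gradX hdiff, hgrad s hsI, transportVelocity_apply hαd,
        hdrift ⟨s, hsI⟩, liftField_apply]
      simp
    rw [ez, add_zero] at heq
    simp only [e1, e0] at heq
    exact heq
  · rw [heα z s hs]
    exact (hfb _).trans (le_max_left _ _)
  · refine le_trans ?_ (le_max_right _ _)
    refine ContinuousLinearMap.opNorm_le_bound _ (by positivity) fun w => ?_
    rw [hef z s hs]
    refine (norm_add_le _ _).trans ?_
    rw [norm_smul, add_mul]
    refine add_le_add ?_ ?_
    · rw [mul_comm]
      exact mul_le_mul (hβb z _) (norm_fst_le w) (norm_nonneg _) (by positivity)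
    · exact (ContinuousLinearMap.le_opNorm _ _).trans
        (mul_le_mul (hD _ z) (norm_snd_le w) (norm_nonneg _) hD0)

theorem IsFlow.measurable_liftC (hF : IsFlow h V Ψ Θ C) (t : Icc t₀ T) :
    Measurable fun z : Phase d₁ d₂ => liftC Ψ z t :=
  (contDiff_eval (contDiff_liftC hF.smooth) t).continuous.measurable

/-- The solution of the continuity equation is transported by the flow. -/
theorem IsFlow.eq_map (hF : IsFlow h V Ψ Θ C) (hV : FlowField V K)
    {b : E d₁ → E d' → E d₁} {ν : ℝ → Measure (E d')}
    (hdrift : ∀ (t : Icc t₀ T) x, drift b (ν t) x = V x t) {γ₀ : Measure (Phase d₁ d₂)}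
    [IsFiniteMeasure γ₀] {γ : ℝ → Measure (Phase d₁ d₂)} (hγ : SolvesContinuity b t₀ T γ₀ ν γ)
    (t : Icc t₀ T) : γ t = γ₀.map fun z => liftC Ψ z t := by
  have := (hγ.1.1 t t.2).1
  have hm := hF.measurable_liftC (d₂ := d₂) t
  -- Cosines and sines of linear forms are bounded, smooth and Lipschitz, hence admissible in the
  -- duality formula, and they determine the measure.
  refine Measure.ext_of_charFunDual (funext fun l => ?_)
  rw [charFunDual_apply, charFunDual_apply, integral_map hm.aemeasurable (by fun_prop)]
  have hi : ∀ (μ : Measure (Phase d₁ d₂)) [IsFiniteMeasure μ] (g : Phase d₁ d₂ → ℝ),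
      Continuous g → Integrable (fun z => Complex.exp (g z * Complex.I)) μ := fun μ _ g hg =>
    (integrable_const (1 : ℝ)).mono' (by fun_prop)
      (ae_of_all _ fun z => by rw [Complex.norm_exp_ofReal_mul_I])
  have hl : Continuous fun z : Phase d₁ d₂ => l (liftC Ψ z t) :=
    l.continuous.comp (contDiff_eval (contDiff_liftC hF.smooth) t).continuous
  have hcos : LipschitzWith (1 * ‖l‖₊) fun z : Phase d₁ d₂ => Real.cos (l z) :=
    LipschitzWith.comp (f := Real.cos) Real.lipschitzWith_cos l.lipschitz
  have hsin : LipschitzWith (1 * ‖l‖₊) fun z : Phase d₁ d₂ => Real.sin (l z) :=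
    LipschitzWith.comp (f := Real.sin) Real.lipschitzWith_sin l.lipschitz
  have h1 := hF.integral_pushforward hV hdrift hγ (f := fun z => Real.cos (l z))
    (Real.contDiff_cos.comp l.contDiff) (fun z => Real.abs_cos_le_one _) hcos t
  have h2 := hF.integral_pushforward hV hdrift hγ (f := fun z => Real.sin (l z))
    (Real.contDiff_sin.comp l.contDiff) (fun z => Real.abs_sin_le_one _) hsin t
  apply Complex.ext
  · have e1 := integral_re (𝕜 := ℂ) (hi (γ t) l l.continuous)
    have e2 := integral_re (𝕜 := ℂ) (hi γ₀ _ hl)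
    simp only [RCLike.re_eq_complex_re, Complex.exp_ofReal_mul_I_re] at e1 e2
    rw [← e1, ← e2, h1]
  · have e1 := integral_im (𝕜 := ℂ) (hi (γ t) l l.continuous)
    have e2 := integral_im (𝕜 := ℂ) (hi γ₀ _ hl)
    simp only [RCLike.im_eq_complex_im, Complex.exp_ofReal_mul_I_im] at e1 e2
    rw [← e1, ← e2, h2]

/-- The adjoint state is constant along the flow. -/
theorem IsFlow.adjoint_eq (hF : IsFlow h V Ψ Θ C)
    {b : E d₁ → E d' → E d₁} {ν : ℝ → Measure (E d')} {L : Phase d₁ d₂ → ℝ}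
    (hdrift : ∀ (t : Icc t₀ T) x, drift b (ν t) x = V x t) {u : ℝ → Phase d₁ d₂ → ℝ}
    (hu : SolvesAdjoint b L t₀ T ν u) (t : Icc t₀ T) (z : Phase d₁ d₂) :
    u t (liftC Ψ z t) = L (liftC Ψ z ⟨T, right_mem_Icc.2 h⟩) := by
  have hg := linearGrad_of_solvesAdjoint hu
  have hcont : ∀ z : Phase d₁ d₂,
      ContinuousOn (fun s => fderiv ℝ (u s) z (IccExtend h (V z.1) s, 0)) (Icc t₀ T) := fun z => by
    have h1 : ContinuousOn (fun s => fderiv ℝ (u s) z) (Icc t₀ T) :=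
      hg.continuousOn.comp (f := fun s => (s, z)) (by fun_prop) fun s hs => ⟨hs, mem_univ _⟩
    have h2 : Continuous fun s => ((IccExtend h (V z.1) s, 0) : Phase d₁ d₂) :=
      ((V z.1).continuous.Icc_extend').prodMk continuous_const
    exact h1.clm_apply h2.continuousOn
  have hfix : ∀ z : Phase d₁ d₂, ∀ s ∈ Icc t₀ T, HasDerivWithinAt (fun r => u r z)
      (-fderiv ℝ (u s) z (IccExtend h (V z.1) s, 0)) (Icc t₀ T) s := fun z s hs => by
    have e : ∀ r ∈ Icc t₀ T, u r z
        = L z + ∫ q in r..T, fderiv ℝ (u q) z (IccExtend h (V z.1) q, 0) := fun r hr => by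
      rw [hu.2.2 r hr z]
      congr 1
      refine intervalIntegral.integral_congr fun q hq => ?_
      rw [uIcc_of_le hr.2] at hq
      have hqI : q ∈ Icc t₀ T := ⟨hr.1.trans hq.1, hq.2⟩
      rw [inner_gradX (hg.differentiable hqI z), hdrift ⟨q, hqI⟩, IccExtend_of_mem h _ hqI]
    refine HasDerivWithinAt.congr (HasDerivWithinAt.const_add _ ?_) e (e s hs)
    have : Fact (s ∈ Icc t₀ T) := ⟨hs⟩
    refine intervalIntegral.integral_hasDerivWithinAt_left ?_ (t := Icc t₀ T)
      ((hcont z).stronglyMeasurableAtFilter_nhdsWithin measurableSet_Icc s) (hcont z s hs)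
    refine ContinuousOn.intervalIntegrable ((hcont z).mono ?_)
    rw [uIcc_of_le hs.2]
    exact Icc_subset_Icc_left hs.1
  -- The time derivative at a fixed point, read off from the integral equation, cancels the spatial
  -- derivative along the characteristic.
  have hconst := eq_of_hasDerivWithinAt_zero (f := fun s => u s (IccExtend h (liftC Ψ z) s))
    (a := t₀) (b := T) (fun s hs => by
      refine (hasDerivWithinAt_comp_curve (h := u) (fun r hr => hg.differentiable hr)
        hg.continuousOn hs (hF.hasDerivWithinAt_lift z hs) (hfix _ s hs)).congr_deriv ?_
      simp only [IccExtend_of_mem h _ hs, liftField_apply, add_neg_cancel])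
    t.2 (right_mem_Icc.2 h)
  simp only [IccExtend_of_mem h _ t.2, IccExtend_of_mem h _ (right_mem_Icc.2 h)] at hconst
  rw [hconst, hu.2.2 T (right_mem_Icc.2 h)]
  simp

end Pushforward

/-! ### Compactly supported test functions transported by the flow. -/

section CompactlySupported

variable {d₁ d₂ : ℕ} {t₀ T : ℝ} {F : Type} [NormedAddCommGroup F] [NormedSpace ℝ F]

theorem norm_iteratedFDeriv_eval_le {f : Phase d₁ d₂ → C(Icc t₀ T, F)} {k j : ℕ}
    (hf : ContDiff ℝ k f) (hj : j ≤ k) (t : Icc t₀ T) (z : Phase d₁ d₂) :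
    ‖iteratedFDeriv ℝ j (fun z => f z t) z‖ ≤ ‖iteratedFDeriv ℝ j f z‖ := by
  have h1 := (ContinuousMap.evalCLM ℝ t : C(Icc t₀ T, F) →L[ℝ] F).iteratedFDeriv_comp_left
    (hf.contDiffAt (x := z)) (i := j) (by exact_mod_cast hj)
  change iteratedFDeriv ℝ j (fun z => f z t) z = _ at h1
  rw [h1]
  refine (ContinuousLinearMap.norm_compContinuousMultilinearMap_le _ _).trans ?_
  refine mul_le_of_le_one_left (norm_nonneg _) ?_
  exact ContinuousLinearMap.opNorm_le_bound _ zero_le_one fun g => by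
    rw [one_mul]; exact ContinuousMap.norm_coe_le_norm g t

theorem boundedIn_of_hasCompactSupport (h : t₀ ≤ T) {k : ℕ} (p : ℕ)
    {f : Phase d₁ d₂ → C(Icc t₀ T, F)} (hf : ContDiff ℝ k f) (hs : HasCompactSupport f) :
    BoundedIn k p t₀ T fun t z => IccExtend h (f z) t := by
  refine ⟨fun t _ => contDiff_eval hf _, ?_⟩
  have hb : ∀ j, ∃ M : ℝ, j ≤ k → ∀ z, ‖iteratedFDeriv ℝ j f z‖ ≤ M := fun j => by
    by_cases hj : j ≤ k
    · obtain ⟨M, hM⟩ := (hs.iteratedFDeriv (𝕜 := ℝ) j).exists_bound_of_continuous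
        (hf.continuous_iteratedFDeriv (m := j) (by exact_mod_cast hj))
      exact ⟨M, fun _ => hM⟩
    · exact ⟨0, fun h => absurd h hj⟩
  choose M hM using hb
  have hM0 : ∀ j ∈ Finset.range (k + 1), 0 ≤ M j := fun j hj =>
    (norm_nonneg _).trans (hM j (Nat.lt_succ_iff.1 (Finset.mem_range.1 hj)) 0)
  refine ⟨(∑ j ∈ Finset.range (k + 1), M j).toNNReal, fun t _ => ?_⟩
  refine growthNorm_le_of_forall fun z => ?_
  refine le_trans ?_ (le_mul_of_one_le_right (Finset.sum_nonneg hM0) (one_le_gw p z))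
  refine Finset.sum_le_sum fun j hj => ?_
  have hj := Nat.lt_succ_iff.1 (Finset.mem_range.1 hj)
  exact (norm_iteratedFDeriv_eval_le hf hj _ z).trans (hM j hj z)

/-- The deviation of values and first derivatives between times s and t is jointly continuous in (s,
z), zero at s = t, and zero off the support; compactness makes it uniformly small. -/
theorem continuousIn_of_hasCompactSupport (h : t₀ ≤ T) (p : ℕ)
    {f : Phase d₁ d₂ → C(Icc t₀ T, F)} (hf : ContDiff ℝ 1 f) (hs : HasCompactSupport f) :
    ContinuousIn 1 p t₀ T fun t z => IccExtend h (f z) t := by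
  have hf1 : ContDiff ℝ (1 : ℕ) f := by exact_mod_cast hf
  obtain ⟨hb1, C, hC⟩ := boundedIn_of_hasCompactSupport h p hf1 hs
  refine ⟨fun t ht => ⟨hb1 t ht, (hC t ht).trans_lt ENNReal.coe_lt_top⟩, fun t ht => ?_⟩
  have hd : ∀ s : Icc t₀ T, Differentiable ℝ fun z => f z s := fun s =>
    (contDiff_eval hf s).differentiable (by simp)
  have hd' : ∀ s : ℝ, Differentiable ℝ fun z => IccExtend h (f z) s := fun s => hd _
  let G : ℝ × Phase d₁ d₂ → ℝ := fun q =>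
    ‖f q.2 (projIcc t₀ T h q.1) - f q.2 (projIcc t₀ T h t)‖
      + ‖fderiv ℝ (fun z => f z (projIcc t₀ T h q.1)) q.2
        - fderiv ℝ (fun z => f z (projIcc t₀ T h t)) q.2‖
  have hG : Continuous G := by
    have c1 : Continuous fun q : ℝ × Phase d₁ d₂ => f q.2 (projIcc t₀ T h q.1) :=
      Continuous.eval (hf.continuous.comp continuous_snd)
        ((continuous_projIcc (h := h)).comp continuous_fst)
    have c2 : Continuous fun q : ℝ × Phase d₁ d₂ => f q.2 (projIcc t₀ T h t) :=
      Continuous.eval (hf.continuous.comp continuous_snd) continuous_const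
    have c3 : Continuous fun q : ℝ × Phase d₁ d₂ =>
        fderiv ℝ (fun z => f z (projIcc t₀ T h q.1)) q.2 :=
      (continuous_fderiv_eval hf).comp
        (((continuous_projIcc (h := h)).comp continuous_fst).prodMk continuous_snd)
    have c4 : Continuous fun q : ℝ × Phase d₁ d₂ =>
        fderiv ℝ (fun z => f z (projIcc t₀ T h t)) q.2 :=
      (continuous_fderiv_eval hf).comp (continuous_const.prodMk continuous_snd)
    exact (c1.sub c2).norm.add (c3.sub c4).norm
  have hsum : ∀ s : ℝ, ∀ z, ∑ j ∈ Finset.range (1 + 1), ‖iteratedFDeriv ℝ j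
      ((fun z => IccExtend h (f z) s) - fun z => IccExtend h (f z) t) z‖ = G (s, z) := by
    intro s z
    rw [Finset.sum_range_succ, Finset.sum_range_one, norm_iteratedFDeriv_zero,
      norm_iteratedFDeriv_one, fderiv_sub (hd' s z) (hd' t z)]
    rfl
  have hG0 : ∀ s, ∀ z ∉ tsupport f, G (s, z) = 0 := fun s z hz => by
    have h1 : f =ᶠ[𝓝 z] 0 := notMem_tsupport_iff_eventuallyEq.1 hz
    have h2 : ∀ r : Icc t₀ T, fderiv ℝ (fun z => f z r) z = 0 := fun r => by
      have : (fun z => f z r) =ᶠ[𝓝 z] fun _ => 0 := h1.mono fun w hw => by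
        change f w r = 0
        rw [hw]; rfl
      rw [this.fderiv_eq]
      simp
    have h3 : f z = 0 := h1.self_of_nhds
    simp [G, h2, h3]
  rw [ENNReal.tendsto_nhds_zero]
  intro ε hε
  obtain ⟨δ, hδ, hδε⟩ : ∃ δ : ℝ, 0 < δ ∧ ENNReal.ofReal δ ≤ ε := by
    rcases eq_or_ne ε ⊤ with rfl | hne
    · exact ⟨1, one_pos, le_top⟩
    · exact ⟨ε.toReal, ENNReal.toReal_pos hε.ne' hne, by rw [ENNReal.ofReal_toReal hne]⟩
  have hev : ∀ᶠ s in 𝓝 t, ∀ z ∈ tsupport f, G (s, z) < δ := by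
    refine hs.isCompact.eventually_forall_of_forall_eventually fun z _ => ?_
    have : G (t, z) < δ := by simpa [G] using hδ
    exact (hG.tendsto (t, z)).eventually_lt_const this
  filter_upwards [nhdsWithin_le_nhds hev] with s hs'
  refine (growthNorm_le_of_forall (C := δ) fun z => ?_).trans hδε
  rw [hsum]
  refine le_trans ?_ (le_mul_of_one_le_right hδ.le (one_le_gw p z))
  by_cases hz : z ∈ tsupport f
  · exact (hs' z hz).le
  · rw [hG0 s z hz]; exact hδ.le

/-- The partial gradient of a path-valued function. -/
noncomputable def gradC (f : Phase d₁ d₂ → C(Icc t₀ T, ℝ)) (z : Phase d₁ d₂) :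
    C(Icc t₀ T, E d₁) :=
  ∑ i, (ContinuousLinearMap.toSpanSingleton ℝ (EuclideanSpace.basisFun (Fin d₁) ℝ i)).compLeftContinuous
    ℝ (Icc t₀ T) (fderiv ℝ f z (EuclideanSpace.basisFun (Fin d₁) ℝ i, 0))

theorem contDiff_gradC {n : WithTop ℕ∞} {f : Phase d₁ d₂ → C(Icc t₀ T, ℝ)}
    (hf : ContDiff ℝ (n + 1) f) : ContDiff ℝ n (gradC f) :=
  ContDiff.sum fun _ _ => ContDiff.continuousLinearMap_comp _
    ((hf.fderiv_right le_rfl).clm_apply contDiff_const)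

theorem hasCompactSupport_gradC {f : Phase d₁ d₂ → C(Icc t₀ T, ℝ)} (hs : HasCompactSupport f) :
    HasCompactSupport (gradC f) := by
  refine (hs.fderiv (𝕜 := ℝ)).mono fun z hz => ?_
  contrapose! hz
  rw [Function.notMem_support] at hz ⊢
  simp [gradC, hz]

theorem gradX_eval {f : Phase d₁ d₂ → C(Icc t₀ T, ℝ)} (hf : Differentiable ℝ f) (t : Icc t₀ T)
    (z : Phase d₁ d₂) : gradX (fun z => f z t) z = gradC f z t := by
  rw [← (EuclideanSpace.basisFun (Fin d₁) ℝ).sum_repr' (gradX (fun z => f z t) z), gradC,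
    ContinuousMap.sum_apply]
  refine Finset.sum_congr rfl fun i _ => ?_
  rw [inner_gradX (hasFDerivAt_eval hf t z).differentiableAt, fderiv_eval hf]
  rfl

theorem hasCompactSupport_transportVelocity {I X : Type} [TopologicalSpace I] [CompactSpace I]
    [NormedAddCommGroup X] [NormedSpace ℝ X] {f : X → C(I, F)} (hs : HasCompactSupport f)
    (V : X → C(I, X)) : HasCompactSupport (transportVelocity f V) := by
  refine (hs.fderiv (𝕜 := ℝ)).mono fun z hz => ?_
  contrapose! hz
  rw [Function.notMem_support] at hz ⊢
  ext t
  simp [transportVelocity, hz]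

theorem isTest_of_hasCompactSupport (h : t₀ ≤ T) {f f' : Phase d₁ d₂ → C(Icc t₀ T, ℝ)}
    (hf : ContDiff ℝ 3 f) (hf' : ContDiff ℝ 2 f') (hs : HasCompactSupport f)
    (hs' : HasCompactSupport f')
    (hd : ∀ z t (ht : t ∈ Icc t₀ T),
      HasDerivWithinAt (IccExtend h (f z)) (f' z ⟨t, ht⟩) (Icc t₀ T) t) :
    IsTest t₀ T (fun t z => IccExtend h (f z) t) fun t z => IccExtend h (f' z) t := by
  have hg : ContDiff ℝ 2 (gradC f) := contDiff_gradC (by norm_num; exact hf)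
  have hgs := hasCompactSupport_gradC hs
  have hge : (fun t => gradX fun z => IccExtend h (f z) t)
      = fun t z => IccExtend h (gradC f z) t := by
    funext t z
    exact gradX_eval (hf.differentiable (by simp)) _ z
  refine ⟨fun t ht z => ?_, ?_, ?_, ?_, ?_, ?_, ?_⟩
  · rw [IccExtend_of_mem h _ ht]; exact hd z t ht
  · exact boundedIn_of_hasCompactSupport h 2 (hf.of_le (by norm_num)) hs
  · exact continuousIn_of_hasCompactSupport h 2 (hf.of_le (by norm_num)) hs
  · exact boundedIn_of_hasCompactSupport h 1 (by exact_mod_cast hf') hs'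
  · rw [hge]; exact boundedIn_of_hasCompactSupport h 1 (by exact_mod_cast hg) hgs
  · exact continuousIn_of_hasCompactSupport h 2 (hf'.of_le (by norm_num)) hs'
  · rw [hge]; exact continuousIn_of_hasCompactSupport h 2 (hg.of_le (by norm_num)) hgs

variable {h : t₀ ≤ T} {V : C(E d₁, C(Icc t₀ T, E d₁))} {Ψ Θ : E d₁ → C(Icc t₀ T, E d₁)} {C : ℝ≥0}

/-- The flow moves points by at most C, so one ball contains the supports at all times. -/
theorem IsFlow.hasCompactSupport_transportC (hF : IsFlow h V Ψ Θ C) {ψ : C(Phase d₁ d₂, ℝ)}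
    (hψ : HasCompactSupport ψ) : HasCompactSupport (transportC Θ ψ) := by
  obtain ⟨R, hR⟩ := hψ.isCompact.isBounded.subset_closedBall (0 : Phase d₁ d₂)
  refine HasCompactSupport.of_support_subset_isCompact
    (isCompact_closedBall (0 : Phase d₁ d₂) (R + C)) fun z hz => ?_
  contrapose! hz
  rw [Function.notMem_support]
  ext t
  rw [transportC_apply]
  by_contra hne
  refine hz ?_
  have h1 : liftC Θ z t ∈ Metric.closedBall (0 : Phase d₁ d₂) R :=
    hR (subset_tsupport _ (Function.mem_support.2 hne))
  rw [mem_closedBall_zero_iff] at h1 ⊢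
  have h2 : ‖z - liftC Θ z t‖ ≤ C := by
    have h3 := hF.norm_sub_le t (Θ z.1 t)
    rw [hF.right_inv] at h3
    have h4 : z - liftC Θ z t = (z.1 - Θ z.1 t, 0) := by
      ext1 <;> simp
    rw [h4, norm_prodMk_zero]
    exact h3
  calc ‖z‖ = ‖liftC Θ z t + (z - liftC Θ z t)‖ := by congr 1; abel
    _ ≤ R + C := (norm_add_le _ _).trans (add_le_add h1 h2)

/-- Time derivative and gradient each cost one derivative and must still be C²; this is what fixes
the order 3 for the flow and for ψ. -/
theorem IsFlow.isTest_transportC (hF : IsFlow h V Ψ Θ C) (hV : ContDiff ℝ 3 V)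
    {ψ : C(Phase d₁ d₂, ℝ)} (hψ : ContDiff ℝ 3 ψ) (hs : HasCompactSupport ψ) :
    IsTest t₀ T (fun t z => IccExtend h (transportC Θ ψ z) t) fun t z =>
      IccExtend h (transportVelocity (transportC Θ ψ) (liftField V) z) t :=
  isTest_of_hasCompactSupport h (hF.contDiff_transportC hψ)
    (hF.contDiff_velocity (n := 2) (by norm_num) hV hψ) (hF.hasCompactSupport_transportC hs)
    (hasCompactSupport_transportVelocity (hF.hasCompactSupport_transportC hs) _)
    fun z _ ht => hF.hasDerivWithinAt_transportC hψ z ht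

end CompactlySupported

/-! ### Weighted integration against η and its control by the potential. -/

section Pairing

variable {d' : ℕ} {F : Type} [NormedAddCommGroup F] [NormedSpace ℝ F]

theorem continuous_weight : Continuous (weight : E d' → ℝ) := contDiff_weight (n := 0).continuous

theorem integrable_weight_smul {μ : Measure (E d')} (h : Integrable weight μ) (φ : E d' →ᵇ F) :
    Integrable (fun a => weight a • φ a) μ :=
  (h.norm.const_mul ‖φ‖).mono' (continuous_weight.smul φ.continuous).aestronglyMeasurable
    (ae_of_all _ fun a => by
      rw [norm_smul, mul_comm]
      gcongr
      exact φ.norm_coe_le_norm a)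

/-- Weighted integration against a signed measure. -/
noncomputable def pairing (η : SignedMeasure (E d')) (h : Integrable weight η.variation)
    (F : Type) [NormedAddCommGroup F] [NormedSpace ℝ F] : (E d' →ᵇ F) →L[ℝ] F :=
  LinearMap.mkContinuous
    { toFun := fun φ => VectorMeasure.integral η (fun a => weight a • φ a)
        (ContinuousLinearMap.lsmul ℝ ℝ).flip
      map_add' := fun φ ψ => by
        simp only [BoundedContinuousFunction.coe_add, Pi.add_apply, smul_add]
        exact VectorMeasure.integral_fun_add (integrable_weight_smul h φ)
          (integrable_weight_smul h ψ)
      map_smul' := fun c φ => by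
        simp only [BoundedContinuousFunction.coe_smul, RingHom.id_apply, smul_comm _ c]
        exact VectorMeasure.integral_fun_smul η _ c _ } (∫ a, weight a ∂η.variation)
    fun φ => by
      change ‖VectorMeasure.integral η (fun a => weight a • φ a)
        (ContinuousLinearMap.lsmul ℝ ℝ).flip‖ ≤ _
      refine VectorMeasure.norm_integral_le_integral_norm.trans ?_
      have h1 : ‖(ContinuousLinearMap.lsmul ℝ ℝ (E := F)).flip‖ ≤ 1 := by
        rw [ContinuousLinearMap.opNorm_flip]
        exact ContinuousLinearMap.opNorm_lsmul_le
      refine (mul_le_of_le_one_left (integral_nonneg fun _ => norm_nonneg _) h1).trans ?_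
      rw [← integral_mul_const]
      refine integral_mono (integrable_weight_smul h φ).norm (h.mul_const _) fun a => ?_
      simp only
      rw [norm_smul, Real.norm_of_nonneg (weight_pos a).le]
      exact mul_le_mul_of_nonneg_left (φ.norm_coe_le_norm a) (weight_pos a).le

theorem pairing_apply (η : SignedMeasure (E d')) (h : Integrable weight η.variation)
    (φ : E d' →ᵇ F) : pairing η h F φ = VectorMeasure.integral η (fun a => weight a • φ a)
      (ContinuousLinearMap.lsmul ℝ ℝ).flip := rfl

theorem norm_pairing_le (η : SignedMeasure (E d')) (h : Integrable weight η.variation) :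
    ‖pairing η h F‖ ≤ ∫ a, weight a ∂η.variation :=
  LinearMap.mkContinuous_norm_le _ (integral_nonneg fun a => (weight_pos a).le) _

theorem driftSigned_eq_pairing {d₁ : ℕ} {b : E d₁ → E d' → E d₁} {g : E d₁ → (E d' →ᵇ E d₁)}
    (hbg : ∀ x a, b x a = weight a • g x a) (η : SignedMeasure (E d'))
    (h : Integrable weight η.variation) (x : E d₁) :
    driftSigned b η x = pairing η h (E d₁) (g x) := by
  rw [pairing_apply, driftSigned]
  congr 1
  exact funext fun a => hbg x a

/-- For a simple function the integral is a finite combination of the measurable functions t ↦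
η_t(s); dominated convergence passes to the limit for each t. -/
theorem measurable_pairing [CompleteSpace F] [SecondCountableTopology F] [MeasurableSpace F]
    [BorelSpace F] {J : Type} [MeasurableSpace J] {η : J → SignedMeasure (E d')}
    (hη : ∀ s, MeasurableSet s → Measurable fun t => η t s)
    (h : ∀ t, Integrable weight (η t).variation) (φ : E d' →ᵇ F) :
    Measurable fun t => pairing (η t) (h t) F φ := by
  have hf : Measurable fun a => weight a • φ a :=
    (continuous_weight.smul φ.continuous).measurable
  set s : ℕ → SimpleFunc (E d') F := SimpleFunc.approxOn _ hf univ 0 (mem_univ _) with hs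
  have hb : ∀ n a, ‖s n a‖ ≤ 2 * ‖weight a • φ a‖ := fun n a => by
    rw [two_mul]; exact SimpleFunc.norm_approxOn_zero_le hf (mem_univ _) a n
  have hi : ∀ t n, Integrable (s n) (η t).variation := fun t n =>
    ((integrable_weight_smul (h t) φ).norm.const_mul 2).mono'
      (s n).aestronglyMeasurable (ae_of_all _ (hb n))
  refine measurable_of_tendsto_metrizable (f := fun n t => VectorMeasure.integral (η t) (s n)
    (ContinuousLinearMap.lsmul ℝ ℝ).flip) (fun n => ?_) (tendsto_pi_nhds.2 fun t => ?_)
  · have e : ∀ t, VectorMeasure.integral (η t) (s n) (ContinuousLinearMap.lsmul ℝ ℝ).flip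
        = ∑ y ∈ (s n).range, (η t ((s n) ⁻¹' {y})) • y := fun t => by
      rw [VectorMeasure.integral, setToFun_simpleFunc _ _ (hi t n)]
      rfl
    simp only [e]
    exact Finset.measurable_sum _ fun y _ =>
      (hη _ ((s n).measurableSet_fiber y)).smul_const y
  · refine VectorMeasure.tendsto_integral_of_dominated_convergence
      (fun a => 2 * ‖weight a • φ a‖) (fun n => (s n).aestronglyMeasurable)
      ((integrable_weight_smul (h t) φ).norm.const_mul 2) (fun n => ae_of_all _ (hb n))
      (ae_of_all _ fun a => SimpleFunc.tendsto_approxOn hf (mem_univ _) (by simp))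

variable {t₀ T : ℝ} {p : ℝ → E d' → ℝ} {dom : E d' → ℝ}

/-- The normalising constant c is not an independent unknown: zero total mass makes it the mean of q
under p, so it obeys the same bound as q. No measurability of q is required, since it follows from
integrability in the only nontrivial case. -/
theorem GibbsFamily.exists_density_bound (hp : GibbsFamily t₀ T p dom) (h : t₀ ≤ T) {ε : ℝ}
    (hε : 0 < ε)
    {t : ℝ} (ht : t ∈ Icc t₀ T) {η : SignedMeasure (E d')} (hη0 : η univ = 0) {q : E d' → ℝ}
    {c D : ℝ} (hη : η = volume.withDensityᵥ fun a => -(p t a / ε) * (q a - c)) (hD : 0 ≤ D)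
    (hq : ∀ a, |q a| ≤ D * weight a) :
    ∃ f : E d' → ℝ, Integrable f ∧ η = volume.withDensityᵥ f ∧
      ∀ a, |f a| ≤ (1 + ∫ a, dom a) / ε * D * (p t a * weight a) := by
  have hdom : 0 ≤ ∫ a, dom a := integral_nonneg (hp.dom_nonneg h)
  have hbound : ∀ a, 0 ≤ (1 + ∫ a, dom a) / ε * D * (p t a * weight a) := fun a => by
    have := (hp.pos t ht a).le
    have := (weight_pos a).le
    have : 0 ≤ 1 + ∫ a, dom a := add_nonneg zero_le_one hdom
    positivity
  by_cases hi : Integrable fun a => -(p t a / ε) * (q a - c)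
  · refine ⟨_, hi, hη, fun a => ?_⟩
    have hpi : Integrable (p t) := by
      by_contra hne
      have := hp.integral_eq_one t ht
      rw [integral_undef hne] at this
      exact zero_ne_one this
    have hpq : Integrable fun a => p t a * q a := by
      refine ((hi.const_mul (-ε)).add (hpi.const_mul c)).congr (ae_of_all _ fun a => ?_)
      simp only [Pi.add_apply]
      field_simp
      ring
    have hzero : ∫ a, -(p t a / ε) * (q a - c) = 0 := by
      rw [hη, withDensityᵥ_apply hi MeasurableSet.univ, Measure.restrict_univ] at hη0
      exact hη0
    -- This uses that p has integral one.
    have hc : c = ∫ a, p t a * q a := by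
      have e : (fun a => -(p t a / ε) * (q a - c))
          = fun a => -ε⁻¹ * (p t a * q a - c * p t a) := by
        funext a; field_simp
      rw [e, integral_const_mul, integral_sub hpq (hpi.const_mul c), integral_const_mul,
        hp.integral_eq_one t ht] at hzero
      have := (mul_eq_zero.1 hzero).resolve_left (neg_ne_zero.2 (inv_ne_zero hε.ne'))
      linarith
    have hcb : |c| ≤ D * ∫ a, dom a := by
      rw [hc, ← integral_const_mul]
      refine norm_integral_le_of_norm_le (f := fun a => p t a * q a)
        (hp.integrable_dom.const_mul D) (ae_of_all _ fun a => ?_)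
      have h1 := (hp.pos t ht a).le
      rw [norm_mul, Real.norm_of_nonneg h1, Real.norm_eq_abs]
      have h2 := hp.le_dom t ht a
      have h3 := one_le_weight a
      calc p t a * |q a| ≤ p t a * (D * weight a) := by gcongr; exact hq a
        _ = D * (p t a * weight a) := by ring
        _ ≤ D * dom a := by
            gcongr
            refine le_trans ?_ h2
            gcongr
            exact le_self_pow₀ h3 two_ne_zero
    have h1 := hp.pos t ht a
    rw [abs_mul, abs_neg, abs_of_pos (by positivity)]
    have h2 : |q a - c| ≤ (1 + ∫ a, dom a) * D * weight a := by
      have h3 := one_le_weight a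
      have h4 : 0 ≤ D * ∫ a, dom a := by positivity
      calc |q a - c| ≤ |q a| + |c| := abs_sub _ _
        _ ≤ D * weight a + (D * ∫ a, dom a) * weight a :=
            add_le_add (hq a) (hcb.trans (le_mul_of_one_le_right h4 h3))
        _ = _ := by ring
    calc p t a / ε * |q a - c| ≤ p t a / ε * ((1 + ∫ a, dom a) * D * weight a) := by gcongr
      _ = _ := by ring
  -- For a nonintegrable density `withDensityᵥ` is zero by convention, so the zero density
  -- represents η.
  · refine ⟨0, integrable_zero _ _ _, ?_, fun a => by simpa using hbound a⟩
    rw [hη, Measure.withDensityᵥ, dif_neg hi, withDensityᵥ_zero]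

/-- The size of η is linear in the size D of its potential. One weight comes from the density bound
and one from the integrand, matching the squared weight in the domination. -/
theorem GibbsFamily.integrable_weight_variation (hp : GibbsFamily t₀ T p dom) (h : t₀ ≤ T) {ε : ℝ}
    (hε : 0 < ε) {t : ℝ} (ht : t ∈ Icc t₀ T) {η : SignedMeasure (E d')} (hη0 : η univ = 0)
    {q : E d' → ℝ} {c D : ℝ} (hη : η = volume.withDensityᵥ fun a => -(p t a / ε) * (q a - c))
    (hD : 0 ≤ D) (hq : ∀ a, |q a| ≤ D * weight a) :
    Integrable weight η.variation ∧
      ∫ a, weight a ∂η.variation ≤ (1 + ∫ a, dom a) / ε * (∫ a, dom a) * D := by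
  obtain ⟨f, hf, hηf, hfb⟩ := hp.exists_density_bound h hε ht hη0 hη hD hq
  have hdom : 0 ≤ ∫ a, dom a := integral_nonneg (hp.dom_nonneg h)
  have hK : 0 ≤ (1 + ∫ a, dom a) / ε * D := by
    have : 0 ≤ 1 + ∫ a, dom a := add_nonneg zero_le_one hdom
    positivity
  have hle : ∀ a, |f a| * weight a ≤ (1 + ∫ a, dom a) / ε * D * dom a := fun a => by
    have := (weight_pos a).le
    calc |f a| * weight a ≤ (1 + ∫ a, dom a) / ε * D * (p t a * weight a) * weight a := by
          gcongr; exact hfb a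
      _ = (1 + ∫ a, dom a) / ε * D * (p t a * weight a ^ 2) := by ring
      _ ≤ _ := by gcongr; exact hp.le_dom t ht a
  have hi : Integrable fun a => |f a| * weight a := by
    refine (hp.integrable_dom.const_mul ((1 + ∫ a, dom a) / ε * D)).mono'
      (hf.aestronglyMeasurable.norm.mul continuous_weight.aestronglyMeasurable)
      (ae_of_all _ fun a => ?_)
    rw [Real.norm_of_nonneg (mul_nonneg (abs_nonneg _) (weight_pos a).le)]
    exact hle a
  have hm : AEMeasurable (fun a => ‖f a‖ₑ) volume := hf.aestronglyMeasurable.enorm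
  have htop : ∀ᵐ a ∂(volume : Measure (E d')), ‖f a‖ₑ < ⊤ := ae_of_all _ fun a => enorm_lt_top
  rw [hηf, Measure.variation_withDensityᵥ hf]
  constructor
  · rw [integrable_withDensity_iff_integrable_smul₀' hm htop]
    simpa using hi
  · rw [integral_withDensity_eq_integral_toReal_smul₀ hm htop]
    simp only [toReal_enorm, smul_eq_mul, Real.norm_eq_abs]
    refine (integral_mono hi (hp.integrable_dom.const_mul _) hle).trans_eq ?_
    rw [integral_const_mul]
    ring

theorem GibbsFamily.eq_zero_of_potential_eq_zero (hp : GibbsFamily t₀ T p dom) (h : t₀ ≤ T) {ε : ℝ}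
    (hε : 0 < ε) {t : ℝ} (ht : t ∈ Icc t₀ T) {η : SignedMeasure (E d')} (hη0 : η univ = 0)
    {q : E d' → ℝ} {c : ℝ} (hη : η = volume.withDensityᵥ fun a => -(p t a / ε) * (q a - c))
    (hq : ∀ a, q a = 0) : η = 0 := by
  obtain ⟨f, -, hηf, hfb⟩ := hp.exists_density_bound h hε ht hη0 hη le_rfl
    (fun a => by simp [hq a])
  have : f = 0 := funext fun a => by simpa using hfb a
  rw [hηf, this, withDensityᵥ_zero]

/-- If the perturbation vanishes then so does its continuous potential, up to a constant. -/
theorem GibbsFamily.potential_eq_of_eq_zero (hp : GibbsFamily t₀ T p dom) {ε : ℝ}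
    (hε : 0 < ε) {t : ℝ} (ht : t ∈ Icc t₀ T) {q : E d' → ℝ} (hqc : Continuous q) {c D : ℝ}
    (hη : (0 : SignedMeasure (E d')) = volume.withDensityᵥ fun a => -(p t a / ε) * (q a - c))
    (hq : ∀ a, |q a| ≤ D * weight a) (a : E d') : q a = c := by
  have hpc := hp.cont t ht
  have hcont : Continuous fun a => -(p t a / ε) * (q a - c) := by fun_prop
  have hi : Integrable fun a => -(p t a / ε) * (q a - c) := by
    refine (hp.integrable_dom.const_mul ((D + |c|) / ε)).mono' hcont.aestronglyMeasurable
      (ae_of_all _ fun a => ?_)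
    have h1 := hp.pos t ht a
    have h3 := one_le_weight a
    have h4 : 0 ≤ D := by
      have := (abs_nonneg _).trans (hq a)
      exact nonneg_of_mul_nonneg_left this (weight_pos a)
    rw [norm_mul, norm_neg, Real.norm_of_nonneg (by positivity), Real.norm_eq_abs]
    have h2 : |q a - c| ≤ (D + |c|) * weight a := by
      calc |q a - c| ≤ |q a| + |c| := abs_sub _ _
        _ ≤ D * weight a + |c| * weight a :=
            add_le_add (hq a) (le_mul_of_one_le_right (abs_nonneg c) h3)
        _ = _ := by ring
    calc p t a / ε * |q a - c| ≤ p t a / ε * ((D + |c|) * weight a) := by gcongr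
      _ = (D + |c|) / ε * (p t a * weight a) := by ring
      _ ≤ (D + |c|) / ε * dom a := by
          gcongr
          refine le_trans ?_ (hp.le_dom t ht a)
          gcongr
          exact le_self_pow₀ h3 two_ne_zero
  rw [← withDensityᵥ_zero (μ := (volume : Measure (E d')))] at hη
  have h0 := (integrable_zero _ _ _).ae_eq_of_withDensityᵥ_eq hi hη
  -- Continuity turns almost everywhere vanishing of the density into vanishing everywhere, in
  -- particular at a = 0, where it is used later.
  have h5 := (Continuous.ae_eq_iff_eq volume continuous_const hcont).1 h0
  have h6 := congrFun h5 a
  have h7 : -(p t a / ε) ≠ 0 := neg_ne_zero.2 (div_pos (hp.pos t ht a) hε).ne'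
  have h8 : -(p t a / ε) * (q a - c) = 0 := h6.symm
  linarith [(mul_eq_zero.1 h8).resolve_left h7]

end Pairing

/-! ### Functions with locally Lipschitz derivatives, and their composition with the flow. -/

section QuadraticGrowth

variable {d₁ d₂ : ℕ}

/-- Functions with a linearly growing, locally Lipschitz derivative. -/
structure QuadGrowth (W : Phase d₁ d₂ → ℝ) (A : ℝ) : Prop where
  smooth : ContDiff ℝ 1 W
  bound : ∀ z, ‖fderiv ℝ W z‖ ≤ A * gw 1 z
  lip : ∀ z, ∀ᶠ z' in 𝓝 z, ‖fderiv ℝ W z' - fderiv ℝ W z‖ ≤ A * gw 1 z * ‖z' - z‖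

theorem QuadGrowth.nonneg {W : Phase d₁ d₂ → ℝ} {A : ℝ} (hW : QuadGrowth W A) : 0 ≤ A :=
  nonneg_of_mul_nonneg_left ((norm_nonneg _).trans (hW.bound 0)) (gw_pos 1 0)

theorem eventually_norm_sub_le {X Y : Type*} [NormedAddCommGroup X] [NormedSpace ℝ X]
    [NormedAddCommGroup Y] [NormedSpace ℝ Y] {f : X → Y} {x : X} (hf : DifferentiableAt ℝ f x)
    {C : ℝ} (hC : ‖fderiv ℝ f x‖ ≤ C) : ∀ᶠ y in 𝓝 x, ‖f y - f x‖ ≤ (C + 1) * ‖y - x‖ := by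
  filter_upwards [(hasFDerivAt_iff_isLittleO.1 hf.hasFDerivAt).def one_pos] with y hy
  have h1 : ‖fderiv ℝ f x (y - x)‖ ≤ C * ‖y - x‖ :=
    (ContinuousLinearMap.le_opNorm _ _).trans (by gcongr)
  calc ‖f y - f x‖ = ‖(f y - f x - fderiv ℝ f x (y - x)) + fderiv ℝ f x (y - x)‖ := by
        congr 1; abel
    _ ≤ 1 * ‖y - x‖ + C * ‖y - x‖ := (norm_add_le _ _).trans (add_le_add hy h1)
    _ = _ := by ring

theorem exists_quadGrowth {L : Phase d₁ d₂ → ℝ} (hL : ContDiff ℝ 3 L)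
    (hg : growthNorm21 2 L < ⊤) : ∃ A, QuadGrowth L A := by
  lift growthNorm21 2 L to ℝ≥0 using hg.ne with C hC
  have h1 : growthNorm 2 1 (fderiv ℝ L) ≤ C := le_add_self.trans hC.ge
  have hd : Differentiable ℝ (fderiv ℝ L) :=
    (hL.fderiv_right (m := 2) (by norm_num)).differentiable (by simp)
  refine ⟨C + 1, hL.of_le (by norm_num), fun z => ?_, fun z => ?_⟩
  · have h2 := norm_le_of_growthNorm_le h1 (Nat.zero_le 2) z
    rw [norm_iteratedFDeriv_zero] at h2
    exact h2.trans (by have := (gw_pos 1 z).le; gcongr; linarith)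
  · have h2 := norm_fderiv_le_of_growthNorm one_le_two h1 z
    filter_upwards [eventually_norm_sub_le (hd z) h2] with z' hz'
    refine hz'.trans ?_
    have := one_le_gw 1 z
    gcongr
    linarith

/-- A diffeomorphism which is Lipschitz together with its derivative and a bounded perturbation of
the identity. -/
structure TameMap (M : Phase d₁ d₂ → Phase d₁ d₂) (c : ℝ≥0) : Prop where
  smooth : ContDiff ℝ 3 M
  growth : ∀ z, gw 1 (M z) ≤ c * gw 1 z
  lip : LipschitzWith c M
  lip_fderiv : ∀ z z', ‖fderiv ℝ M z - fderiv ℝ M z'‖ ≤ c * ‖z - z'‖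

theorem TameMap.norm_fderiv_le {M : Phase d₁ d₂ → Phase d₁ d₂} {c : ℝ≥0} (hM : TameMap M c)
    (z : Phase d₁ d₂) : ‖fderiv ℝ M z‖ ≤ c := norm_fderiv_le_of_lipschitz ℝ hM.lip

theorem TameMap.differentiable {M : Phase d₁ d₂ → Phase d₁ d₂} {c : ℝ≥0} (hM : TameMap M c) :
    Differentiable ℝ M := hM.smooth.differentiable (by simp)

theorem fderiv_comp_tame {W : Phase d₁ d₂ → ℝ} (hW : Differentiable ℝ W)
    {M : Phase d₁ d₂ → Phase d₁ d₂} (hM : Differentiable ℝ M) (z : Phase d₁ d₂) :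
    fderiv ℝ (fun z => W (M z)) z = (fderiv ℝ W (M z)).comp (fderiv ℝ M z) :=
  ((hW (M z)).hasFDerivAt.comp z (hM z).hasFDerivAt).fderiv

/-- Chain rule, varying separately DW and DM; the class only records what survives composition with
the flow without computing second derivatives. -/
theorem QuadGrowth.comp {W : Phase d₁ d₂ → ℝ} {A : ℝ} (hW : QuadGrowth W A)
    {M : Phase d₁ d₂ → Phase d₁ d₂} {c : ℝ≥0} (hM : TameMap M c) :
    QuadGrowth (fun z => W (M z)) (A * c * c * (c + 1) + A * c * c) := by
  have hA := hW.nonneg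
  have hWd : Differentiable ℝ W := hW.smooth.differentiable (by simp)
  have hb : ∀ z, ‖fderiv ℝ W (M z)‖ ≤ A * c * gw 1 z := fun z => by
    refine (hW.bound _).trans ?_
    rw [mul_assoc]
    gcongr
    exact hM.growth z
  refine ⟨hW.smooth.comp (hM.smooth.of_le (by norm_num)), fun z => ?_, fun z => ?_⟩
  · rw [fderiv_comp_tame hWd hM.differentiable]
    refine (ContinuousLinearMap.opNorm_comp_le _ _).trans ?_
    have h2 := (gw_pos 1 z).le
    calc _ ≤ (A * c * gw 1 z) * c :=
          mul_le_mul (hb z) (hM.norm_fderiv_le z) (norm_nonneg _) (by positivity)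
      _ = (A * c * c) * gw 1 z := by ring
      _ ≤ _ := by
          gcongr
          exact le_add_of_nonneg_left (by positivity)
  · filter_upwards [hM.smooth.continuous.continuousAt.eventually (hW.lip (M z))] with z' hz'
    rw [fderiv_comp_tame hWd hM.differentiable, fderiv_comp_tame hWd hM.differentiable]
    have e : (fderiv ℝ W (M z')).comp (fderiv ℝ M z') - (fderiv ℝ W (M z)).comp (fderiv ℝ M z)
        = (fderiv ℝ W (M z') - fderiv ℝ W (M z)).comp (fderiv ℝ M z')
          + (fderiv ℝ W (M z)).comp (fderiv ℝ M z' - fderiv ℝ M z) := by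
      rw [ContinuousLinearMap.sub_comp, ContinuousLinearMap.comp_sub]
      abel
    rw [e]
    have h2 := (gw_pos 1 z).le
    have h3 : ‖fderiv ℝ W (M z') - fderiv ℝ W (M z)‖ ≤ A * c * gw 1 z * (c * ‖z' - z‖) := by
      refine hz'.trans ?_
      have h4 := hM.growth z
      have h5 := hM.lip.norm_sub_le z' z
      have h6 := (gw_pos 1 (M z)).le
      calc A * gw 1 (M z) * ‖M z' - M z‖ ≤ A * (c * gw 1 z) * (c * ‖z' - z‖) := by gcongr
        _ = _ := by ring
    calc _ ≤ ‖fderiv ℝ W (M z') - fderiv ℝ W (M z)‖ * ‖fderiv ℝ M z'‖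
          + ‖fderiv ℝ W (M z)‖ * ‖fderiv ℝ M z' - fderiv ℝ M z‖ :=
          (norm_add_le _ _).trans (add_le_add (ContinuousLinearMap.opNorm_comp_le _ _)
            (ContinuousLinearMap.opNorm_comp_le _ _))
      _ ≤ (A * c * gw 1 z * (c * ‖z' - z‖)) * c + (A * c * gw 1 z) * (c * ‖z' - z‖) := by
          gcongr
          · exact hM.norm_fderiv_le z'
          · exact hb z
          · exact hM.lip_fderiv z' z
      _ = (A * c * c * c + A * c * c) * gw 1 z * ‖z' - z‖ := by ring
      _ ≤ _ := by
          gcongr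
          linarith

/-- Bounded Lipschitz vector fields. -/
structure BoundedLip (w : E d₁ → E d₁) (S : ℝ) : Prop where
  bound : ∀ x, ‖w x‖ ≤ S
  lip : ∀ x x', ‖w x - w x'‖ ≤ S * ‖x - x'‖

theorem BoundedLip.nonneg {w : E d₁ → E d₁} {S : ℝ} (hw : BoundedLip w S) : 0 ≤ S :=
  (norm_nonneg _).trans (hw.bound 0)

theorem BoundedLip.continuous {w : E d₁ → E d₁} {S : ℝ} (hw : BoundedLip w S) : Continuous w :=
  (LipschitzWith.of_dist_le_mul (K := ⟨S, hw.nonneg⟩) fun x x' => by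
    rw [dist_eq_norm, dist_eq_norm]; exact hw.lip x x').continuous

/-- Only a Lipschitz estimate at the point is proved, varying DW and w in turn, which accounts for
the 2. Differentiability is not needed for the bound, so w may be merely Lipschitz. -/
theorem QuadGrowth.norm_fderiv_directional_le {W : Phase d₁ d₂ → ℝ} {A S : ℝ}
    (hW : QuadGrowth W A) {w : E d₁ → E d₁} (hw : BoundedLip w S) (z : Phase d₁ d₂) :
    ‖fderiv ℝ (fun z : Phase d₁ d₂ => fderiv ℝ W z (w z.1, 0)) z‖ ≤ 2 * A * S * gw 1 z := by
  have hA := hW.nonneg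
  have hS := hw.nonneg
  have h2 := (gw_pos 1 z).le
  refine norm_fderiv_le_of_lip' ℝ (by positivity) ?_
  filter_upwards [hW.lip z] with z' hz'
  have e : fderiv ℝ W z' (w z'.1, 0) - fderiv ℝ W z (w z.1, 0)
      = (fderiv ℝ W z' - fderiv ℝ W z) (w z'.1, 0) + fderiv ℝ W z (w z'.1 - w z.1, 0) := by
    have : ((w z'.1 - w z.1, 0) : Phase d₁ d₂) = (w z'.1, 0) - (w z.1, 0) := by simp
    rw [this, map_sub, sub_apply]
    abel
  rw [e]
  have h3 : ‖(fderiv ℝ W z' - fderiv ℝ W z) (w z'.1, 0)‖ ≤ (A * gw 1 z * ‖z' - z‖) * S := by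
    refine (ContinuousLinearMap.le_opNorm _ _).trans ?_
    rw [norm_prodMk_zero]
    gcongr
    exact hw.bound _
  have h4 : ‖fderiv ℝ W z (w z'.1 - w z.1, 0)‖ ≤ (A * gw 1 z) * (S * ‖z' - z‖) := by
    refine (ContinuousLinearMap.le_opNorm _ _).trans ?_
    rw [norm_prodMk_zero]
    gcongr
    · exact hW.bound z
    · refine (hw.lip _ _).trans ?_
      gcongr
      exact norm_fst_le (z' - z)
  calc _ ≤ (A * gw 1 z * ‖z' - z‖) * S + (A * gw 1 z) * (S * ‖z' - z‖) :=
        (norm_add_le _ _).trans (add_le_add h3 h4)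
    _ = _ := by ring

theorem gw_one_le_of_norm_sub_le {x x' : E d₁} {y : E d₂} {C : ℝ≥0} (hx : ‖x' - x‖ ≤ C) :
    gw 1 ((x', y) : Phase d₁ d₂) ≤ (1 + C) * gw 1 ((x, y) : Phase d₁ d₂) := by
  have h1 : ‖x'‖ ≤ ‖x‖ + C := by
    calc ‖x'‖ = ‖x + (x' - x)‖ := by congr 1; abel
      _ ≤ _ := (norm_add_le _ _).trans (by gcongr)
  simp only [gw, pow_one]
  nlinarith [norm_nonneg x, norm_nonneg y, C.2]

theorem gw_three_le_of_norm_sub_le {x x' : E d₁} {y : E d₂} {C : ℝ≥0} (hx : ‖x' - x‖ ≤ C) :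
    gw 3 ((x', y) : Phase d₁ d₂) ≤ (4 + 4 * C ^ 3) * gw 3 ((x, y) : Phase d₁ d₂) := by
  have h1 : ‖x'‖ ≤ ‖x‖ + C := by
    calc ‖x'‖ = ‖x + (x' - x)‖ := by congr 1; abel
      _ ≤ _ := (norm_add_le _ _).trans (by gcongr)
  have hC : (0 : ℝ) ≤ C := C.2
  have h2 : ‖x'‖ ^ 3 ≤ 4 * ‖x‖ ^ 3 + 4 * (C : ℝ) ^ 3 := by
    refine (pow_le_pow_left₀ (norm_nonneg _) h1 3).trans ?_
    have := add_pow_le (norm_nonneg x) hC 3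
    norm_num at this
    linarith
  have h3 : (0 : ℝ) ≤ ‖x‖ ^ 3 := by positivity
  have h4 : (0 : ℝ) ≤ ‖y‖ ^ 3 := by positivity
  have h5 : (0 : ℝ) ≤ (C : ℝ) ^ 3 := by positivity
  simp only [gw]
  nlinarith [mul_nonneg h5 h3, mul_nonneg h5 h4]

variable {t₀ T : ℝ} {h : t₀ ≤ T} {V : C(E d₁, C(Icc t₀ T, E d₁))} {Ψ Θ : E d₁ → C(Icc t₀ T, E d₁)}
  {C : ℝ≥0}

theorem fderiv_liftC {Ψ : E d₁ → C(Icc t₀ T, E d₁)} {t : Icc t₀ T}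
    (hd : Differentiable ℝ fun x => Ψ x t) (z k : Phase d₁ d₂) :
    fderiv ℝ (fun z : Phase d₁ d₂ => liftC Ψ z t) z k
      = (fderiv ℝ (fun x => Ψ x t) z.1 k.1, k.2) := by
  have h1 : HasFDerivAt (fun z : Phase d₁ d₂ => Ψ z.1 t)
      ((fderiv ℝ (fun x => Ψ x t) z.1).comp (ContinuousLinearMap.fst ℝ (E d₁) (E d₂))) z :=
    (hd z.1).hasFDerivAt.comp z hasFDerivAt_fst
  have h2 := h1.prodMk (hasFDerivAt_snd (𝕜 := ℝ) (p := z))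
  rw [HasFDerivAt.fderiv (f := fun z : Phase d₁ d₂ => liftC Ψ z t) h2]
  rfl

theorem tameMap_liftC {Ψ : E d₁ → C(Icc t₀ T, E d₁)} {t : Icc t₀ T}
    (hs : ContDiff ℝ 3 Ψ) (hl : LipschitzWith C fun x => Ψ x t)
    (hl' : LipschitzWith C (fderiv ℝ fun x => Ψ x t)) (hn : ∀ x, ‖Ψ x t - x‖ ≤ C) :
    TameMap (fun z : Phase d₁ d₂ => liftC Ψ z t) (1 + C) where
  smooth := contDiff_eval (contDiff_liftC hs) t
  growth z := by
    refine (gw_one_le_of_norm_sub_le (hn z.1)).trans_eq ?_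
    simp
  lip := (lipschitz_liftC hl).weaken (max_le le_add_self le_self_add)
  lip_fderiv z z' := by
    have hd : Differentiable ℝ fun x => Ψ x t := (contDiff_eval hs t).differentiable (by simp)
    refine ContinuousLinearMap.opNorm_le_bound _ (by positivity) fun k => ?_
    have e : (fderiv ℝ (fun z : Phase d₁ d₂ => liftC Ψ z t) z
        - fderiv ℝ (fun z : Phase d₁ d₂ => liftC Ψ z t) z') k
        = ((fderiv ℝ (fun x => Ψ x t) z.1 - fderiv ℝ (fun x => Ψ x t) z'.1) k.1, 0) := by
      rw [sub_apply, fderiv_liftC hd, fderiv_liftC hd]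
      simp
    rw [e, norm_prodMk_zero]
    refine (ContinuousLinearMap.le_opNorm _ _).trans ?_
    refine mul_le_mul ?_ (norm_fst_le k) (norm_nonneg _) (by positivity)
    refine (hl'.norm_sub_le z.1 z'.1).trans ?_
    have := norm_fst_le (z - z')
    push_cast
    gcongr
    · linarith
    · exact this

theorem IsFlow.tameMap (hF : IsFlow h V Ψ Θ C) (t : Icc t₀ T) :
    TameMap (fun z : Phase d₁ d₂ => liftC Ψ z t) (1 + C) :=
  tameMap_liftC hF.smooth (hF.lip t) (hF.lip_fderiv t) (hF.norm_sub_le t)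

theorem IsFlow.norm_inv_sub_le (hF : IsFlow h V Ψ Θ C) (t : Icc t₀ T) (x : E d₁) :
    ‖Θ x t - x‖ ≤ C := by
  have h3 := hF.norm_sub_le t (Θ x t)
  rwa [hF.right_inv, norm_sub_rev] at h3

theorem IsFlow.tameMap_inv (hF : IsFlow h V Ψ Θ C) (t : Icc t₀ T) :
    TameMap (fun z : Phase d₁ d₂ => liftC Θ z t) (1 + C) :=
  tameMap_liftC hF.smooth_inv (hF.lip_inv t) (hF.lip_fderiv_inv t) (hF.norm_inv_sub_le t)

end QuadraticGrowth

/-! ### Vector fields pulled back to the initial time. -/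

section Pull

variable {d₁ d₂ d' : ℕ} {t₀ T : ℝ} {h : t₀ ≤ T} {V : C(E d₁, C(Icc t₀ T, E d₁))}
  {Ψ Θ : E d₁ → C(Icc t₀ T, E d₁)} {C B : ℝ≥0} {g : E d₁ → (E d' →ᵇ E d₁)}

/-- The vector field `x ↦ μ (g x)` at time `t`, pulled back to the initial time by the flow. -/
noncomputable def pull (Ψ Θ : E d₁ → C(Icc t₀ T, E d₁)) (g : E d₁ → (E d' →ᵇ E d₁)) (t : Icc t₀ T)
    (μ : (E d' →ᵇ E d₁) →L[ℝ] E d₁) (x : E d₁) : E d₁ :=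
  fderiv ℝ (fun y => Θ y t) (Ψ x t) (μ (g (Ψ x t)))

/-- The constant is linear in ‖μ‖, which is what lets the final estimate close as a linear
inequality. The Lipschitz part uses the Lipschitz bound on DΘ_t. -/
theorem IsFlow.boundedLip_pull (hF : IsFlow h V Ψ Θ C) (hg : SmoothFamily g B) (t : Icc t₀ T)
    (μ : (E d' →ᵇ E d₁) →L[ℝ] E d₁) :
    BoundedLip (pull Ψ Θ g t μ) ((C * B + 2 * C * C * B) * ‖μ‖) := by
  have hΘ : ∀ x, ‖fderiv ℝ (fun y => Θ y t) x‖ ≤ C := fun x =>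
    norm_fderiv_le_of_lipschitz ℝ (hF.lip_inv t)
  have hμ : ∀ x, ‖μ (g x)‖ ≤ ‖μ‖ * B := fun x =>
    (μ.le_opNorm _).trans (by gcongr; exact hg.bdd x)
  have hμl : ∀ x x', ‖μ (g x) - μ (g x')‖ ≤ ‖μ‖ * (B * ‖x - x'‖) := fun x x' => by
    rw [← map_sub]
    exact (μ.le_opNorm _).trans (by gcongr; exact hg.lip.norm_sub_le x x')
  constructor
  · intro x
    refine (ContinuousLinearMap.le_opNorm _ _).trans ?_
    calc _ ≤ C * (‖μ‖ * B) := mul_le_mul (hΘ _) (hμ _) (norm_nonneg _) C.2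
      _ = (C * B) * ‖μ‖ := by ring
      _ ≤ _ := by
          gcongr
          exact le_add_of_nonneg_right (by positivity)
  · intro x x'
    have e : pull Ψ Θ g t μ x - pull Ψ Θ g t μ x'
        = (fderiv ℝ (fun y => Θ y t) (Ψ x t) - fderiv ℝ (fun y => Θ y t) (Ψ x' t))
            (μ (g (Ψ x t)))
          + fderiv ℝ (fun y => Θ y t) (Ψ x' t) (μ (g (Ψ x t)) - μ (g (Ψ x' t))) := by
      rw [pull, pull, sub_apply, map_sub]
      abel
    rw [e]
    have hΨ := (hF.lip t).norm_sub_le x x'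
    have h1 : ‖(fderiv ℝ (fun y => Θ y t) (Ψ x t) - fderiv ℝ (fun y => Θ y t) (Ψ x' t))
        (μ (g (Ψ x t)))‖ ≤ (C * (C * ‖x - x'‖)) * (‖μ‖ * B) := by
      refine (ContinuousLinearMap.le_opNorm _ _).trans ?_
      refine mul_le_mul ?_ (hμ _) (norm_nonneg _) (by positivity)
      refine ((hF.lip_fderiv_inv t).norm_sub_le _ _).trans ?_
      gcongr
    have h2 : ‖fderiv ℝ (fun y => Θ y t) (Ψ x' t) (μ (g (Ψ x t)) - μ (g (Ψ x' t)))‖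
        ≤ C * (‖μ‖ * (B * (C * ‖x - x'‖))) := by
      refine (ContinuousLinearMap.le_opNorm _ _).trans ?_
      refine mul_le_mul (hΘ _) ((hμl _ _).trans ?_) (norm_nonneg _) C.2
      gcongr
    calc _ ≤ (C * (C * ‖x - x'‖)) * (‖μ‖ * B) + C * (‖μ‖ * (B * (C * ‖x - x'‖))) :=
          (norm_add_le _ _).trans (add_le_add h1 h2)
      _ = (2 * C * C * B) * ‖μ‖ * ‖x - x'‖ := by ring
      _ ≤ _ := by
          gcongr
          exact le_add_of_nonneg_left (by positivity)

theorem IsFlow.fderiv_pull (hF : IsFlow h V Ψ Θ C) (t : Icc t₀ T)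
    (μ : (E d' →ᵇ E d₁) →L[ℝ] E d₁) (x : E d₁) :
    fderiv ℝ (fun y => Ψ y t) x (pull Ψ Θ g t μ x) = μ (g (Ψ x t)) := by
  have hΨ : Differentiable ℝ fun y => Ψ y t := (contDiff_eval hF.smooth t).differentiable (by simp)
  have hΘ : Differentiable ℝ fun y => Θ y t :=
    (contDiff_eval hF.smooth_inv t).differentiable (by simp)
  have h1 : HasFDerivAt (fun y => Ψ (Θ y t) t) ((fderiv ℝ (fun y => Ψ y t) (Θ (Ψ x t) t)).comp
      (fderiv ℝ (fun y => Θ y t) (Ψ x t))) (Ψ x t) :=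
    HasFDerivAt.comp (g := fun y => Ψ y t) _ (hΨ _).hasFDerivAt (hΘ _).hasFDerivAt
  have h2 : (fun y => Ψ (Θ y t) t) = id := funext fun y => hF.right_inv t y
  rw [h2, hF.left_inv] at h1
  have h3 := h1.unique (hasFDerivAt_id _)
  exact DFunLike.congr_fun h3 (μ (g (Ψ x t)))

/-- The reason for the definition of `pull`: derivatives at time t along μ(g) become derivatives of
the pulled-back function along a field at time t₀, because DΨ_t and DΘ_t are inverse to each other.
-/
theorem IsFlow.fderiv_comp_lift_pull (hF : IsFlow h V Ψ Θ C) (t : Icc t₀ T)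
    (μ : (E d' →ᵇ E d₁) →L[ℝ] E d₁) {f : Phase d₁ d₂ → ℝ} (hf : Differentiable ℝ f)
    (z : Phase d₁ d₂) :
    fderiv ℝ (fun z => f (liftC Ψ z t)) z (pull Ψ Θ g t μ z.1, 0)
      = fderiv ℝ f (liftC Ψ z t) (μ (g (Ψ z.1 t)), 0) := by
  rw [fderiv_comp_tame hf (hF.tameMap t).differentiable, ContinuousLinearMap.comp_apply,
    fderiv_liftC ((contDiff_eval hF.smooth t).differentiable (by simp)), hF.fderiv_pull]

end Pull

/-! ### The displacement and Duhamel's formula for v. -/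

section Displacement

variable {d₁ d₂ d' : ℕ} {t₀ T : ℝ} {h : t₀ ≤ T} {V : C(E d₁, C(Icc t₀ T, E d₁))}
  {Ψ Θ : E d₁ → C(Icc t₀ T, E d₁)} {C B M : ℝ≥0} {g : E d₁ → (E d' →ᵇ E d₁)}

/-- A measurable bounded family of linear functionals on bounded continuous functions. -/
structure PairingFamily (μ : ℝ → (E d' →ᵇ E d₁) →L[ℝ] E d₁) (M : ℝ≥0) : Prop where
  meas : ∀ φ, Measurable fun r => μ r φ
  bdd : ∀ r, ‖μ r‖ ≤ M

variable {μ : ℝ → (E d' →ᵇ E d₁) →L[ℝ] E d₁}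

theorem PairingFamily.measurable_apply (hμ : PairingFamily μ M) {φ : ℝ → (E d' →ᵇ E d₁)}
    (hφ : Continuous φ) : Measurable fun r => μ r (φ r) := by
  have h1 := measurable_uncurry_of_continuous_of_measurable (u := fun s r => μ r (φ s))
    (fun r => (μ r).continuous.comp hφ) fun s => hμ.meas (φ s)
  exact h1.comp (measurable_id.prodMk measurable_id)

theorem IsFlow.measurable_pull (hF : IsFlow h V Ψ Θ C) (hg : SmoothFamily g B)
    (hμ : PairingFamily μ M) (x : E d₁) :
    Measurable fun r => pull Ψ Θ g (projIcc t₀ T h r) (μ r) x := by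
  have c0 : Continuous fun r : ℝ => Ψ x (projIcc t₀ T h r) :=
    (Ψ x).continuous.comp (continuous_projIcc (h := h))
  have h1 : Continuous fun r : ℝ =>
      fderiv ℝ (fun y => Θ y (projIcc t₀ T h r)) (Ψ x (projIcc t₀ T h r)) :=
    (continuous_fderiv_eval (hF.smooth_inv.of_le (by norm_num))).comp
      ((continuous_projIcc (h := h)).prodMk c0)
  have h2 : Measurable fun r => μ r (g (Ψ x (projIcc t₀ T h r))) :=
    hμ.measurable_apply (hg.smooth.continuous.comp c0)
  have h3 : Continuous fun q : (E d₁ →L[ℝ] E d₁) × E d₁ => q.1 q.2 :=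
    isBoundedBilinearMap_apply.continuous
  exact h3.measurable.comp (h1.measurable.prodMk h2)

theorem IsFlow.measurable_pull_uncurry (hF : IsFlow h V Ψ Θ C) (hg : SmoothFamily g B)
    (hμ : PairingFamily μ M) :
    Measurable fun q : E d₁ × ℝ => pull Ψ Θ g (projIcc t₀ T h q.2) (μ q.2) q.1 :=
  measurable_uncurry_of_continuous_of_measurable
    (u := fun x r => pull Ψ Θ g (projIcc t₀ T h r) (μ r) x)
    (fun _ => (hF.boundedLip_pull hg _ _).continuous) fun x => hF.measurable_pull hg hμ x

theorem intervalIntegrable_of_measurable_of_bdd {F : Type*} [NormedAddCommGroup F]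
    [MeasurableSpace F] [BorelSpace F] [SecondCountableTopology F] {f : ℝ → F} (hf : Measurable f)
    {K : ℝ} (hK : ∀ r, ‖f r‖ ≤ K) (a b : ℝ) : IntervalIntegrable f volume a b :=
  (intervalIntegrable_const (c := K)).mono_fun hf.aestronglyMeasurable
    (ae_of_all _ fun r => (hK r).trans (le_abs_self K))

theorem IsFlow.intervalIntegrable_pull (hF : IsFlow h V Ψ Θ C) (hg : SmoothFamily g B)
    (hμ : PairingFamily μ M) (x : E d₁) (a b : ℝ) :
    IntervalIntegrable (fun r => pull Ψ Θ g (projIcc t₀ T h r) (μ r) x) volume a b :=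
  intervalIntegrable_of_measurable_of_bdd (hF.measurable_pull hg hμ x)
    (K := (C * B + 2 * C * C * B) * M) (fun r =>
      ((hF.boundedLip_pull hg _ _).bound x).trans (by gcongr; exact hμ.bdd r)) a b

/-- The accumulated perturbation of the flow, pulled back to the initial time. -/
noncomputable def displacement (h : t₀ ≤ T) (Ψ Θ : E d₁ → C(Icc t₀ T, E d₁))
    (g : E d₁ → (E d' →ᵇ E d₁)) (μ : ℝ → (E d' →ᵇ E d₁) →L[ℝ] E d₁) (t : ℝ) (x : E d₁) : E d₁ :=
  ∫ r in t₀..t, pull Ψ Θ g (projIcc t₀ T h r) (μ r) x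

/-- A continuous majorant β stands in for r ↦ ‖μ r‖, so that no measurability of the operator norm
in time is required. -/
theorem IsFlow.boundedLip_displacement (hF : IsFlow h V Ψ Θ C) (hg : SmoothFamily g B)
    (hμ : PairingFamily μ M) {t : ℝ} (ht : t₀ ≤ t) {β : ℝ → ℝ} (hβ : Continuous β)
    (hb : ∀ r ∈ Icc t₀ t, ‖μ r‖ ≤ β r) :
    BoundedLip (displacement h Ψ Θ g μ t) ((C * B + 2 * C * C * B) * ∫ r in t₀..t, β r) := by
  have hi : IntervalIntegrable (fun r => (C * B + 2 * C * C * B) * β r) volume t₀ t :=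
    (hβ.intervalIntegrable _ _).const_mul _
  constructor
  · intro x
    rw [← intervalIntegral.integral_const_mul]
    refine intervalIntegral.norm_integral_le_of_norm_le ht (ae_of_all _ fun r hr => ?_) hi
    refine ((hF.boundedLip_pull hg _ _).bound x).trans ?_
    gcongr
    exact hb r (Ioc_subset_Icc_self hr)
  · intro x x'
    rw [← intervalIntegral.integral_const_mul, ← intervalIntegral.integral_mul_const,
      displacement, displacement, ← intervalIntegral.integral_sub
        (hF.intervalIntegrable_pull hg hμ x _ _) (hF.intervalIntegrable_pull hg hμ x' _ _)]
    refine intervalIntegral.norm_integral_le_of_norm_le ht (ae_of_all _ fun r hr => ?_)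
      (hi.mul_const _)
    refine ((hF.boundedLip_pull hg _ _).lip x x').trans ?_
    gcongr
    exact hb r (Ioc_subset_Icc_self hr)

theorem IsFlow.fderiv_displacement (hF : IsFlow h V Ψ Θ C) (hg : SmoothFamily g B)
    (hμ : PairingFamily μ M) {W : Phase d₁ d₂ → ℝ} (z : Phase d₁ d₂) (t : ℝ) :
    ∫ r in t₀..t, fderiv ℝ W z (pull Ψ Θ g (projIcc t₀ T h r) (μ r) z.1, 0)
      = fderiv ℝ W z (displacement h Ψ Θ g μ t z.1, 0) :=
  ((fderiv ℝ W z).comp (ContinuousLinearMap.inl ℝ (E d₁) (E d₂))).intervalIntegral_comp_comm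
    (hF.intervalIntegrable_pull hg hμ z.1 t₀ t)

/-- The linearized adjoint state in terms of the displacement. -/
theorem IsFlow.linAdjoint_eq (hF : IsFlow h V Ψ Θ C) (hg : SmoothFamily g B)
    (hμ : PairingFamily μ M) {b : E d₁ → E d' → E d₁} {ν : ℝ → Measure (E d')}
    (hdrift : ∀ (t : Icc t₀ T) x, drift b (ν t) x = V x t)
    {η : ℝ → SignedMeasure (E d')} (hη : ∀ t ∈ Icc t₀ T, ∀ x, driftSigned b (η t) x = μ t (g x))
    {u v : ℝ → Phase d₁ d₂ → ℝ} (hu : LinearGrad t₀ T u) {W : Phase d₁ d₂ → ℝ}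
    (huW : ∀ (t : Icc t₀ T) z, u t (liftC Ψ z t) = W z) (hv : SolvesLinAdjoint b t₀ T ν u η v)
    (t : Icc t₀ T) (z : Phase d₁ d₂) :
    v t (liftC Ψ z t) =
      fderiv ℝ W z (displacement h Ψ Θ g μ T z.1 - displacement h Ψ Θ g μ t z.1, 0) := by
  have hvg := linearGrad_of_continuousIn hv.1
  obtain ⟨Cu, hCu⟩ := hu.exists_bound
  let P : ℝ → Icc t₀ T := projIcc t₀ T h
  have hP : Continuous P := continuous_projIcc
  have hPI : ∀ r ∈ Icc t₀ T, P r = r := fun r hr => by simp [P, projIcc_of_mem h hr]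
  let e : ℝ → Phase d₁ d₂ → ℝ := fun r y => fderiv ℝ (u (P r)) y (μ r (g y.1), 0)
  have hDu : ∀ y : ℝ → Phase d₁ d₂, Continuous y →
      Continuous fun r => fderiv ℝ (u (P r)) (y r) := fun y hy =>
    hu.continuousOn.comp_continuous (f := fun r => ((P r : ℝ), y r))
      ((continuous_subtype_val.comp hP).prodMk hy) fun r => ⟨(P r).2, mem_univ _⟩
  have hem : ∀ y : ℝ → Phase d₁ d₂, Continuous y → Measurable fun r => e r (y r) := fun y hy => by
    have h2 : Measurable fun r => μ r (g (y r).1) :=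
      hμ.measurable_apply (hg.smooth.continuous.comp (continuous_fst.comp hy))
    have h3 : Continuous fun q : (Phase d₁ d₂ →L[ℝ] ℝ) × Phase d₁ d₂ => q.1 q.2 :=
      isBoundedBilinearMap_apply.continuous
    exact h3.measurable.comp ((hDu y hy).measurable.prodMk (h2.prodMk measurable_const))
  have hμg : ∀ r x, ‖μ r (g x)‖ ≤ M * B := fun r x =>
    ((μ r).le_opNorm _).trans (mul_le_mul (hμ.bdd r) (hg.bdd x) (norm_nonneg _) M.2)
  have heb : ∀ r y, ‖e r y‖ ≤ M * B * Cu * gw 1 y := fun r y =>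
    norm_fderiv_inl_le (hCu _ (P r).2 y) (hμg r y.1)
  have hei : ∀ y : ℝ → Phase d₁ d₂, Continuous y → (∃ K, ∀ r, gw 1 (y r) ≤ K) → ∀ a b,
      IntervalIntegrable (fun r => e r (y r)) volume a b := fun y hy ⟨K, hK⟩ a b =>
    intervalIntegrable_of_measurable_of_bdd (hem y hy) (K := M * B * Cu * K)
      (fun r => (heb r _).trans (by gcongr; exact hK r)) a b
  let c : ℝ → Phase d₁ d₂ := IccExtend h (liftC Ψ z)
  have hc : Continuous c := (liftC Ψ z).continuous.Icc_extend'
  have hcb : ∃ K, ∀ r, gw 1 (c r) ≤ K :=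
    ⟨_, fun r => (hF.tameMap (P r)).growth z⟩
  -- Along a characteristic the transport terms cancel, and v changes only through the source e,
  -- whose accumulated integral compensates it.
  have hG : ∀ s ∈ Icc t₀ T, HasDerivWithinAt
      (fun s => v s (c s) + ∫ r in t₀..s, e r (c r)) 0 (Icc t₀ T) s := by
    intro s hs
    set y := c s with hy
    have hey := hei (fun _ => y) continuous_const ⟨_, fun _ => le_rfl⟩
    have hec := hei c hc hcb
    let α : ℝ → ℝ := fun r => fderiv ℝ (v (P r)) y (V y.1 (P r), 0)
    have hα : Continuous α := by
      have h1 : Continuous fun r => fderiv ℝ (v (P r)) y :=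
        hvg.continuousOn.comp_continuous (f := fun r => ((P r : ℝ), y))
          ((continuous_subtype_val.comp hP).prodMk continuous_const) fun r => ⟨(P r).2, mem_univ _⟩
      exact h1.clm_apply (((V y.1).continuous.comp hP).prodMk continuous_const)
    have hfix : ∀ r ∈ Icc t₀ T, v r y = v t₀ y - ∫ q in t₀..r, (α q + e q y) := fun r hr => by
      rcases eq_or_lt_of_le hr.1 with h0 | h0
      · rw [← h0, intervalIntegral.integral_same, sub_zero]
      · have h1 := hv.2.2 t₀ (left_mem_Icc.2 h) r hr h0 y
        have h2 : ∫ q in t₀..r, (α q + e q y) = ∫ q in t₀..r,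
            (inner ℝ (drift b (ν q) y.1) (gradX (v q) y) +
              inner ℝ (driftSigned b (η q) y.1) (gradX (u q) y)) := by
          refine intervalIntegral.integral_congr fun q hq => ?_
          rw [uIcc_of_le hr.1] at hq
          have hqI : q ∈ Icc t₀ T := ⟨hq.1, hq.2.trans hr.2⟩
          have h3 : P q = ⟨q, hqI⟩ := projIcc_of_mem h hqI
          simp only [α, e, h3]
          rw [inner_gradX (hvg.differentiable hqI y), inner_gradX (hu.differentiable hqI y),
            hdrift ⟨q, hqI⟩, hη q hqI]
        rw [h2, ← h1]
        ring
    have hd1 := hasDerivWithinAt_along_curve (h := v) (fun r hr => hvg.differentiable hr)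
      hvg.continuousOn hs (hF.hasDerivWithinAt_lift z hs)
    have hd2 : HasDerivWithinAt (fun r => ∫ q in t₀..r, α q) (α s) (Icc t₀ T) s :=
      (intervalIntegral.integral_hasDerivAt_right (hα.intervalIntegrable _ _)
        (hα.stronglyMeasurableAtFilter _ _) hα.continuousAt).hasDerivWithinAt
    -- The source is only bounded and measurable in time, so e itself cannot be differentiated under
    -- the integral. The difference between the source on the curve and at the frozen point is
    -- continuous at s with value zero, and only this difference is needed.
    let δ : ℝ → ℝ := fun q => e q (c q) - e q y
    have hδs : δ s = 0 := by simp [δ, hy]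
    have hδc : ContinuousAt δ s := by
      rw [ContinuousAt, hδs]
      have hb : ∀ q, ‖δ q‖ ≤ ‖fderiv ℝ (u (P q)) (c q) - fderiv ℝ (u (P q)) y‖ * (M * B)
          + ‖fderiv ℝ (u (P q)) y‖ * (M * ‖g (c q).1 - g y.1‖) := fun q => by
        have e1 : δ q = (fderiv ℝ (u (P q)) (c q) - fderiv ℝ (u (P q)) y) (μ q (g (c q).1), 0)
            + fderiv ℝ (u (P q)) y (μ q (g (c q).1 - g y.1), 0) := by
          have : ((μ q (g (c q).1 - g y.1), 0) : Phase d₁ d₂)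
              = (μ q (g (c q).1), 0) - (μ q (g y.1), 0) := by simp
          rw [this, map_sub, sub_apply]
          simp only [δ, e]
          abel
        rw [e1]
        refine (norm_add_le _ _).trans (add_le_add ?_ ?_)
        · refine (ContinuousLinearMap.le_opNorm _ _).trans ?_
          rw [norm_prodMk_zero]
          gcongr
          exact hμg _ _
        · refine (ContinuousLinearMap.le_opNorm _ _).trans ?_
          rw [norm_prodMk_zero]
          gcongr
          exact ((μ q).le_opNorm _).trans (by gcongr; exact hμ.bdd q)
      have hlim : Continuous fun q => ‖fderiv ℝ (u (P q)) (c q) - fderiv ℝ (u (P q)) y‖ * (M * B)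
          + ‖fderiv ℝ (u (P q)) y‖ * (M * ‖g (c q).1 - g y.1‖) := by
        have k1 := hDu c hc
        have k2 := hDu (fun _ => y) continuous_const
        have k3 : Continuous fun q => g (c q).1 :=
          hg.smooth.continuous.comp (continuous_fst.comp hc)
        exact ((k1.sub k2).norm.mul continuous_const).add
          (k2.norm.mul (continuous_const.mul (k3.sub continuous_const).norm))
      refine squeeze_zero_norm hb ?_
      have := hlim.tendsto s
      simpa [← hy] using this
    have hδi : ∀ a b, IntervalIntegrable δ volume a b := fun a b => (hec a b).sub (hey a b)
    have hd3 : HasDerivWithinAt (fun r => ∫ q in t₀..r, δ q) 0 (Icc t₀ T) s := by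
      rw [← hδs]
      exact (intervalIntegral.integral_hasDerivAt_right (hδi _ _)
        (((hem c hc).sub (hem _ continuous_const)).stronglyMeasurable.stronglyMeasurableAtFilter)
        hδc).hasDerivWithinAt
    have hsum : ∀ r ∈ Icc t₀ T, v r (c r) + ∫ q in t₀..r, e q (c q)
        = (v r (c r) - v r (c s)) + (v t₀ y - ∫ q in t₀..r, α q) + ∫ q in t₀..r, δ q := fun r hr => by
      have h1 : ∫ q in t₀..r, δ q = (∫ q in t₀..r, e q (c q)) - ∫ q in t₀..r, e q y :=
        intervalIntegral.integral_sub (hec _ _) (hey _ _)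
      have h2 := hfix r hr
      rw [intervalIntegral.integral_add (hα.intervalIntegrable _ _) (hey _ _)] at h2
      rw [h1, ← hy, h2]
      ring
    refine (((hd1.add (hd2.const_sub (v t₀ y))).add hd3).congr hsum (hsum s hs)).congr_deriv ?_
    have h3 : P s = ⟨s, hs⟩ := projIcc_of_mem h hs
    have h4 : liftC Ψ z ⟨s, hs⟩ = y := by rw [hy]; exact (IccExtend_of_mem h _ hs).symm
    have h5 : IccExtend h (liftC Ψ z) s = y := rfl
    simp only [α, h3, h4, h5, liftField_apply]
    ring
  have hGe := eq_of_hasDerivWithinAt_zero hG t.2 (right_mem_Icc.2 h)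
  -- Because u_r ∘ Ψ_r = W for all r, the source on the characteristic is DW at the fixed point z
  -- applied to the pulled-back field, and DW leaves the time integral.
  have hint : ∀ s ∈ Icc t₀ T, ∫ r in t₀..s, e r (c r)
      = fderiv ℝ W z (displacement h Ψ Θ g μ s z.1, 0) := fun s hs => by
    rw [← hF.fderiv_displacement hg hμ]
    refine intervalIntegral.integral_congr fun r hr => ?_
    rw [uIcc_of_le hs.1] at hr
    have hrI : r ∈ Icc t₀ T := ⟨hr.1, hr.2.trans hs.2⟩
    have h3 : P r = ⟨r, hrI⟩ := projIcc_of_mem h hrI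
    have h5 : W = fun z => u r (liftC Ψ z ⟨r, hrI⟩) := funext fun z => (huW ⟨r, hrI⟩ z).symm
    have h6 := hF.fderiv_comp_lift_pull (g := g) ⟨r, hrI⟩ (μ r) (hu.differentiable hrI) z
    simp only [e, c]
    rw [h3, projIcc_of_mem h hrI, IccExtend_of_mem h _ hrI, h5, h6]
    rfl
  simp only [hint t t.2, hint T (right_mem_Icc.2 h), hv.2.1, Pi.zero_apply, zero_add] at hGe
  have h7 : c t = liftC Ψ z t := IccExtend_val h _ t
  have h8 : ((displacement h Ψ Θ g μ T z.1 - displacement h Ψ Θ g μ t z.1, 0) : Phase d₁ d₂)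
      = (displacement h Ψ Θ g μ T z.1, 0) - (displacement h Ψ Θ g μ t z.1, 0) := by simp
  rw [h8, map_sub, ← hGe, h7]
  ring

end Displacement

/-! ### Approximation by smooth compactly supported functions in a weighted C¹ norm. -/

section Density

open scoped ContDiff Convolution

theorem exists_smooth_approx {X : Type*} [NormedAddCommGroup X] [NormedSpace ℝ X]
    [FiniteDimensional ℝ X] {F : X → ℝ} (hF : ContDiff ℝ 1 F) (hs : HasCompactSupport F)
    {δ : ℝ} (hδ : 0 < δ) :
    ∃ f : X → ℝ, ContDiff ℝ ∞ f ∧ HasCompactSupport f ∧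
      ∀ x, |F x - f x| ≤ δ ∧ ‖fderiv ℝ F x - fderiv ℝ f x‖ ≤ δ := by
  borelize X
  let m : Measure X := Measure.addHaar
  have hDF : Continuous (fderiv ℝ F) := hF.continuous_fderiv (by simp)
  obtain ⟨r₁, hr₁, h1⟩ := Metric.uniformContinuous_iff.1
    (hs.uniformContinuous_of_continuous hF.continuous) δ hδ
  obtain ⟨r₂, hr₂, h2⟩ := Metric.uniformContinuous_iff.1
    ((hs.fderiv (𝕜 := ℝ)).uniformContinuous_of_continuous hDF) δ hδ
  have hr : 0 < min r₁ r₂ := lt_min hr₁ hr₂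
  let φ : ContDiffBump (0 : X) := ⟨min r₁ r₂ / 2, min r₁ r₂, half_pos hr, half_lt_self hr⟩
  have hφ : LocallyIntegrable (φ.normed m) m := φ.continuous_normed.locallyIntegrable
  have hD : ∀ x, HasFDerivAt (φ.normed m ⋆[ContinuousLinearMap.lsmul ℝ ℝ, m] F)
      ((φ.normed m ⋆[(ContinuousLinearMap.lsmul ℝ ℝ).precompR X, m] fderiv ℝ F) x) x :=
    hs.hasFDerivAt_convolution_right _ hφ hF
  refine ⟨φ.normed m ⋆[ContinuousLinearMap.lsmul ℝ ℝ, m] F,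
    φ.hasCompactSupport_normed.contDiff_convolution_left _ φ.contDiff_normed
      hF.continuous.locallyIntegrable,
    HasCompactSupport.convolution _ φ.hasCompactSupport_normed hs, fun x => ⟨?_, ?_⟩⟩
  · rw [← Real.norm_eq_abs, ← dist_eq_norm, dist_comm]
    refine φ.dist_normed_convolution_le hF.continuous.aestronglyMeasurable fun y hy => ?_
    exact (h1 (lt_of_lt_of_le hy (min_le_left _ _))).le
  · rw [(hD x).fderiv]
    refine ContinuousLinearMap.opNorm_le_bound _ hδ.le fun w => ?_
    rw [sub_apply, convolution_precompR_apply _ hφ (hs.fderiv (𝕜 := ℝ)) hDF,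
      ← dist_eq_norm, dist_comm]
    refine φ.dist_normed_convolution_le
      (hDF.clm_apply continuous_const).aestronglyMeasurable fun y hy => ?_
    rw [dist_eq_norm, ← sub_apply]
    refine (ContinuousLinearMap.le_opNorm _ _).trans ?_
    gcongr
    rw [← dist_eq_norm]
    exact (h2 (lt_of_lt_of_le hy (min_le_right _ _))).le

variable {d₁ d₂ : ℕ}

/-- Cut off at scale R. The error lives where ‖z‖ ≥ R, and there quadratic growth is at most 3/R
times cubic growth. -/
theorem exists_compactSupport_approx {φ : Phase d₁ d₂ → ℝ} (hφ : φ ∈ C22 d₁ d₂) :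
    ∃ K : ℝ, ∀ R : ℝ, 1 ≤ R → ∃ f : Phase d₁ d₂ → ℝ, ContDiff ℝ 2 f ∧ HasCompactSupport f ∧
      ∀ z, |φ z - f z| ≤ K / R * gw 3 z ∧ ‖fderiv ℝ φ z - fderiv ℝ f z‖ ≤ K / R * gw 3 z := by
  obtain ⟨hφs, hφg⟩ := hφ
  lift growthNorm 2 2 φ to ℝ≥0 using hφg.ne with C hC
  let χ : ContDiffBump (0 : Phase d₁ d₂) := ⟨1, 2, one_pos, one_lt_two⟩
  have hχs : ContDiff ℝ 2 χ := χ.contDiff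
  obtain ⟨K, hK⟩ := (χ.hasCompactSupport.fderiv (𝕜 := ℝ)).exists_bound_of_continuous
    (hχs.continuous_fderiv (by simp))
  have hK0 : 0 ≤ K := (norm_nonneg _).trans (hK 0)
  have hφ0 : ∀ z, |φ z| ≤ C * gw 2 z := fun z => by
    have := norm_le_of_growthNorm_le hC.ge (Nat.zero_le 2) z
    rwa [norm_iteratedFDeriv_zero] at this
  have hφ1 : ∀ z, ‖fderiv ℝ φ z‖ ≤ C * gw 2 z := fun z =>
    norm_fderiv_le_of_growthNorm one_le_two hC.ge z
  have hgw : ∀ R : ℝ, 1 ≤ R → ∀ z : Phase d₁ d₂, R ≤ ‖z‖ → gw 2 z ≤ 3 / R * gw 3 z := by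
    intro R hR z hz
    rw [div_mul_eq_mul_div, le_div_iff₀ (by linarith)]
    have h0 := norm_nonneg z.1
    have h1 := norm_nonneg z.2
    have h2 : ∀ s t : ℝ, 0 ≤ s → 0 ≤ t → 1 ≤ max s t →
        (1 + s ^ 2 + t ^ 2) * max s t ≤ 3 * (1 + s ^ 3 + t ^ 3) := by
      intro s t hs ht hm
      have hp : ∀ a b : ℝ, 0 ≤ a → a ≤ b → 1 ≤ b →
          (1 + a ^ 2 + b ^ 2) * b ≤ 3 * (1 + a ^ 3 + b ^ 3) := by
        intro a b ha hab hb
        have e1 : a ^ 2 * b ≤ b ^ 3 := by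
          nlinarith [mul_nonneg ha ha, mul_nonneg (sub_nonneg.2 hab) (add_nonneg ha (ha.trans hab))]
        have e2 : b ≤ b ^ 3 := le_self_pow₀ hb (by norm_num)
        have e3 : 0 ≤ a ^ 3 := by positivity
        nlinarith
      rcases le_total s t with hst | hst
      · rw [max_eq_right hst] at hm ⊢
        exact hp s t hs hst hm
      · rw [max_eq_left hst] at hm ⊢
        have := hp t s ht hst hm
        linarith
    have h3 := h2 ‖z.1‖ ‖z.2‖ h0 h1 (by rw [← Prod.norm_def]; linarith)
    rw [← Prod.norm_def] at h3
    exact (mul_le_mul_of_nonneg_left hz (gw_pos 2 z).le).trans h3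
  refine ⟨3 * C * (1 + K), fun R hR => ⟨fun z => χ (R⁻¹ • z) * φ z, ?_, ?_, fun z => ?_⟩⟩
  · exact (hχs.comp (contDiff_const_smul _)).mul hφs
  · refine HasCompactSupport.mul_right ?_
    exact χ.hasCompactSupport.comp_smul (inv_ne_zero (by linarith))
  have hR0 : 0 < R := by linarith
  have hd : HasFDerivAt (fun z : Phase d₁ d₂ => χ (R⁻¹ • z))
      ((fderiv ℝ χ (R⁻¹ • z)).comp (R⁻¹ • ContinuousLinearMap.id ℝ _)) z :=
    (hχs.differentiable (by simp) _).hasFDerivAt.comp z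
      ((hasFDerivAt_id z).const_smul R⁻¹)
  have hφd := (hφs.differentiable (by simp) z).hasFDerivAt
  rcases lt_or_ge ‖z‖ R with hz | hz
  · have h1 : ∀ᶠ y in 𝓝 z, χ (R⁻¹ • y) * φ y = φ y := by
      have : ∀ᶠ y in 𝓝 z, ‖y‖ < R := continuous_norm.continuousAt.eventually_lt_const hz
      filter_upwards [this] with y hy
      rw [χ.one_of_mem_closedBall, one_mul]
      rw [mem_closedBall_zero_iff, norm_smul, norm_inv, Real.norm_of_nonneg hR0.le]
      change R⁻¹ * ‖y‖ ≤ 1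
      rw [inv_mul_le_iff₀ hR0, mul_one]
      exact hy.le
    have h2 : fderiv ℝ (fun z => χ (R⁻¹ • z) * φ z) z = fderiv ℝ φ z :=
      Filter.EventuallyEq.fderiv_eq h1
    have h3 := h1.self_of_nhds
    have h4 := gw_pos 3 z
    rw [h2]
    constructor
    · change |φ z - χ (R⁻¹ • z) * φ z| ≤ _
      rw [h3, sub_self, abs_zero]; positivity
    · rw [sub_self, norm_zero]; positivity
  · have h5 := hgw R hR z hz
    have h6 := gw_pos 3 z
    have h7 := gw_pos 2 z
    have h8 : |1 - χ (R⁻¹ • z)| ≤ 1 := by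
      rw [abs_le]
      have e1 := χ.nonneg (x := R⁻¹ • z)
      have e2 := χ.le_one (x := R⁻¹ • z)
      constructor <;> linarith
    have h9 : C * gw 2 z * (1 + K) ≤ 3 * C * (1 + K) / R * gw 3 z := by
      calc C * gw 2 z * (1 + K) ≤ C * (3 / R * gw 3 z) * (1 + K) := by gcongr
        _ = _ := by ring
    constructor
    · calc |φ z - χ (R⁻¹ • z) * φ z| = |1 - χ (R⁻¹ • z)| * |φ z| := by
            rw [← abs_mul]; congr 1; ring
        _ ≤ 1 * (C * gw 2 z) := mul_le_mul h8 (hφ0 z) (abs_nonneg _) zero_le_one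
        _ ≤ C * gw 2 z * (1 + K) := by
            rw [one_mul]
            exact le_mul_of_one_le_right (by positivity) (by linarith)
        _ ≤ _ := h9
    · have hm : fderiv ℝ (fun z => χ (R⁻¹ • z) * φ z) z = _ := (hd.mul hφd).fderiv
      rw [hm]
      have e : fderiv ℝ φ z - (χ (R⁻¹ • z) • fderiv ℝ φ z +
          φ z • (fderiv ℝ χ (R⁻¹ • z)).comp (R⁻¹ • ContinuousLinearMap.id ℝ _))
          = (1 - χ (R⁻¹ • z)) • fderiv ℝ φ z
            - (φ z * R⁻¹) • fderiv ℝ χ (R⁻¹ • z) := by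
        ext <;> simp <;> ring
      rw [e]
      have h10 : R⁻¹ ≤ 1 := inv_le_one_of_one_le₀ hR
      calc _ ≤ |1 - χ (R⁻¹ • z)| * ‖fderiv ℝ φ z‖ + |φ z| * R⁻¹ * ‖fderiv ℝ χ (R⁻¹ • z)‖ := by
            refine (norm_sub_le _ _).trans ?_
            rw [norm_smul, norm_smul, Real.norm_eq_abs, Real.norm_eq_abs, abs_mul,
              abs_of_pos (inv_pos.2 hR0)]
        _ ≤ 1 * (C * gw 2 z) + C * gw 2 z * 1 * K := by
            gcongr
            · exact hφ1 z
            · exact hφ0 z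
            · exact hK _
        _ = C * gw 2 z * (1 + K) := by ring
        _ ≤ _ := h9

/-- The approximation is in the norm of 𝒞¹₃, weaker than that of 𝒞²₂. The extra bound on ρ in `MemR`
is what makes it usable. -/
theorem exists_smooth_compactSupport_approx {φ : Phase d₁ d₂ → ℝ} (hφ : φ ∈ C22 d₁ d₂) {δ : ℝ}
    (hδ : 0 < δ) : ∃ f : Phase d₁ d₂ → ℝ, ContDiff ℝ 3 f ∧ HasCompactSupport f ∧
      ∀ z, |φ z - f z| ≤ δ * gw 3 z ∧ ‖fderiv ℝ φ z - fderiv ℝ f z‖ ≤ δ * gw 3 z := by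
  obtain ⟨K, hK⟩ := exists_compactSupport_approx hφ
  obtain ⟨f₁, hf₁, hs₁, h₁⟩ := hK (max 1 (2 * K / δ)) (le_max_left _ _)
  obtain ⟨f₂, hf₂, hs₂, h₂⟩ := exists_smooth_approx (hf₁.of_le one_le_two) hs₁ (half_pos hδ)
  have hKR : K / max 1 (2 * K / δ) ≤ δ / 2 := by
    have h0 : (0 : ℝ) < max 1 (2 * K / δ) := lt_of_lt_of_le one_pos (le_max_left _ _)
    rw [div_le_iff₀ h0]
    have h1 := le_max_right 1 (2 * K / δ)
    rw [div_le_iff₀ hδ] at h1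
    linarith
  refine ⟨f₂, mod_cast contDiff_infty.1 hf₂ 3, hs₂, fun z => ?_⟩
  have hg := one_le_gw 3 z
  have hb : K / max 1 (2 * K / δ) * gw 3 z + δ / 2 ≤ δ * gw 3 z := by
    nlinarith [mul_le_mul_of_nonneg_right hKR (zero_le_one.trans hg)]
  constructor
  · calc |φ z - f₂ z| = |(φ z - f₁ z) + (f₁ z - f₂ z)| := by congr 1; ring
      _ ≤ _ := (abs_add_le _ _).trans (add_le_add (h₁ z).1 (h₂ z).1)
      _ ≤ _ := hb
  · calc _ = ‖(fderiv ℝ φ z - fderiv ℝ f₁ z) + (fderiv ℝ f₁ z - fderiv ℝ f₂ z)‖ := by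
          congr 1; abel
      _ ≤ _ := (norm_add_le _ _).trans (add_le_add (h₁ z).2 (h₂ z).2)
      _ ≤ _ := hb

theorem abs_form_le {k p : ℕ} {ρ : Form d₁ d₂} {C B : ℝ≥0} (hρ : dualNorm k p ρ ≤ C)
    (hB : 0 < B) (φ : C22 d₁ d₂) (hk : ContDiff ℝ k (φ : Phase d₁ d₂ → ℝ))
    (hφ : growthNorm k p (φ : Phase d₁ d₂ → ℝ) ≤ B) : |ρ φ| ≤ C * B := by
  have h1 : growthNorm k p ((((B⁻¹ : ℝ≥0) : ℝ) • φ : C22 d₁ d₂) : Phase d₁ d₂ → ℝ) ≤ 1 := by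
    refine (growthNorm_smul_le _ hk).trans ?_
    rw [abs_of_nonneg (NNReal.coe_nonneg _), ENNReal.ofReal_coe_nnreal]
    calc ((B⁻¹ : ℝ≥0) : ℝ≥0∞) * growthNorm k p (φ : Phase d₁ d₂ → ℝ) ≤ (B⁻¹ : ℝ≥0) * B := by gcongr
      _ = 1 := by rw [← ENNReal.coe_mul, inv_mul_cancel₀ hB.ne', ENNReal.coe_one]
  have h2 : ‖ρ (((B⁻¹ : ℝ≥0) : ℝ) • φ)‖ₑ ≤ C :=
    (le_iSup₂ (f := fun (φ : C22 d₁ d₂) (_ : growthNorm k p (φ : Phase d₁ d₂ → ℝ) ≤ 1) => ‖ρ φ‖ₑ)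
      _ h1).trans hρ
  rw [enorm_le_coe, map_smul, smul_eq_mul, nnnorm_mul] at h2
  have h3 : (‖ρ φ‖₊ : ℝ) ≤ C * B := by
    have h4 : ‖((B⁻¹ : ℝ≥0) : ℝ)‖₊ = B⁻¹ := Real.nnnorm_of_nonneg (NNReal.coe_nonneg _)
    rw [h4, inv_mul_le_iff₀ hB] at h2
    rw [mul_comm]
    exact_mod_cast h2
  simpa using h3

theorem growthNorm_one_le {f : Phase d₁ d₂ → ℝ} {p : ℕ} {a c : ℝ} (h0 : ∀ z, |f z| ≤ a * gw p z)
    (h1 : ∀ z, ‖fderiv ℝ f z‖ ≤ c * gw p z) : growthNorm 1 p f ≤ ENNReal.ofReal (a + c) := by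
  refine growthNorm_le_of_forall fun z => ?_
  rw [Finset.sum_range_succ, Finset.sum_range_one, norm_iteratedFDeriv_zero,
    norm_iteratedFDeriv_one, add_mul]
  exact add_le_add (h0 z) (h1 z)

theorem mem_C22_of_hasCompactSupport {f : Phase d₁ d₂ → ℝ} (hf : ContDiff ℝ 2 f)
    (hs : HasCompactSupport f) : f ∈ C22 d₁ d₂ := by
  have h1 : ∀ j ∈ Finset.range (2 + 1), ∃ K, ∀ z, ‖iteratedFDeriv ℝ j f z‖ ≤ K := fun j hj =>
    (hs.iteratedFDeriv (𝕜 := ℝ) j).exists_bound_of_continuous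
      (hf.continuous_iteratedFDeriv (mod_cast Nat.lt_succ_iff.1 (Finset.mem_range.1 hj)))
  choose! K hK using h1
  refine ⟨hf, (growthNorm_le_of_forall (C := ∑ j ∈ Finset.range (2 + 1), K j) fun z => ?_).trans_lt
    ENNReal.ofReal_lt_top⟩
  have h2 : ∑ j ∈ Finset.range (2 + 1), ‖iteratedFDeriv ℝ j f z‖
      ≤ ∑ j ∈ Finset.range (2 + 1), K j := Finset.sum_le_sum fun j hj => hK j hj z
  have h3 : 0 ≤ ∑ j ∈ Finset.range (2 + 1), K j :=
    (Finset.sum_nonneg fun _ _ => norm_nonneg _).trans h2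
  exact h2.trans (le_mul_of_one_le_right h3 (one_le_gw 2 z))

end Density

/-! ### Duhamel's formula for ρ. -/

section LinearizedContinuity

variable {d₁ d₂ d' : ℕ} {t₀ T : ℝ} {h : t₀ ≤ T} {V : C(E d₁, C(Icc t₀ T, E d₁))}
  {Ψ Θ : E d₁ → C(Icc t₀ T, E d₁)} {C B M K : ℝ≥0} {g : E d₁ → (E d' →ᵇ E d₁)}
  {μ : ℝ → (E d' →ᵇ E d₁) →L[ℝ] E d₁}

theorem bracket_zero (ρ : Form d₁ d₂) : bracket (fun _ => 0) ρ = 0 := by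
  unfold bracket
  split
  · exact map_zero ρ
  · rfl

theorem bracket_of_mem {φ : Phase d₁ d₂ → ℝ} (hφ : φ ∈ C22 d₁ d₂) (ρ : Form d₁ d₂) :
    bracket φ ρ = ρ ⟨φ, hφ⟩ := dif_pos hφ

theorem IsFlow.hasCompactSupport_comp_lift (hF : IsFlow h V Ψ Θ C) (t : Icc t₀ T)
    {f : Phase d₁ d₂ → ℝ} (hs : HasCompactSupport f) :
    HasCompactSupport fun z => f (liftC Ψ z t) :=
  hs.comp_homeomorph
    { toFun := fun z => liftC Ψ z t
      invFun := fun z => liftC Θ z t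
      left_inv := hF.lift_left_inv t
      right_inv := hF.lift_right_inv t
      continuous_toFun := (hF.tameMap t).smooth.continuous
      continuous_invFun := (hF.tameMap_inv t).smooth.continuous }

variable {b : E d₁ → E d' → E d₁} {ν : ℝ → Measure (E d')} {η : ℝ → SignedMeasure (E d')}
  {γ₀ : Measure (Phase d₁ d₂)} {γ : ℝ → Measure (Phase d₁ d₂)} {ρ : ℝ → Form d₁ d₂}

theorem IsFlow.integral_fderiv_displacement (hF : IsFlow h V Ψ Θ C) (hg : SmoothFamily g B)
    (hμ : PairingFamily μ M) [IsFiniteMeasure γ₀] {ψ : Phase d₁ d₂ → ℝ} (hψ : ContDiff ℝ 1 ψ)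
    (hs : HasCompactSupport ψ) (t : ℝ) :
    ∫ r in t₀..t, ∫ z, fderiv ℝ ψ z (pull Ψ Θ g (projIcc t₀ T h r) (μ r) z.1, 0) ∂γ₀
      = ∫ z, fderiv ℝ ψ z (displacement h Ψ Θ g μ t z.1, 0) ∂γ₀ := by
  obtain ⟨D, hD⟩ := (hs.fderiv (𝕜 := ℝ)).exists_bound_of_continuous
    (hψ.continuous_fderiv (by simp))
  have hm : Measurable fun q : ℝ × Phase d₁ d₂ =>
      fderiv ℝ ψ q.2 (pull Ψ Θ g (projIcc t₀ T h q.1) (μ q.1) q.2.1, 0) := by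
    have h1 : Measurable fun q : ℝ × Phase d₁ d₂ =>
        pull Ψ Θ g (projIcc t₀ T h q.1) (μ q.1) q.2.1 :=
      (hF.measurable_pull_uncurry hg hμ).comp
        ((measurable_fst.comp measurable_snd).prodMk measurable_fst)
    have h2 : Measurable fun q : ℝ × Phase d₁ d₂ => fderiv ℝ ψ q.2 :=
      (hψ.continuous_fderiv (by simp)).measurable.comp measurable_snd
    have h3 : Continuous fun q : (Phase d₁ d₂ →L[ℝ] ℝ) × Phase d₁ d₂ => q.1 q.2 :=
      isBoundedBilinearMap_apply.continuous
    exact h3.measurable.comp (h2.prodMk (h1.prodMk measurable_const))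
  rw [intervalIntegral_integral_swap]
  · exact integral_congr_ae (ae_of_all _ fun z => hF.fderiv_displacement hg hμ z t)
  · have : IsFiniteMeasure (volume.restrict (uIoc t₀ t)) :=
      ⟨by rw [Measure.restrict_apply_univ, uIoc]; exact measure_Ioc_lt_top⟩
    refine Integrable.of_bound (C := D * ((C * B + 2 * C * C * B) * M)) hm.aestronglyMeasurable
      (ae_of_all _ fun q => ?_)
    refine (ContinuousLinearMap.le_opNorm _ _).trans ?_
    rw [norm_prodMk_zero]
    refine mul_le_mul (hD _) ?_ (norm_nonneg _) ((norm_nonneg _).trans (hD 0))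
    refine ((hF.boundedLip_pull hg _ _).bound _).trans ?_
    gcongr
    exact hμ.bdd _

/-- Test with f ∘ Ψ_t ∘ Θ_r at time r: it solves the transport equation, so the term containing ρ
under the integral disappears. Transported to γ₀, the source becomes the derivative of f ∘ Ψ_t along
the pulled-back field, and Fubini assembles the displacement. -/
theorem IsFlow.linContinuity_eq_of_hasCompactSupport (hF : IsFlow h V Ψ Θ C)
    (hV : FlowField V K) (hg : SmoothFamily g B)
    (hμ : PairingFamily μ M) (hdrift : ∀ (t : Icc t₀ T) x, drift b (ν t) x = V x t)
    (hη : ∀ t ∈ Icc t₀ T, ∀ x, driftSigned b (η t) x = μ t (g x)) [IsFiniteMeasure γ₀]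
    (hγ : ∀ t : Icc t₀ T, γ t = γ₀.map fun z => liftC Ψ z t)
    (hρ : SolvesLinContinuity b t₀ T ν γ η ρ) (t : Icc t₀ T) {f : Phase d₁ d₂ → ℝ}
    (hf : ContDiff ℝ 3 f) (hs : HasCompactSupport f) :
    bracket f (ρ t) = ∫ z, fderiv ℝ (fun z => f (liftC Ψ z t)) z
      (displacement h Ψ Θ g μ t z.1, 0) ∂γ₀ := by
  have hψ' : ContDiff ℝ 3 fun z => f (liftC Ψ z t) := hf.comp (hF.tameMap t).smooth
  have hψs := hF.hasCompactSupport_comp_lift t hs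
  let ψ : C(Phase d₁ d₂, ℝ) := ⟨fun z => f (liftC Ψ z t), hψ'.continuous⟩
  have hψ : ContDiff ℝ 3 ψ := hψ'
  have heq := hρ.2.2 _ _ (hF.isTest_transportC hV.smooth hψ hψs) t t.2
  have htr := hF.contDiff_transportC hψ
  have htd : Differentiable ℝ (transportC Θ ψ) := htr.differentiable (by simp)
  have e0 : (fun z => IccExtend h (transportC Θ ψ z) t) = f := funext fun z => by
    rw [IccExtend_val, transportC_apply]
    exact congrArg f (hF.lift_right_inv t z)
  have e1 : ∀ r ∈ Icc t₀ T, (fun z => IccExtend h (transportC Θ ψ z) r)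
      = fun z => transportC Θ ψ z (projIcc t₀ T h r) := fun r hr => rfl
  have h1 : ∫ r in t₀..t, bracket (fun z =>
      IccExtend h (transportVelocity (transportC Θ ψ) (liftField V) z) r +
        inner ℝ (drift b (ν r) z.1) (gradX (fun z => IccExtend h (transportC Θ ψ z) r) z)) (ρ r)
      = 0 := by
    refine intervalIntegral.integral_zero_ae (ae_of_all _ fun r hr => ?_)
    rw [uIoc_of_le t.2.1] at hr
    have hrI : r ∈ Icc t₀ T := ⟨hr.1.le, hr.2.trans t.2.2⟩
    rw [← bracket_zero (ρ r)]
    congr 1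
    funext z
    rw [e1 r hrI, inner_gradX (hasFDerivAt_eval htd _ z).differentiableAt,
      IccExtend_of_mem h _ hrI, transportVelocity_apply htd, hdrift ⟨r, hrI⟩,
      projIcc_of_mem h hrI, liftField_apply]
    exact neg_add_cancel _
  have h2 : ∀ r ∈ uIcc t₀ (t : ℝ), ∫ z, inner ℝ (driftSigned b (η r) z.1)
        (gradX (fun z => IccExtend h (transportC Θ ψ z) r) z) ∂(γ r)
      = ∫ z, fderiv ℝ ψ z (pull Ψ Θ g (projIcc t₀ T h r) (μ r) z.1, 0) ∂γ₀ := fun r hr => by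
    rw [uIcc_of_le t.2.1] at hr
    have hrI : r ∈ Icc t₀ T := ⟨hr.1, hr.2.trans t.2.2⟩
    have hse : ContDiff ℝ 3 fun z => transportC Θ ψ z ⟨r, hrI⟩ := contDiff_eval htr _
    have hsd : Differentiable ℝ fun z => transportC Θ ψ z ⟨r, hrI⟩ := hse.differentiable (by simp)
    have h3 : ∀ z, inner ℝ (driftSigned b (η r) z.1)
        (gradX (fun z => IccExtend h (transportC Θ ψ z) r) z)
        = fderiv ℝ (fun z => transportC Θ ψ z ⟨r, hrI⟩) z (μ r (g z.1), 0) := fun z => by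
      rw [e1 r hrI, projIcc_of_mem h hrI, inner_gradX (hsd z), hη r hrI]
    have h4 : Continuous fun z : Phase d₁ d₂ =>
        fderiv ℝ (fun z => transportC Θ ψ z ⟨r, hrI⟩) z (μ r (g z.1), 0) :=
      continuous_fderiv_apply_inl (hse.of_le (by norm_num))
        ((μ r).continuous.comp (hg.smooth.continuous.comp continuous_fst))
    have h5 : (fun z => transportC Θ ψ (liftC Ψ z ⟨r, hrI⟩) ⟨r, hrI⟩) = ψ := funext fun z => by
      rw [transportC_apply, hF.lift_left_inv]
    rw [integral_congr_ae (ae_of_all _ h3), hγ ⟨r, hrI⟩,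
      integral_map (hF.measurable_liftC _).aemeasurable h4.aestronglyMeasurable]
    refine integral_congr_ae (ae_of_all _ fun z => ?_)
    change fderiv ℝ (fun z => transportC Θ ψ z ⟨r, hrI⟩) (liftC Ψ z ⟨r, hrI⟩)
      (μ r (g (Ψ z.1 ⟨r, hrI⟩)), 0) = _
    rw [← hF.fderiv_comp_lift_pull _ _ hsd, h5, projIcc_of_mem h hrI]
  rw [h1, zero_add, e0, intervalIntegral.integral_congr h2,
    hF.integral_fderiv_displacement hg hμ (hψ.of_le (by norm_num)) hψs] at heq
  exact heq

theorem IsFlow.gw_three_lift_le (hF : IsFlow h V Ψ Θ C) (t : Icc t₀ T) (z : Phase d₁ d₂) :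
    gw 3 (liftC Ψ z t) ≤ (4 + 4 * C ^ 3) * gw 3 z :=
  gw_three_le_of_norm_sub_le (hF.norm_sub_le t z.1)

/-- The linearized flow of measures in terms of the displacement. -/
theorem IsFlow.linContinuity_eq (hF : IsFlow h V Ψ Θ C)
    (hV : FlowField V K) (hg : SmoothFamily g B)
    (hμ : PairingFamily μ M) (hdrift : ∀ (t : Icc t₀ T) x, drift b (ν t) x = V x t)
    (hη : ∀ t ∈ Icc t₀ T, ∀ x, driftSigned b (η t) x = μ t (g x)) (hγ₀ : MemP 3 γ₀)
    (hγ : ∀ t : Icc t₀ T, γ t = γ₀.map fun z => liftC Ψ z t)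
    (hρ : SolvesLinContinuity b t₀ T ν γ η ρ) (t : Icc t₀ T) {φ : Phase d₁ d₂ → ℝ}
    (hφ : φ ∈ C22 d₁ d₂) :
    bracket φ (ρ t) = ∫ z, fderiv ℝ (fun z => φ (liftC Ψ z t)) z
      (displacement h Ψ Θ g μ t z.1, 0) ∂γ₀ := by
  have := hγ₀.1
  obtain ⟨R, hR⟩ := hρ.1.2.2.1
  have hw := hF.boundedLip_displacement hg hμ t.2.1 (β := fun _ => M) continuous_const
    fun r _ => hμ.bdd r
  set S : ℝ := (C * B + 2 * C * C * B) * ∫ _ in t₀..t, (M : ℝ) with hSdef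
  have hS := hw.nonneg
  set w := displacement h Ψ Θ g μ t
  set c : ℝ := (4 + 4 * C ^ 3) * (1 + C) * S with hc
  have hM := hF.tameMap (d₂ := d₂) t
  have hint : ∀ {f : Phase d₁ d₂ → ℝ}, ContDiff ℝ 1 f → ∀ {D : ℝ},
      (∀ z, ‖fderiv ℝ f z‖ ≤ D * gw 3 z) →
      (∀ z, ‖fderiv ℝ (fun z => f (liftC Ψ z t)) z (w z.1, 0)‖ ≤ D * c * gw 3 z) ∧
      Integrable (fun z => fderiv ℝ (fun z => f (liftC Ψ z t)) z (w z.1, 0)) γ₀ := by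
    intro f hf D hD
    have hD0 : 0 ≤ D := nonneg_of_mul_nonneg_left ((norm_nonneg _).trans (hD 0)) (gw_pos 3 0)
    have hfd : Differentiable ℝ f := hf.differentiable (by simp)
    have hb : ∀ z, ‖fderiv ℝ (fun z => f (liftC Ψ z t)) z (w z.1, 0)‖ ≤ D * c * gw 3 z := by
      intro z
      rw [fderiv_comp_tame hfd hM.differentiable]
      refine (ContinuousLinearMap.le_opNorm _ _).trans ?_
      rw [norm_prodMk_zero]
      have h1 := (gw_pos 3 z).le
      calc _ ≤ (D * ((4 + 4 * C ^ 3) * gw 3 z)) * (1 + C : ℝ≥0) * S := by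
            gcongr
            · refine (ContinuousLinearMap.opNorm_comp_le _ _).trans ?_
              refine mul_le_mul ((hD _).trans ?_) (hM.norm_fderiv_le z) (norm_nonneg _)
                (by positivity)
              gcongr
              exact hF.gw_three_lift_le t z
            · exact hw.bound _
        _ = D * c * gw 3 z := by rw [hc]; push_cast; ring
    refine ⟨hb, hγ₀.integrable_of_norm_le le_rfl ?_ hb⟩
    exact (continuous_fderiv_apply_inl (hf.comp (hM.smooth.of_le (by norm_num)))
      (hw.continuous.comp continuous_fst)).aestronglyMeasurable
  have hφs : ContDiff ℝ 1 φ := hφ.1.of_le (by norm_num)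
  obtain ⟨Cφ, hCφ⟩ : ∃ Cφ : ℝ≥0, growthNorm 2 2 φ ≤ Cφ :=
    ⟨_, (ENNReal.coe_toNNReal hφ.2.ne).ge⟩
  have hφD : ∀ z, ‖fderiv ℝ φ z‖ ≤ (Cφ * 3) * gw 3 z := fun z => by
    refine (norm_fderiv_le_of_growthNorm one_le_two hCφ z).trans ?_
    rw [mul_assoc]
    gcongr
    exact gw_le_mul_gw (by norm_num) z
  refine eq_of_abs_sub_le_all fun δ hδ => ?_
  -- Both sides are continuous for the 𝒞¹₃ norm: the left by the uniform bound R on ρ, the 2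
  -- counting function and gradient errors, the right by the third moment of γ₀. Approximating to
  -- within δ / (D + 1) gives a total error of at most δ.
  set D : ℝ := 2 * R + c * ∫ z, gw 3 z ∂γ₀ with hDdef
  have hc0 : 0 ≤ c := by positivity
  have hI0 : 0 ≤ ∫ z, gw 3 z ∂γ₀ := integral_nonneg fun z => (gw_pos 3 z).le
  have hD0 : 0 ≤ D := by positivity
  have hδ' : 0 < δ / (D + 1) := by positivity
  obtain ⟨f, hf, hfs, hfa⟩ := exists_smooth_compactSupport_approx hφ hδ'
  have hf22 := mem_C22_of_hasCompactSupport (hf.of_le (by norm_num)) hfs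
  have hf1 : ContDiff ℝ 1 f := hf.of_le (by norm_num)
  have hsub : ∀ z, ‖fderiv ℝ (φ - f) z‖ ≤ δ / (D + 1) * gw 3 z := fun z => by
    rw [fderiv_sub (hφs.differentiable (by simp) z) (hf1.differentiable (by simp) z)]
    exact (hfa z).2
  have hrep := hF.linContinuity_eq_of_hasCompactSupport hV hg hμ hdrift hη hγ hρ t hf hfs
  have h1 : |bracket φ (ρ t) - bracket f (ρ t)| ≤ R * (2 * (δ / (D + 1))) := by
    rw [bracket_of_mem hφ, bracket_of_mem hf22, ← map_sub]
    have h2 : growthNorm 1 3 (φ - f) ≤ ENNReal.ofReal (δ / (D + 1) + δ / (D + 1)) :=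
      growthNorm_one_le (fun z => (hfa z).1) hsub
    have h3 := abs_form_le (B := (2 * (δ / (D + 1))).toNNReal) (hR t t.2) (by simpa using hδ')
      (⟨φ, hφ⟩ - ⟨f, hf22⟩) (by exact_mod_cast hφs.sub hf1) (by rw [← two_mul] at h2; exact h2)
    rwa [Real.coe_toNNReal _ (by positivity)] at h3
  have h4 : |(∫ z, fderiv ℝ (fun z => φ (liftC Ψ z t)) z (w z.1, 0) ∂γ₀)
      - ∫ z, fderiv ℝ (fun z => f (liftC Ψ z t)) z (w z.1, 0) ∂γ₀|
      ≤ δ / (D + 1) * c * ∫ z, gw 3 z ∂γ₀ := by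
    have i1 := (hint hφs hφD).2
    have hfD : ∀ z, ‖fderiv ℝ f z‖ ≤ (Cφ * 3 + δ / (D + 1)) * gw 3 z := fun z => by
      rw [add_mul]
      calc _ = ‖fderiv ℝ φ z - (fderiv ℝ φ z - fderiv ℝ f z)‖ := by congr 1; abel
        _ ≤ _ := (_root_.norm_sub_le _ _).trans (add_le_add (hφD z) (hfa z).2)
    have i2 := (hint hf1 hfD).2
    rw [← integral_sub i1 i2, ← Real.norm_eq_abs, ← integral_const_mul]
    refine norm_integral_le_of_norm_le ((hγ₀.integrable_gw le_rfl).const_mul _)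
      (ae_of_all _ fun z => ?_)
    have h5 := (hint (hφs.sub hf1) hsub).1 z
    have h6 : fderiv ℝ (fun z => φ (liftC Ψ z t) - f (liftC Ψ z t)) z
        = fderiv ℝ (fun z => φ (liftC Ψ z t)) z - fderiv ℝ (fun z => f (liftC Ψ z t)) z :=
      fderiv_sub ((hφs.differentiable (by simp)).comp hM.differentiable z)
        ((hf1.differentiable (by simp)).comp hM.differentiable z)
    rwa [h6, sub_apply] at h5
  rw [← hrep] at h4
  calc _ = |(bracket φ (ρ t) - bracket f (ρ t)) - ((∫ z, fderiv ℝ (fun z => φ (liftC Ψ z t)) z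
        (w z.1, 0) ∂γ₀) - bracket f (ρ t))| := by congr 1; ring
    _ ≤ R * (2 * (δ / (D + 1))) + δ / (D + 1) * c * ∫ z, gw 3 z ∂γ₀ :=
        (abs_sub _ _).trans (add_le_add h1 h4)
    _ = D / (D + 1) * δ := by rw [hDdef]; ring
    _ ≤ 1 * δ := by
        gcongr
        rw [div_le_one (by positivity)]
        linarith
    _ = δ := one_mul δ

end LinearizedContinuity

/-! ### Use of the discriminating property. -/

section Discrimination

variable {d₁ d₂ d' : ℕ}

theorem gradX_eq {f : Phase d₁ d₂ → ℝ} {z : Phase d₁ d₂} (hf : DifferentiableAt ℝ f z) :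
    gradX f z = (InnerProductSpace.toDual ℝ (E d₁)).symm
      ((fderiv ℝ f z).comp (ContinuousLinearMap.inl ℝ (E d₁) (E d₂))) := by
  refine ext_inner_right ℝ fun w => ?_
  rw [InnerProductSpace.toDual_symm_apply, real_inner_comm, inner_gradX hf]
  rfl

theorem continuous_gradX {f : Phase d₁ d₂ → ℝ} (hf : ContDiff ℝ 1 f) : Continuous (gradX f) := by
  have h : gradX f = fun z => (InnerProductSpace.toDual ℝ (E d₁)).symm
      ((fderiv ℝ f z).comp (ContinuousLinearMap.inl ℝ (E d₁) (E d₂))) :=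
    funext fun z => gradX_eq (hf.differentiable (by simp) z)
  rw [h]
  exact (LinearIsometryEquiv.continuous _).comp
    ((hf.continuous_fderiv (by simp)).clm_comp continuous_const)

theorem norm_gradX_le {f : Phase d₁ d₂ → ℝ} {z : Phase d₁ d₂} (hf : DifferentiableAt ℝ f z) :
    ‖gradX f z‖ ≤ ‖fderiv ℝ f z‖ := by
  rw [gradX_eq hf, LinearIsometryEquiv.norm_map]
  exact (ContinuousLinearMap.opNorm_comp_le _ _).trans
    (mul_le_of_le_one_right (norm_nonneg _) (ContinuousLinearMap.norm_inl_le_one ℝ _ _))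

/-- If the partial gradient of `f` is orthogonal to all coefficients, then it is orthogonal to all
bounded continuous vector fields. -/
theorem Discriminating.integral_fderiv_eq_zero {b : E d₁ → E d' → E d₁} (hdis : Discriminating b)
    {γ₀ : Measure (Phase d₁ d₂)} (hγ₀ : MemP 2 γ₀) {f : Phase d₁ d₂ → ℝ} (hf : ContDiff ℝ 1 f)
    {C : ℝ} (hC : ∀ z, ‖fderiv ℝ f z‖ ≤ C * gw 1 z)
    (h0 : ∀ a, ∫ z, inner ℝ (b z.1 a) (gradX f z) ∂γ₀ = 0) {w : E d₁ → E d₁} (hw : Continuous w)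
    {S : ℝ} (hS : ∀ x, ‖w x‖ ≤ S) : ∫ z, fderiv ℝ f z (w z.1, 0) ∂γ₀ = 0 := by
  have := hγ₀.1
  have hfd : Differentiable ℝ f := hf.differentiable (by simp)
  have hZ : Integrable (gradX f) γ₀ := hγ₀.integrable_of_norm_le one_le_two
    (continuous_gradX hf).aestronglyMeasurable fun z => (norm_gradX_le (hfd z)).trans (hC z)
  have hi : Integrable (fun z : Phase d₁ d₂ => fderiv ℝ f z (w z.1, 0)) γ₀ :=
    hγ₀.integrable_of_norm_le one_le_two (continuous_fderiv_apply_inl hf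
      (hw.comp continuous_fst)).aestronglyMeasurable fun z => norm_fderiv_inl_le (hC z) (hS z.1)
  -- The phase space itself is the probability space, with X the feature and Z the partial gradient.
  have hce := hdis (Phase d₁ d₂) γ₀ Prod.fst (gradX f) measurable_fst
    (continuous_gradX hf).measurable hZ h0
  have hm : MeasurableSpace.comap (Prod.fst : Phase d₁ d₂ → E d₁) inferInstance
      ≤ (inferInstance : MeasurableSpace (Phase d₁ d₂)) := measurable_fst.comap_le
  have e : (fun z : Phase d₁ d₂ => fderiv ℝ f z (w z.1, 0))
      = fun z => innerSL ℝ (w z.1) (gradX f z) := funext fun z => by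
    rw [← inner_gradX (hfd z)]
    rfl
  rw [e] at hi ⊢
  have hws : StronglyMeasurable[MeasurableSpace.comap (Prod.fst : Phase d₁ d₂ → E d₁)
      inferInstance] fun z : Phase d₁ d₂ => w z.1 :=
    (hw.measurable.comp (comap_measurable _)).stronglyMeasurable
  -- A field depending on x only can be pulled out of the conditional expectation given x.
  have hp := condExp_bilin_of_stronglyMeasurable_left (innerSL ℝ) hws hi hZ
  rw [← integral_condExp hm, integral_congr_ae hp]
  refine integral_eq_zero_of_ae ?_
  filter_upwards [hce] with z hz
  rw [hz]
  simp

end Discrimination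

/-! ### A Gronwall inequality by iteration. -/

section Iteration

/-- Starting from the crude bound M, each use of the hypothesis gains a factor, giving M(K(t -
t₀))ⁿ/n!, which tends to zero. Continuous majorants are fed in, so m need not be measurable. -/
theorem nonpos_of_iterated_bound {t₀ T M K : ℝ} {m : ℝ → ℝ} (hM : ∀ r, m r ≤ M)
    (hm : ∀ t ∈ Icc t₀ T, ∀ β : ℝ → ℝ, Continuous β → (∀ r ∈ Icc t₀ t, m r ≤ β r) →
      m t ≤ K * ∫ r in t₀..t, β r) : ∀ t ∈ Icc t₀ T, m t ≤ 0 := by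
  have key : ∀ n : ℕ, ∀ t ∈ Icc t₀ T, m t ≤ M * ((K * (t - t₀)) ^ n / n.factorial) := by
    intro n
    induction n with
    | zero => intro t _; simpa using hM t
    | succ n ih =>
      intro t ht
      refine (hm t ht (fun r => M * ((K * (r - t₀)) ^ n / n.factorial)) (by fun_prop)
        fun r hr => ih r ⟨hr.1, hr.2.trans ht.2⟩).trans_eq ?_
      have h1 : ∫ r in t₀..t, (r - t₀) ^ n = (t - t₀) ^ (n + 1) / (n + 1) := by
        rw [intervalIntegral.integral_comp_sub_right (fun r => r ^ n), integral_pow]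
        simp
      have h2 : ∫ r in t₀..t, M * ((K * (r - t₀)) ^ n / n.factorial)
          = M * (K ^ n / n.factorial) * ((t - t₀) ^ (n + 1) / (n + 1)) := by
        rw [← h1, ← intervalIntegral.integral_const_mul]
        congr 1
        funext r
        rw [mul_pow]
        ring
      rw [h2, Nat.factorial_succ, mul_pow]
      push_cast
      have h3 : (n.factorial : ℝ) ≠ 0 := by positivity
      have h4 : (n : ℝ) + 1 ≠ 0 := by positivity
      field_simp
      ring
  intro t ht
  have hlim : Tendsto (fun n : ℕ => M * ((K * (t - t₀)) ^ n / n.factorial)) atTop (𝓝 (M * 0)) :=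
    (FloorSemiring.tendsto_pow_div_factorial_atTop _).const_mul M
  rw [mul_zero] at hlim
  exact ge_of_tendsto' hlim fun n => key n t ht

end Iteration

/-! ### Estimates for the potential of η. -/

section Potential

variable {d₁ d₂ d' : ℕ} {t₀ T : ℝ} {h : t₀ ≤ T} {V : C(E d₁, C(Icc t₀ T, E d₁))}
  {Ψ Θ : E d₁ → C(Icc t₀ T, E d₁)} {C B M K : ℝ≥0} {g : E d₁ → (E d' →ᵇ E d₁)}
  {μ : ℝ → (E d' →ᵇ E d₁) →L[ℝ] E d₁} {b : E d₁ → E d' → E d₁} {W : Phase d₁ d₂ → ℝ} {A : ℝ}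
  {ν : ℝ → Measure (E d')} {η : ℝ → SignedMeasure (E d')} {γ₀ : Measure (Phase d₁ d₂)}
  {γ : ℝ → Measure (Phase d₁ d₂)} {ρ : ℝ → Form d₁ d₂} {u v : ℝ → Phase d₁ d₂ → ℝ}

/-- Weighted evaluation at a point. -/
noncomputable def evalW (a : E d') : (E d' →ᵇ E d₁) →L[ℝ] E d₁ :=
  weight a • BoundedContinuousFunction.evalCLM ℝ a

theorem evalW_apply (hbg : ∀ x a, b x a = weight a • g x a) (a : E d') (x : E d₁) :
    evalW a (g x) = b x a := (hbg x a).symm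

theorem norm_evalW_le (a : E d') : ‖(evalW a : (E d' →ᵇ E d₁) →L[ℝ] E d₁)‖ ≤ weight a := by
  refine ContinuousLinearMap.opNorm_le_bound _ (weight_pos a).le fun φ => ?_
  change ‖weight a • φ a‖ ≤ _
  rw [norm_smul, Real.norm_of_nonneg (weight_pos a).le]
  exact mul_le_mul_of_nonneg_left (φ.norm_coe_le_norm a) (weight_pos a).le

theorem BoundedLip.mono {w : E d₁ → E d₁} {S S' : ℝ} (hw : BoundedLip w S) (hS : S ≤ S') :
    BoundedLip w S' :=
  ⟨fun x => (hw.bound x).trans hS, fun x x' => (hw.lip x x').trans (by gcongr)⟩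

theorem IsFlow.boundedLip_pull_evalW (hF : IsFlow h V Ψ Θ C) (hg : SmoothFamily g B)
    (t : Icc t₀ T) (a : E d') :
    BoundedLip (pull Ψ Θ g t (evalW a)) ((C * B + 2 * C * C * B) * weight a) :=
  (hF.boundedLip_pull hg t _).mono (by gcongr; exact norm_evalW_le a)

theorem IsFlow.inner_gradX_lift (hF : IsFlow h V Ψ Θ C) (hbg : ∀ x a, b x a = weight a • g x a)
    (t : Icc t₀ T) {f : Phase d₁ d₂ → ℝ} (hf : Differentiable ℝ f) (a : E d')
    (z : Phase d₁ d₂) :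
    inner ℝ (b (liftC Ψ z t).1 a) (gradX f (liftC Ψ z t))
      = fderiv ℝ (fun z => f (liftC Ψ z t)) z (pull Ψ Θ g t (evalW a) z.1, 0) := by
  rw [hF.fderiv_comp_lift_pull t _ hf, inner_gradX (hf _), evalW_apply hbg]
  rfl

/-- A crude a priori bound, from the 𝒞¹₃-dual norm of ρ alone. It is needed before the displacement
can be used, as it gives the variation of η a finite weighted mass, bounded in time. -/
theorem IsFlow.abs_bracket_le (hF : IsFlow h V Ψ Θ C) (hg : SmoothFamily g B)
    (hbg : ∀ x a, b x a = weight a • g x a) (hW : QuadGrowth W A) (hu : LinearGrad t₀ T u)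
    (huW : ∀ (t : Icc t₀ T) z, u t (liftC Ψ z t) = W z) {R : ℝ≥0} {t : Icc t₀ T}
    (hR : dualNorm 1 3 (ρ t) ≤ R) (a : E d') :
    |bracket (fun z => inner ℝ (b z.1 a) (gradX (u t) z)) (ρ t)|
      ≤ R * (9 * A * (C * B + 2 * C * C * B) * (1 + C) * (1 + C) + 1) * weight a := by
  have hA := hW.nonneg
  have hw1 := (weight_pos a).le
  -- Membership need not be established: otherwise the bracket is zero by convention.
  by_cases hf : (fun z : Phase d₁ d₂ => inner ℝ (b z.1 a) (gradX (u t) z)) ∈ C22 d₁ d₂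
  · rw [bracket_of_mem hf]
    set f := fun z : Phase d₁ d₂ => inner ℝ (b z.1 a) (gradX (u t) z) with hfdef
    set N : ℝ := C * B + 2 * C * C * B with hN
    have hN0 : 0 ≤ N := by positivity
    have hf1 : ContDiff ℝ 1 f := hf.1.of_le (by norm_num)
    have hfd : Differentiable ℝ f := hf1.differentiable (by simp)
    have hp := hF.boundedLip_pull_evalW hg t a
    have hG : (fun z => f (liftC Ψ z t))
        = fun z => fderiv ℝ W z (pull Ψ Θ g t (evalW a) z.1, 0) := funext fun z => by
      rw [hfdef]
      simp only
      rw [hF.inner_gradX_lift hbg t (hu.differentiable t.2)]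
      congr 2
      exact funext fun z => huW t z
    have hfG : f = fun z => (fun z => fderiv ℝ W z (pull Ψ Θ g t (evalW a) z.1, 0))
        (liftC Θ z t) := by
      rw [← hG]
      exact funext fun z => (congrArg f (hF.lift_right_inv t z)).symm
    have hGd : Differentiable ℝ fun z : Phase d₁ d₂ =>
        fderiv ℝ W z (pull Ψ Θ g t (evalW a) z.1, 0) := by
      rw [← hG]
      exact hfd.comp (hF.tameMap t).differentiable
    have hΘ := hF.tameMap_inv (d₂ := d₂) t
    have hgw : ∀ z : Phase d₁ d₂, gw 1 (liftC Θ z t) ≤ (1 + C) * (3 * gw 3 z) := fun z => by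
      refine (hΘ.growth z).trans ?_
      push_cast
      gcongr
      exact gw_le_mul_gw (by norm_num) z
    have h0 : ∀ z, |f z| ≤ (3 * A * N * (1 + C) * (1 + C) * weight a) * gw 3 z := fun z => by
      rw [hfG]
      refine (norm_fderiv_inl_le (hW.bound _) (hp.bound _)).trans ?_
      have h2 := (gw_pos 3 z).le
      calc N * weight a * A * gw 1 (liftC Θ z t)
          ≤ N * weight a * A * ((1 + C) * (3 * gw 3 z)) := by gcongr; exact hgw z
        _ = 3 * A * N * (1 + C) * 1 * weight a * gw 3 z := by ring
        _ ≤ _ := by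
            gcongr
            exact le_add_of_nonneg_right C.2
    have h1 : ∀ z, ‖fderiv ℝ f z‖ ≤ (6 * A * N * (1 + C) * (1 + C) * weight a) * gw 3 z :=
        fun z => by
      rw [hfG, fderiv_comp_tame hGd hΘ.differentiable]
      refine (ContinuousLinearMap.opNorm_comp_le _ _).trans ?_
      have h2 := (gw_pos 3 z).le
      calc _ ≤ (2 * A * (N * weight a) * ((1 + C) * (3 * gw 3 z))) * (1 + C : ℝ≥0) := by
            gcongr
            · exact (hW.norm_fderiv_directional_le hp _).trans (by gcongr; exact hgw z)
            · exact hΘ.norm_fderiv_le z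
        _ = _ := by push_cast; ring
    have h3 := growthNorm_one_le h0 h1
    -- Here 9 = 3 + 6 adds the bounds on the function and on its differential; the 1 makes the
    -- constant positive, as the rescaling in `abs_form_le` requires.
    set D : ℝ := 9 * A * N * (1 + C) * (1 + C) + 1 with hD
    have hD0 : 0 < D := by positivity
    have h4 : growthNorm 1 3 f ≤ ((D * weight a).toNNReal : ℝ≥0) := by
      refine h3.trans (ENNReal.ofReal_le_ofReal ?_)
      rw [hD]
      nlinarith
    have h5 := abs_form_le hR (by have := weight_pos a; simp; positivity) ⟨f, hf⟩
      (by exact_mod_cast hf1) h4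
    rw [Real.coe_toNNReal _ (by positivity)] at h5
    rw [mul_assoc]
    exact h5
  · rw [bracket, dif_neg hf, abs_zero]
    positivity

theorem displacement_initial : displacement h Ψ Θ g μ t₀ = 0 :=
  funext fun _ => intervalIntegral.integral_same

/-- The potential of the linearized system is controlled by the size of the displacement. -/
theorem IsFlow.abs_potential_le (hF : IsFlow h V Ψ Θ C) (hV : FlowField V K)
    (hg : SmoothFamily g B) (hbg : ∀ x a, b x a = weight a • g x a) (hW : QuadGrowth W A)
    (hμ : PairingFamily μ M) (hdrift : ∀ (t : Icc t₀ T) x, drift b (ν t) x = V x t)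
    (hη : ∀ t ∈ Icc t₀ T, ∀ x, driftSigned b (η t) x = μ t (g x)) (hγ₀ : MemP 3 γ₀)
    (hγ : ∀ t : Icc t₀ T, γ t = γ₀.map fun z => liftC Ψ z t) (hu : LinearGrad t₀ T u)
    (huW : ∀ (t : Icc t₀ T) z, u t (liftC Ψ z t) = W z)
    (hρ : SolvesLinContinuity b t₀ T ν γ η ρ) (hv : SolvesLinAdjoint b t₀ T ν u η v)
    (hv0 : ∀ w : E d₁ → E d₁, Continuous w → ∀ S, (∀ x, ‖w x‖ ≤ S) →
      ∫ z, fderiv ℝ (v t₀) z (w z.1, 0) ∂γ₀ = 0)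
    (t : Icc t₀ T) {S : ℝ} (hS : BoundedLip (displacement h Ψ Θ g μ t) S) (a : E d') :
    |bracket (fun z => inner ℝ (b z.1 a) (gradX (u t) z)) (ρ t) +
        ∫ z, inner ℝ (b z.1 a) (gradX (v t) z) ∂(γ t)|
      ≤ 4 * A * (C * B + 2 * C * C * B) * (∫ z, gw 1 z ∂γ₀) * S * weight a := by
  have hA := hW.nonneg
  have hw1 := (weight_pos a).le
  have hS0 := hS.nonneg
  set N : ℝ := C * B + 2 * C * C * B with hN
  have hN0 : 0 ≤ N := by positivity
  set ξ := displacement h Ψ Θ g μ t with hξ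
  have hp := hF.boundedLip_pull_evalW hg t a
  set w := pull Ψ Θ g t (evalW a) with hw
  have hvg := linearGrad_of_continuousIn hv.1
  have ht₀ : t₀ ∈ Icc t₀ T := left_mem_Icc.2 h
  have hM := hF.tameMap (d₂ := d₂) t
  have hi1 := hγ₀.integrable_gw (q := 1) (by norm_num)
  have hI : ∀ F : Phase d₁ d₂ → ℝ, (∀ z, ‖F z‖ ≤ 2 * A * N * S * weight a * gw 1 z) →
      |∫ z, F z ∂γ₀| ≤ 2 * A * N * (∫ z, gw 1 z ∂γ₀) * S * weight a := fun F hF' => by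
    have := norm_integral_le_of_norm_le (hi1.const_mul (2 * A * N * S * weight a))
      (ae_of_all _ hF')
    rw [integral_const_mul, Real.norm_eq_abs] at this
    linarith
  have hbr : |bracket (fun z => inner ℝ (b z.1 a) (gradX (u t) z)) (ρ t)|
      ≤ 2 * A * N * (∫ z, gw 1 z ∂γ₀) * S * weight a := by
    by_cases hf : (fun z : Phase d₁ d₂ => inner ℝ (b z.1 a) (gradX (u t) z)) ∈ C22 d₁ d₂
    · rw [hF.linContinuity_eq hV hg hμ hdrift hη hγ₀ hγ hρ t hf]
      refine hI _ fun z => ?_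
      have hG : (fun z => inner ℝ (b (liftC Ψ z t).1 a) (gradX (u t) (liftC Ψ z t)))
          = fun z => fderiv ℝ W z (w z.1, 0) := funext fun z => by
        rw [hF.inner_gradX_lift hbg t (hu.differentiable t.2)]
        congr 2
        exact funext fun z => huW t z
      rw [hG]
      refine (norm_fderiv_inl_le (hW.norm_fderiv_directional_le hp z) (hS.bound z.1)).trans_eq ?_
      ring
    · rw [bracket, dif_neg hf, abs_zero]
      have : 0 ≤ ∫ z, gw 1 z ∂γ₀ := integral_nonneg fun z => (gw_pos 1 z).le
      positivity
  have hvd : Differentiable ℝ (v t) := hvg.differentiable t.2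
  have hv0s := hvg.smooth t₀ ht₀
  have hvts : ContDiff ℝ 1 fun z => v t (liftC Ψ z t) :=
    (hvg.smooth t t.2).comp (hM.smooth.of_le (by norm_num))
  -- ξ_t is only known to be Lipschitz, yet DW · ξ_t is C¹, being the difference of v at time t₀ and
  -- of v_t transported by the flow. The vanishing of ξ at time t₀ enters here.
  have hH : (fun z : Phase d₁ d₂ => fderiv ℝ W z (ξ z.1, 0))
      = fun z => v t₀ z - v t (liftC Ψ z t) := funext fun z => by
    have e1 := hF.linAdjoint_eq hg hμ hdrift hη hu huW hv t z
    have e2 := hF.linAdjoint_eq hg hμ hdrift hη hu huW hv ⟨t₀, ht₀⟩ z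
    rw [hF.lift_initial] at e2
    simp only [displacement_initial, Pi.zero_apply, sub_zero] at e2
    have e3 : ((ξ z.1, 0) : Phase d₁ d₂) = (displacement h Ψ Θ g μ T z.1, 0)
        - (displacement h Ψ Θ g μ T z.1 - displacement h Ψ Θ g μ t z.1, 0) := by simp [hξ]
    rw [e1, e2, e3, map_sub]
  have hHs : ContDiff ℝ 1 fun z : Phase d₁ d₂ => fderiv ℝ W z (ξ z.1, 0) := by
    rw [hH]; exact hv0s.sub hvts
  -- The decisive cancellation: after pulling back, the contribution of the future displacement ξ_T
  -- is that of v at time t₀, which integrates to zero along w. Only ξ_t remains.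
  have hvt : ∫ z, inner ℝ (b z.1 a) (gradX (v t) z) ∂(γ t)
      = -∫ z, fderiv ℝ (fun z : Phase d₁ d₂ => fderiv ℝ W z (ξ z.1, 0)) z (w z.1, 0) ∂γ₀ := by
    have hcont : Continuous fun z : Phase d₁ d₂ => inner ℝ (b z.1 a) (gradX (v t) z) := by
      refine Continuous.inner ?_ (continuous_gradX (hvg.smooth t t.2))
      have : Continuous fun z : Phase d₁ d₂ => (evalW a : (E d' →ᵇ E d₁) →L[ℝ] E d₁) (g z.1) :=
        (evalW a).continuous.comp (hg.smooth.continuous.comp continuous_fst)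
      exact this.congr fun z => evalW_apply hbg a z.1
    rw [hγ t, integral_map (hF.measurable_liftC t).aemeasurable hcont.aestronglyMeasurable]
    have e1 : ∀ z, inner ℝ (b (liftC Ψ z t).1 a) (gradX (v t) (liftC Ψ z t))
        = fderiv ℝ (v t₀) z (w z.1, 0)
          - fderiv ℝ (fun z : Phase d₁ d₂ => fderiv ℝ W z (ξ z.1, 0)) z (w z.1, 0) := fun z => by
      rw [hF.inner_gradX_lift hbg t hvd, ← sub_apply]
      congr 1
      rw [hH, fderiv_fun_sub (hv0s.differentiable (by simp) z) (hvts.differentiable (by simp) z)]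
      abel
    obtain ⟨c, hc⟩ := hvg.growth t₀ ht₀
    have i1 : Integrable (fun z : Phase d₁ d₂ => fderiv ℝ (v t₀) z (w z.1, 0)) γ₀ :=
      hγ₀.integrable_of_norm_le (q := 1) (by norm_num) (continuous_fderiv_apply_inl hv0s
        (hp.continuous.comp continuous_fst)).aestronglyMeasurable
        fun z => norm_fderiv_inl_le (hc z) (hp.bound z.1)
    have i2 : Integrable (fun z : Phase d₁ d₂ =>
        fderiv ℝ (fun z : Phase d₁ d₂ => fderiv ℝ W z (ξ z.1, 0)) z (w z.1, 0)) γ₀ :=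
      hγ₀.integrable_of_norm_le (q := 1) (by norm_num) (continuous_fderiv_apply_inl hHs
        (hp.continuous.comp continuous_fst)).aestronglyMeasurable
        fun z => norm_fderiv_inl_le (hW.norm_fderiv_directional_le hS z) (hp.bound z.1)
    rw [integral_congr_ae (ae_of_all _ e1), integral_sub i1 i2,
      hv0 w hp.continuous _ hp.bound, zero_sub]
  have hvb : |∫ z, inner ℝ (b z.1 a) (gradX (v t) z) ∂(γ t)|
      ≤ 2 * A * N * (∫ z, gw 1 z ∂γ₀) * S * weight a := by
    rw [hvt, abs_neg]
    refine hI _ fun z => ?_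
    refine (norm_fderiv_inl_le (hW.norm_fderiv_directional_le hS z) (hp.bound z.1)).trans_eq ?_
    ring
  refine (abs_add_le _ _).trans ((add_le_add hbr hvb).trans_eq ?_)
  ring

end Potential

/-! ### Conclusion of the uniqueness argument. -/

section Uniqueness

variable {d₁ d₂ d' : ℕ} {t₀ T ε : ℝ} {b : E d₁ → E d' → E d₁} {ℓ : E d' → ℝ}
  {L : Phase d₁ d₂ → ℝ} {γ₀ : Measure (Phase d₁ d₂)} {ν : ℝ → Measure (E d')}
  {γ : ℝ → Measure (Phase d₁ d₂)} {u v : ℝ → Phase d₁ d₂ → ℝ} {η : ℝ → SignedMeasure (E d')}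
  {ρ : ℝ → Form d₁ d₂}

theorem bracket_of_form_eq_zero (φ : Phase d₁ d₂ → ℝ) : bracket φ (0 : Form d₁ d₂) = 0 := by
  unfold bracket
  split <;> rfl

/-- The potential of the linearized perturbation `η_t`. -/
noncomputable def potential (b : E d₁ → E d' → E d₁) (γ : Measure (Phase d₁ d₂))
    (u : Phase d₁ d₂ → ℝ) (ρ : Form d₁ d₂) (v : Phase d₁ d₂ → ℝ) (a : E d') : ℝ :=
  bracket (fun z => inner ℝ (b z.1 a) (gradX u z)) ρ + ∫ z, inner ℝ (b z.1 a) (gradX v z) ∂γ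

theorem exists_abs_integral_coefficient_le (hreg : RegularData b ℓ L) (hγ : ContinuousInP2 t₀ T γ)
    (hv : LinearGrad t₀ T v) : ∃ D : ℝ≥0, ∀ t ∈ Icc t₀ T, ∀ a,
      |∫ z, inner ℝ (b z.1 a) (gradX (v t) z) ∂(γ t)| ≤ D * weight a := by
  obtain ⟨B, hB⟩ := exists_linear_bound hreg
  obtain ⟨C, hC⟩ := hv.exists_bound
  obtain ⟨M, hM⟩ := exists_bound_integral_gw hγ
  refine ⟨B * C * M * 2, fun t ht a => ?_⟩
  refine (abs_integral_coefficient_le hB (hγ.1 t ht) (hv.differentiable ht) (hC t ht) a).trans ?_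
  have h1 : 1 + ‖a‖ ≤ 2 * weight a := by
    have := pow_le_weight a (j := 1) (by norm_num)
    have := one_le_weight a
    rw [pow_one] at *
    linarith
  calc _ ≤ (B * C * M : ℝ) * (2 * weight a) := by
        gcongr
        exact hM t ht
    _ = _ := by push_cast; ring

/-- A perturbation which vanishes at the initial time has an initial adjoint state with vanishing
mean gradient in every direction depending on the feature only. -/
theorem integral_fderiv_initial_eq_zero (h : t₀ ≤ T) (hreg : RegularData b ℓ L)
    (hdis : Discriminating b) (hε : 0 < ε) (hγ₀ : MemP 2 (γ t₀)) {dom : E d' → ℝ}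
    (hp : GibbsFamily t₀ T (fun t => gibbsDensity b ℓ ε (γ t) (u t)) dom)
    (hv : LinearGrad t₀ T v) {c D : ℝ}
    (hD : ∀ a, |potential b (γ t₀) (u t₀) (ρ t₀) (v t₀) a| ≤ D * weight a)
    (hη : η t₀ = volume.withDensityᵥ fun a => -(gibbsDensity b ℓ ε (γ t₀) (u t₀) a / ε) *
      (potential b (γ t₀) (u t₀) (ρ t₀) (v t₀) a - c))
    (hη₀ : η t₀ = 0) (hρ₀ : ρ t₀ = 0) {w : E d₁ → E d₁} (hw : Continuous w) {S : ℝ}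
    (hS : ∀ x, ‖w x‖ ≤ S) : ∫ z, fderiv ℝ (v t₀) z (w z.1, 0) ∂(γ t₀) = 0 := by
  have ht₀ : t₀ ∈ Icc t₀ T := left_mem_Icc.2 h
  obtain ⟨C, hC⟩ := hv.growth t₀ ht₀
  have hq : potential b (γ t₀) (u t₀) (ρ t₀) (v t₀)
      = fun a => ∫ z, inner ℝ (b z.1 a) (gradX (v t₀) z) ∂(γ t₀) := funext fun a => by
    rw [potential, hρ₀, bracket_of_form_eq_zero, zero_add]
  rw [hη₀] at hη
  rw [hq] at hη hD
  have hc := hp.potential_eq_of_eq_zero hε ht₀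
    (continuous_integral_coefficient hreg hγ₀ (hv.smooth t₀ ht₀) hC) hη hD
  -- The potential is constant in a, and it vanishes at a = 0 because b does.
  have hc0 : c = 0 := by
    rw [← hc 0]
    simp [hreg.b_zero]
  exact hdis.integral_fderiv_eq_zero hγ₀ (hv.smooth t₀ ht₀) hC
    (fun a => (hc a).trans hc0) hw hS

/-- The unknown is η, seen through its weighted pairing μ with bounded continuous functions. Its
norm at time t is bounded by the potential, the potential by the displacement at time t, and the
displacement by the integral of ‖μ‖ up to t. Once μ vanishes the displacement does, and the
representation formulas give ρ = 0 and v = 0. -/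
theorem linearized_eq_zero (h : t₀ ≤ T) (hreg : RegularData b ℓ L) (hdis : Discriminating b)
    (hε : 0 < ε) (hγ₀ : MemP 3 γ₀) (hsol : SolvesFirstOrder b ℓ L ε t₀ T γ₀ ν γ u)
    (hlin : SolvesLinearized b ℓ ε t₀ T ν γ u η ρ v) (hη₀ : η t₀ = 0) :
    ∀ t ∈ Icc t₀ T, η t = 0 ∧ ρ t = 0 ∧ v t = 0 := by
  have := hγ₀.1
  obtain ⟨g, B, hg, hbg⟩ := exists_coefficient hreg
  have hu := linearGrad_of_solvesAdjoint hsol.adjoint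
  have hv := linearGrad_of_continuousIn hlin.linAdjoint.1
  obtain ⟨dom, hp⟩ := exists_gibbsFamily hreg hε hsol.continuity.1 hu
  have hV := flowField_comp (hp.expectC h (E d₁)) hg.smooth hg.bdd hg.lip hg.lip_fderiv
  obtain ⟨Ψ, Θ, C, hF⟩ := exists_isFlow h hV
  have hdrift := fun (t : Icc t₀ T) x => drift_eq_expectC hp h hbg (hsol.gibbs t t.2) x
  have hγ := fun t => hF.eq_map hV hdrift hsol.continuity t
  have huW := fun t z => hF.adjoint_eq hdrift hsol.adjoint t z
  obtain ⟨A₀, hA₀⟩ := exists_quadGrowth hreg.L_smooth hreg.L_growth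
  have hW := hA₀.comp (hF.tameMap (d₂ := d₂) ⟨T, right_mem_Icc.2 h⟩)
  set W : Phase d₁ d₂ → ℝ := fun z => L (liftC Ψ z ⟨T, right_mem_Icc.2 h⟩)
  set A : ℝ := A₀ * (1 + C : ℝ≥0) * (1 + C : ℝ≥0) * ((1 + C : ℝ≥0) + 1)
    + A₀ * (1 + C : ℝ≥0) * (1 + C : ℝ≥0)
  have hA := hW.nonneg
  obtain ⟨R, hR⟩ := hlin.linContinuity.1.2.2.1
  obtain ⟨c, hc⟩ := hlin.formula
  let q : ℝ → E d' → ℝ := fun t => potential b (γ t) (u t) (ρ t) (v t)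
  have hmass := hlin.perturbation.mass
  -- The time-uniform starting bound of the iteration; it also makes the weighted pairing with η
  -- well defined.
  obtain ⟨D, hD0, hD⟩ : ∃ D : ℝ, 0 ≤ D ∧ ∀ t ∈ Icc t₀ T, ∀ a, |q t a| ≤ D * weight a := by
    obtain ⟨D₁, hD₁⟩ := exists_abs_integral_coefficient_le hreg hsol.continuity.1 hv
    refine ⟨R * (9 * A * (C * B + 2 * C * C * B) * (1 + C) * (1 + C) + 1) + D₁, by positivity,
      fun t ht a => ?_⟩
    rw [add_mul]
    exact (abs_add_le _ _).trans (add_le_add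
      (hF.abs_bracket_le hg hbg hW hu huW (t := ⟨t, ht⟩) (hR t ht) a) (hD₁ t ht a))
  have hdom : 0 ≤ ∫ a, dom a := integral_nonneg (hp.dom_nonneg h)
  set κ : ℝ := (1 + ∫ a, dom a) / ε * ∫ a, dom a with hκ
  have hκ0 : 0 ≤ κ := by positivity
  have hvar : ∀ t : Icc t₀ T, Integrable weight (η t).variation := fun t =>
    (hp.integrable_weight_variation h hε t.2 (hmass t t.2) (hc t t.2) hD0 (hD t t.2)).1
  let μI : Icc t₀ T → (E d' →ᵇ E d₁) →L[ℝ] E d₁ := fun t => pairing (η t) (hvar t) (E d₁)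
  have hμI : ∀ (t : Icc t₀ T) (D : ℝ), 0 ≤ D → (∀ a, |q t a| ≤ D * weight a) →
      ‖μI t‖ ≤ κ * D := fun t D hD0 hD =>
    (norm_pairing_le _ _).trans
      (hp.integrable_weight_variation h hε t.2 (hmass t t.2) (hc t t.2) hD0 hD).2
  -- Clamping time makes measurability and boundedness hold on the whole line, where the interval
  -- integrals are formed.
  let μ : ℝ → (E d' →ᵇ E d₁) →L[ℝ] E d₁ := fun r => μI (projIcc t₀ T h r)
  have hμ : PairingFamily μ (κ * D).toNNReal := by
    refine ⟨fun φ => ?_, fun r => ?_⟩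
    · exact (measurable_pairing (η := fun t : Icc t₀ T => η t) hlin.perturbation.meas hvar φ).comp
        (continuous_projIcc (h := h)).measurable
    · rw [Real.coe_toNNReal _ (by positivity)]
      exact hμI _ D hD0 (hD _ (projIcc t₀ T h r).2)
  have hη : ∀ t ∈ Icc t₀ T, ∀ x, driftSigned b (η t) x = μ t (g x) := fun t ht x => by
    simp only [μ]
    rw [projIcc_of_mem h ht]
    exact driftSigned_eq_pairing hbg _ (hvar ⟨t, ht⟩) x
  have ht₀ : t₀ ∈ Icc t₀ T := left_mem_Icc.2 h
  have hγt₀ : γ t₀ = γ₀ := by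
    rw [hγ ⟨t₀, ht₀⟩]
    have : (fun z : Phase d₁ d₂ => liftC Ψ z ⟨t₀, ht₀⟩) = id := funext fun z => hF.lift_initial z
    rw [this, Measure.map_id]
  have hv0 : ∀ w : E d₁ → E d₁, Continuous w → ∀ S, (∀ x, ‖w x‖ ≤ S) →
      ∫ z, fderiv ℝ (v t₀) z (w z.1, 0) ∂γ₀ = 0 := fun w hw S hS => by
    rw [← hγt₀]
    exact integral_fderiv_initial_eq_zero h hreg hdis hε (hsol.continuity.1.1 t₀ ht₀) hp hv
      (hD t₀ ht₀) (hc t₀ ht₀) hη₀ hlin.linContinuity.2.1 hw hS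
  have hpot := fun (t : Icc t₀ T) S (hS : BoundedLip (displacement h Ψ Θ g μ t) S) a =>
    hF.abs_potential_le hV hg hbg hW hμ hdrift hη hγ₀ hγ hu huW hlin.linContinuity hlin.linAdjoint
      hv0 t hS a
  have hI0 : 0 ≤ ∫ z, gw 1 z ∂γ₀ := integral_nonneg fun z => (gw_pos 1 z).le
  set N : ℝ := C * B + 2 * C * C * B with hN
  have hN0 : 0 ≤ N := by positivity
  -- In the constant, one N comes from the displacement and the other from the pulled-back
  -- coefficient in the potential; κ passes from the potential to η.
  have hzero : ∀ t ∈ Icc t₀ T, ‖μ t‖ ≤ 0 := by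
    refine nonpos_of_iterated_bound (M := (κ * D).toNNReal)
      (K := κ * (4 * A * N * (∫ z, gw 1 z ∂γ₀) * N)) hμ.bdd fun t ht β hβ hb => ?_
    have hS := hF.boundedLip_displacement hg hμ ht.1 hβ hb
    have h1 := hμI ⟨t, ht⟩ _ (mul_nonneg (by positivity) hS.nonneg) (hpot ⟨t, ht⟩ _ hS)
    simp only [μ]
    rw [projIcc_of_mem h ht]
    refine h1.trans_eq ?_
    ring
  have hξ : ∀ t ∈ Icc t₀ T, BoundedLip (displacement h Ψ Θ g μ t) 0 := fun t ht => by
    have := hF.boundedLip_displacement hg hμ ht.1 (β := fun _ => 0) continuous_const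
      fun r hr => hzero r ⟨hr.1, hr.2.trans ht.2⟩
    simpa using this
  have hξ0 : ∀ t ∈ Icc t₀ T, ∀ x, displacement h Ψ Θ g μ t x = 0 := fun t ht x =>
    norm_le_zero_iff.1 ((hξ t ht).bound x)
  have hz : ((0, 0) : Phase d₁ d₂) = 0 := rfl
  intro t ht
  refine ⟨?_, ?_, ?_⟩
  · refine hp.eq_zero_of_potential_eq_zero h hε ht (hmass t ht) (hc t ht) fun a => ?_
    have := hpot ⟨t, ht⟩ 0 (hξ t ht) a
    simpa using this
  · ext φ
    have := hF.linContinuity_eq hV hg hμ hdrift hη hγ₀ hγ hlin.linContinuity ⟨t, ht⟩ φ.2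
    rw [bracket_of_mem φ.2] at this
    simp only [hξ0 t ht, hz, map_zero, integral_zero] at this
    exact this
  · funext z
    have := hF.linAdjoint_eq hg hμ hdrift hη hu huW hlin.linAdjoint ⟨t, ht⟩
      (liftC Θ z ⟨t, ht⟩)
    rw [hF.lift_right_inv] at this
    simp only [hξ0 t ht, hξ0 T (right_mem_Icc.2 h), sub_zero, hz, map_zero] at this
    exact this

end Uniqueness

end NeuralODE

theorem mainTheorem6 {d₁ d₂ d' : ℕ} (hd₁ : 1 ≤ d₁) (hd₂ : 1 ≤ d₂) (hd' : 1 ≤ d')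
    (b : NeuralODE.E d₁ → NeuralODE.E d' → NeuralODE.E d₁)
    (ℓ : NeuralODE.E d' → ℝ) (L : NeuralODE.Phase d₁ d₂ → ℝ)
    (hreg : NeuralODE.RegularData b ℓ L) (hdis : NeuralODE.Discriminating b)
    (ε T t₀ : ℝ) (hε : 0 < ε) (hT : 0 < T) (ht₀ : t₀ ∈ Set.Icc 0 T)
    (γ₀ : MeasureTheory.Measure (NeuralODE.Phase d₁ d₂)) (hγ₀ : NeuralODE.MemP 3 γ₀)
    (ν : ℝ → MeasureTheory.Measure (NeuralODE.E d'))
    (γ : ℝ → MeasureTheory.Measure (NeuralODE.Phase d₁ d₂))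
    (u : ℝ → NeuralODE.Phase d₁ d₂ → ℝ)
    (hsol : NeuralODE.SolvesFirstOrder b ℓ L ε t₀ T γ₀ ν γ u)
    (η : ℝ → MeasureTheory.SignedMeasure (NeuralODE.E d'))
    (ρ : ℝ → NeuralODE.Form d₁ d₂)
    (v : ℝ → NeuralODE.Phase d₁ d₂ → ℝ)
    (hlin : NeuralODE.SolvesLinearized b ℓ ε t₀ T ν γ u η ρ v)
    (hη₀ : η t₀ = 0) :
    ∀ t ∈ Set.Icc t₀ T, η t = 0 ∧ ρ t = 0 ∧ v t = 0 :=
  NeuralODE.linearized_eq_zero ht₀.2 hreg hdis hε hγ₀ hsol hlin hη₀
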